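/- Let $n\ge 2$ and $B_1^+=B_1\cap\{x_n>0\}$, $B_r'=B_r\cap\{x_n=0\}$ in $\mathbb R^n$, $x=(x',x_n)$. For $k\in\mathbb N$ and a constant $M$, let $\mathfrak S_k(M)$ be the class of functions $u$ on $B_1$, even in $x_n$, with $u\in C^{1,\alpha}_{\rm loc}(B_1^+\cup B_1')$ for some $\alpha\in(0,1)$, such that: (a) the distributional Laplacian of $u$ in $B_1^+$ is a measurable function with $|\Delta u|\le M|x'|^{k-1}$ a.e. in $B_1^+$; (b) $u\ge 0$, $-\partial_{x_n}u\ge 0$ and $u\,\partial_{x_n}u=0$ on $B_1'$, where $\partial_{x_n}u$ is the one-sided derivative from $\{x_n>0\}$; (c) $0\in\Gamma(u)$, the boundary, relative to $B_1'$, of the coincidence set $\Lambda(u)=\{x\in B_1' : u(x)=0\}$; (d) $|u|\le M$ and $|\nabla u|\le M$ in $B_1^+\cup B_1'$. Put $H(r)=\int_{\partial B_r}u^2$ and, for a constant $C>0$, $$\Phi_k(r,u)=(r+Cr^2)\frac{d}{dr}\log\max\{H(r),r^{n-1+2k}\},$$ where $\frac{d}{dr}\log r^{n-1+2k}$ is taken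 if $H(r)\le r^{n-1+2k}$ and $\frac{d}{dr}\log H(r)$ if $H(r)>r^{n-1+2k}$; the limit $\Phi_k(0+,u)$ does not depend on $C$. For $u\in\mathfrak S_k(M)$ and $\kappa<k$ we write $0\in\Sigma_\kappa(u)$ if $\Phi_k(0+,u)=n-1+2\kappa$ and $$\lim_{r\to0+}\frac{\mathcal H^{n-1}(\Lambda(u)\cap B_r')}{\mathcal H^{n-1}(B_r')}=0.$$ Let $\mathfrak P_\kappa$ be the set of harmonic homogeneous polynomials $p_\kappa$ of degree $\kappa$ on $\mathbb R^n$ with $p_\kappa(x',0)\ge 0$ for all $x'$. **Theorem (Monneau type monotonicity formula, nonzero obstacle).** Let $n\ge2$, $m,k\in\mathbb N$, $m\ge1$, $\kappa=2m<k$, and let $M$ be given. There exist $r_M\in(0,1]$ and $C_M\ge0$, depending only on $n,k,m,M$, such that for every $u\in\mathfrak S_k(M)$ with $0\in\Sigma_\kappa(u)$ and every $p_\kappa\in\mathfrak P_\kappa$ the function $$M_\kappa(r,u,p_\kappa)=\frac1{r^{n-1+2\kappa}}\int_{\partial B_r}(u-p_\kappa)^2$$ is differentiable on $(0,r_M)$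 and satisfies $$\frac{d}{dr}M_\kappa(r,u,p_\kappa)\ge -C_M\left(1+\|p_\kappa\|_{L^2(B_1)}\right)\qquad\text{for }0<r<r_M.$$ -/

import Mathlib

open MeasureTheory Set Filter Topology Metric
open scoped ContDiff

noncomputable section

namespace ThinObstacle

/-- The space `ℝⁿ` with `n = d + 1`, so that `n - 1 = d`; the last coordinate is `x_n`. -/
abbrev Space (d : ℕ) : Type := EuclideanSpace ℝ (Fin (d + 1))

/-- The coordinate `x_n`. -/
def lastCoord {d : ℕ} (x : Space d) : ℝ := x (Fin.last d)

/-- The unit vector in the direction of `x_n`. -/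
def lastVec (d : ℕ) : Space d := EuclideanSpace.single (Fin.last d) (1 : ℝ)

/-- The tangential part `x'` of `x = (x', x_n)`. -/
def tang {d : ℕ} (x : Space d) : EuclideanSpace ℝ (Fin d) :=
  WithLp.toLp 2 (fun i => x i.castSucc)

/-- The reflection `(x', x_n) ↦ (x', -x_n)`. -/
def reflect {d : ℕ} (x : Space d) : Space d := x - (2 * lastCoord x) • lastVec d

/-- The open upper half ball `B₁⁺`. -/
def upperHalfBall (d : ℕ) : Set (Space d) := {x | ‖x‖ < 1 ∧ 0 < lastCoord x}

/-- The set `B₁⁺ ∪ B₁'`. -/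
def upperBall (d : ℕ) : Set (Space d) := {x | ‖x‖ < 1 ∧ 0 ≤ lastCoord x}

/-- The thin ball `B_r'`. -/
def thinBall (d : ℕ) (r : ℝ) : Set (Space d) := {x | ‖x‖ < r ∧ lastCoord x = 0}

/-- The full first derivative of `u` on `B₁⁺ ∪ B₁'`; at points of `B₁'` it is taken from the
side `{x_n ≥ 0}`. -/
def grad {d : ℕ} (u : Space d → ℝ) (x : Space d) : Space d →L[ℝ] ℝ :=
  fderivWithin ℝ u (upperBall d) x

/-- The derivative `∂_{x_n} u`; at points of `B₁'` it is the one-sided derivative from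
`{x_n > 0}`. -/
def normalDeriv {d : ℕ} (u : Space d → ℝ) (x : Space d) : ℝ := grad u x (lastVec d)

/-- `u ∈ C^{1,α}(B₁⁺ ∪ B₁')` for some `0 < α < 1`: `u` is continuously differentiable up to `B₁'`
and its gradient is `α`-Hölder on every smaller half ball. -/
def IsC1Holder {d : ℕ} (u : Space d → ℝ) : Prop :=
  ContDiffOn ℝ 1 u (upperBall d) ∧
    ∃ α : ℝ, 0 < α ∧ α < 1 ∧ ∀ R : ℝ, 0 < R → R < 1 → ∃ C : ℝ,
      ∀ x ∈ upperBall d, ∀ y ∈ upperBall d, ‖x‖ ≤ R → ‖y‖ ≤ R →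
        ‖grad u x - grad u y‖ ≤ C * ‖x - y‖ ^ α

/-- `Δu = f` in `B₁⁺` in the sense of distributions. -/
def HasWeakLaplacian {d : ℕ} (u f : Space d → ℝ) : Prop :=
  ∀ ζ : Space d → ℝ, ContDiff ℝ ∞ ζ → HasCompactSupport ζ → tsupport ζ ⊆ upperHalfBall d →
    ∫ x in upperHalfBall d, u x * Laplacian.laplacian ζ x =
      ∫ x in upperHalfBall d, f x * ζ x

/-- The distributional Laplacian of `u` in `B₁⁺` is a measurable function
with `|Δu| ≤ M |x'|^{k-1}` almost everywhere. -/
def LaplacianBound {d : ℕ} (k : ℕ) (M : ℝ) (u : Space d → ℝ) : Prop :=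
  ∃ f : Space d → ℝ, Measurable f ∧
    (∀ᵐ x ∂(volume.restrict (upperHalfBall d)), |f x| ≤ M * ‖tang x‖ ^ (k - 1)) ∧
    HasWeakLaplacian u f

/-- The coincidence set `Λ(u) = {x ∈ B₁' : u(x) = 0}`. -/
def coincidenceSet {d : ℕ} (u : Space d → ℝ) : Set (Space d) := {x ∈ thinBall d 1 | u x = 0}

/-- The free boundary `Γ(u)`: the boundary of `Λ(u)` in the relative topology of `B₁'`. -/
def freeBoundary {d : ℕ} (u : Space d → ℝ) : Set (Space d) :=
  Subtype.val '' frontier (Subtype.val ⁻¹' coincidenceSet u : Set (thinBall d 1))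

/-- The class `𝔖_k(M)` of normalized solutions, extended to `B₁` by even symmetry in `x_n`. -/
structure IsNormalizedSolution {d : ℕ} (k : ℕ) (M : ℝ) (u : Space d → ℝ) : Prop where
  even : ∀ x : Space d, ‖x‖ < 1 → u (reflect x) = u x
  regular : IsC1Holder u
  laplacian_le : LaplacianBound k M u
  nonneg : ∀ x ∈ thinBall d 1, 0 ≤ u x
  normal_nonneg : ∀ x ∈ thinBall d 1, 0 ≤ -normalDeriv u x
  complementarity : ∀ x ∈ thinBall d 1, u x * normalDeriv u x = 0
  zero_mem : (0 : Space d) ∈ freeBoundary u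
  bound : ∀ x ∈ upperBall d, |u x| ≤ M
  grad_bound : ∀ x ∈ upperBall d, ‖grad u x‖ ≤ M

/-- The surface integral `∫_{∂B_r} f` with respect to the `(n-1)`-dimensional surface measure. -/
def sphereIntegral {d : ℕ} (r : ℝ) (f : Space d → ℝ) : ℝ :=
  r ^ d * ∫ y : sphere (0 : Space d) 1, f (r • (y : Space d)) ∂(volume : Measure (Space d)).toSphere

/-- `H(r) = ∫_{∂B_r} u²`. -/
def height {d : ℕ} (u : Space d → ℝ) (r : ℝ) : ℝ := sphereIntegral r (fun x => u x ^ 2)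

/-- The generalized frequency
`Φ_k(r, u) = (r + C r²) (d/dr) log max {H(r), r^{n-1+2k}}`. This derivative is determined for almost
every `r`; as usual, the representative is the one given by the derivative of `log r^{n-1+2k}` where
`H(r) ≤ r^{n-1+2k}` and by the derivative of `log H(r)` where `H(r) > r^{n-1+2k}`. -/
def genFrequency {d : ℕ} (k : ℕ) (C : ℝ) (u : Space d → ℝ) (r : ℝ) : ℝ :=
  open Classical in
  if height u r ≤ r ^ (d + 2 * k) then (1 + C * r) * ((d : ℝ) + 2 * (k : ℝ))
  else (r + C * r ^ 2) * (deriv (height u) r / height u r)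

/-- `Φ_k(0+, u) = l`. The constant `C` in `Φ_k` has no influence on the limit, see
`frequencyLimit_iff`. -/
def FrequencyLimit {d : ℕ} (k : ℕ) (u : Space d → ℝ) (l : ℝ) : Prop :=
  ∃ C : ℝ, 0 < C ∧ Tendsto (genFrequency k C u) (𝓝[>] (0 : ℝ)) (𝓝 l)

theorem genFrequency_factor {d : ℕ} (k : ℕ) (C : ℝ) (u : Space d → ℝ) (r : ℝ) :
    genFrequency k C u r = (1 + C * r) * genFrequency k 0 u r := by
  unfold genFrequency
  split_ifs <;> ring

theorem frequencyLimit_iff {d : ℕ} (k : ℕ) (u : Space d → ℝ) (l C : ℝ) (hC : 0 < C) :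
    FrequencyLimit k u l ↔ Tendsto (genFrequency k C u) (𝓝[>] (0 : ℝ)) (𝓝 l) := by
  refine ⟨?_, fun h => ⟨C, hC, h⟩⟩
  rintro ⟨C₀, hC₀, h⟩
  have hlin : ∀ A : ℝ, Tendsto (fun r : ℝ => 1 + A * r) (𝓝[>] (0 : ℝ)) (𝓝 1) := by
    intro A
    have hc : Continuous (fun r : ℝ => 1 + A * r) := by fun_prop
    have := hc.tendsto (0 : ℝ)
    simp only [mul_zero, add_zero] at this
    exact this.mono_left nhdsWithin_le_nhds
  have h2 := ((hlin C).div (hlin C₀) one_ne_zero).mul h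
  simp only [div_one, one_mul] at h2
  refine h2.congr' ?_
  filter_upwards [self_mem_nhdsWithin] with r hr
  have hr' : (0 : ℝ) < r := hr
  have hpos : (0 : ℝ) < 1 + C₀ * r := by positivity
  simp only [Pi.div_apply]
  rw [genFrequency_factor k C₀ u r, genFrequency_factor k C u r]
  field_simp

/-- `0 ∈ Σ_κ(u)` for `u` in the class `𝔖_k`: the origin is a free boundary point,
`Φ_k(0+, u) = n - 1 + 2κ`, and the coincidence set has vanishing `(n-1)`-dimensional Hausdorff
density at the origin. -/
structure IsSingularOrigin {d : ℕ} (k : ℕ) (κ : ℝ) (u : Space d → ℝ) : Prop where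
  mem_freeBoundary : (0 : Space d) ∈ freeBoundary u
  frequency : FrequencyLimit k u ((d : ℝ) + 2 * κ)
  density : Tendsto
    (fun r : ℝ => Measure.hausdorffMeasure (d : ℝ) (coincidenceSet u ∩ thinBall d r) /
      Measure.hausdorffMeasure (d : ℝ) (thinBall d r))
    (𝓝[>] (0 : ℝ)) (𝓝 0)

/-- The value of a polynomial at a point of `ℝⁿ`. -/
def polyFun {d : ℕ} (p : MvPolynomial (Fin (d + 1)) ℝ) (x : Space d) : ℝ :=
  MvPolynomial.eval (fun i => x i) p

/-- The class `𝔓_κ` of `κ`-homogeneous harmonic polynomials that are nonnegative on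
`{x_n = 0}`. -/
structure IsAdmissiblePoly {d : ℕ} (κ : ℕ) (p : MvPolynomial (Fin (d + 1)) ℝ) : Prop where
  homogeneous : p.IsHomogeneous κ
  harmonic : ∑ i : Fin (d + 1), MvPolynomial.pderiv i (MvPolynomial.pderiv i p) = 0
  nonneg : ∀ x : Space d, lastCoord x = 0 → 0 ≤ polyFun p x

/-- The norm `‖p‖_{L²(B₁)}`. -/
def polyL2Norm {d : ℕ} (p : MvPolynomial (Fin (d + 1)) ℝ) : ℝ :=
  Real.sqrt (∫ x in ball (0 : Space d) 1, polyFun p x ^ 2)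

/-- The Monneau functional `M_κ(r, u, p) = r^{-(n-1+2κ)} ∫_{∂B_r} (u - p)²`. -/
def monneau {d : ℕ} (κ : ℕ) (u : Space d → ℝ) (p : MvPolynomial (Fin (d + 1)) ℝ) (r : ℝ) : ℝ :=
  1 / r ^ (d + 2 * κ) * sphereIntegral r (fun x => (u x - polyFun p x) ^ 2)

end ThinObstacle

end

/-!
The Monneau functional has a derivative bounded below by the Weiss energy of `u` plus an error term,
and both are controlled as soon as `u` is known to grow at most like `r^κ`, with constants that
depend only on the data.

All integrals are taken over the upper half space. With `n = d + 1`, the notation is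
`hemi F r = ∫ F (r y) dσ(y)` over the open upper unit hemisphere, `A(r) = hemi (u²) r`, and `D(r)`
is the Dirichlet energy of `u` on the half ball of radius `r`.

The equation, the signs of `u` and `∂_n u` on the thin space, and complementarity enter only through
Green's inequality `IsWeakSolution.green_le`: if `w` is nonnegative on the thin space, then
`∂_n u (w - u) ≤ 0` there, so that `η = w - u` satisfies
`∫_{∂B_r⁺} ∂_ν u η ≤ ∫_{B_r⁺} (∇u · ∇η + Δu η)`. It is applied with three competitors `w`.

* The rescalings `w = t^(-l) u(t x)` as `t → 1+`. The Dirichlet integral of a rescaling is a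
  multiple of `D(t r)`, and the derivative at `t = 1` gives `IsSignorini.energy_deriv_ge`,
  which replaces the Rellich identity. It makes a corrected Weiss functional nondecreasing. Its
  limit at `0` is nonnegative when `A = o(r^(2l))`, hence the Weiss energy
  `r^(-(d-1+2l)) D - l r^(-2l) A` is at least `-C r²` (`IsSignorini.weiss_ge`).
* The function `w = 0`. It bounds the derivative of `r^(-2l) A` from below by the Weiss energy, and
  an absorption argument yields `A ≤ S r^(2l)` with `S` depending only on the data
  (`IsSignorini.growth`).
* The competitor `w = q`, harmonic, homogeneous of degree `κ`, even in `x_n` and nonnegative on the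
  thin space. By Green's identity for `q` (`integral_gdot_harmonic`), the derivative of
  `r^(-2κ) hemi ((u - q)²) r` is at least `2 / r` times the Weiss energy plus an integral of
  `Δu (u - q)`, and both have lower bounds of order `r²` (`IsSignorini.hasDerivAt_monneau`).

The frequency limit `n - 1 + 2κ` with `κ < k` makes the truncation in the frequency inactive near
`0` and gives `A = o(r^(2l))` for every `l < κ` (`FrequencyLimit.tendsto_height`). The bounds for
`l < κ` are uniform, so they pass to `l = κ`.

A polynomial `p` in `𝔓_κ` need not be even in `x_n`. It is the sum of its even part, to which
the above applies, and its odd part, which contributes a constant to the Monneau functional of the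
even function `u` (`monneau_eq_hemi`).
-/

open scoped Pointwise

noncomputable section

namespace ThinObstacle

variable {d : ℕ}

/-! ### Integration over half balls and hemispheres -/

/-- The open upper half ball of radius `R`. -/
def halfBall (d : ℕ) (R : ℝ) : Set (Space d) := {x | ‖x‖ < R ∧ 0 < lastCoord x}

/-- The surface measure of the open upper unit hemisphere. -/
def hemiMeasure (d : ℕ) : Measure (sphere (0 : Space d) 1) :=
  (volume : Measure (Space d)).toSphere.restrict {y | 0 < lastCoord (y : Space d)}

/-- The integral over the unit hemisphere of `y ↦ F (ρ y)`. The Jacobian `ρ ^ d` is not included. -/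
def hemi (F : Space d → ℝ) (ρ : ℝ) : ℝ :=
  ∫ y : sphere (0 : Space d) 1, F (ρ • (y : Space d)) ∂(hemiMeasure d)

theorem continuous_lastCoord : Continuous (lastCoord : Space d → ℝ) := by
  unfold lastCoord; fun_prop

theorem lastCoord_smul (t : ℝ) (x : Space d) : lastCoord (t • x) = t * lastCoord x := by
  simp [lastCoord]

theorem isOpen_halfBall (R : ℝ) : IsOpen (halfBall d R) :=
  (isOpen_lt continuous_norm continuous_const).inter
    (isOpen_lt continuous_const continuous_lastCoord)

theorem measurableSet_halfBall (R : ℝ) : MeasurableSet (halfBall d R) :=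
  (isOpen_halfBall R).measurableSet

theorem halfBall_mono {r R : ℝ} (h : r ≤ R) : halfBall d r ⊆ halfBall d R :=
  fun _ hx => ⟨hx.1.trans_le h, hx.2⟩

theorem halfBall_subset_ball (R : ℝ) : halfBall d R ⊆ ball 0 R := fun x hx => by
  simpa using hx.1

theorem volume_halfBall_lt_top (R : ℝ) : volume (halfBall d R) < ⊤ :=
  (measure_mono (halfBall_subset_ball R)).trans_lt measure_ball_lt_top

instance : IsFiniteMeasure (hemiMeasure d) := by unfold hemiMeasure; infer_instance

instance (R : ℝ) : IsFiniteMeasure ((volume : Measure (Space d)).restrict (halfBall d R)) :=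
  ⟨by simpa using volume_halfBall_lt_top R⟩

theorem measurableSet_hemisphere :
    MeasurableSet {y : sphere (0 : Space d) 1 | 0 < lastCoord (y : Space d)} :=
  (isOpen_lt continuous_const (continuous_lastCoord.comp continuous_subtype_val)).measurableSet

theorem smul_mem_halfBall {R ρ : ℝ} (h0 : 0 < ρ) (hR : ρ < R) {y : sphere (0 : Space d) 1}
    (hy : 0 < lastCoord (y : Space d)) : ρ • (y : Space d) ∈ halfBall d R := by
  refine ⟨?_, ?_⟩
  · simpa [norm_smul, abs_of_pos h0] using hR
  · rw [lastCoord_smul]; positivity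

theorem ae_hemiMeasure :
    ∀ᵐ y : sphere (0 : Space d) 1 ∂(hemiMeasure d), 0 < lastCoord (y : Space d) :=
  ae_restrict_mem measurableSet_hemisphere

/-- Integration in polar coordinates. -/
theorem integral_eq_polar {G : Space d → ℝ} (hG : Integrable G) :
    ∫ x, G x = ∫ ρ in Ioi (0 : ℝ), ρ ^ d * ∫ y : sphere (0 : Space d) 1,
      G (ρ • (y : Space d)) ∂(volume : Measure (Space d)).toSphere := by
  have hdim : Module.finrank ℝ (Space d) - 1 = d := by simp
  have hmp := (volume : Measure (Space d)).measurePreserving_homeomorphUnitSphereProd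
  rw [hdim] at hmp
  have hemb := (homeomorphUnitSphereProd (Space d)).measurableEmbedding
  let K : sphere (0 : Space d) 1 × Ioi (0 : ℝ) → ℝ := fun z => G ((z.2 : ℝ) • (z.1 : Space d))
  have hK : ∀ x : ({(0 : Space d)}ᶜ : Set (Space d)), K (homeomorphUnitSphereProd (Space d) x)
      = G x := by
    intro x
    have := homeomorphUnitSphereProd_symm_apply_coe (Space d)
      (homeomorphUnitSphereProd (Space d) x)
    simp only [Homeomorph.symm_apply_apply] at this
    simp only [K]
    rw [← this]
  have hint : Integrable K ((volume : Measure (Space d)).toSphere.prod (.volumeIoiPow d)) := by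
    rw [← hmp.integrable_comp_emb hemb]
    have : K ∘ (homeomorphUnitSphereProd (Space d)) =
        fun x : ({(0 : Space d)}ᶜ : Set (Space d)) => G (x : Space d) := funext hK
    rw [this]
    have h2 : IntegrableOn G ({(0 : Space d)}ᶜ) := hG.integrableOn
    rwa [integrableOn_iff_comap_subtypeVal (by measurability)] at h2
  calc
    ∫ x, G x = ∫ x : ({(0 : Space d)}ᶜ : Set (Space d)), G x ∂(volume.comap Subtype.val) := by
      rw [integral_subtype_comap (measurableSet_singleton _).compl, restrict_compl_singleton]
    _ = ∫ z, K z ∂((volume : Measure (Space d)).toSphere.prod (.volumeIoiPow d)) := by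
      rw [← hmp.integral_comp hemb]
      exact integral_congr_ae (Eventually.of_forall fun x => (hK x).symm)
    _ = ∫ ρ : Ioi (0 : ℝ), (∫ y, K (y, ρ) ∂(volume : Measure (Space d)).toSphere)
          ∂(.volumeIoiPow d) := integral_prod_symm _ hint
    _ = _ := by
      simp only [Measure.volumeIoiPow, ENNReal.ofReal]
      rw [integral_withDensity_eq_integral_smul
          ((measurable_subtype_coe.pow_const _).real_toNNReal),
        integral_subtype_comap measurableSet_Ioi fun a ↦ Real.toNNReal (a ^ d) •
          ∫ y : sphere (0 : Space d) 1,
            G (a • (y : Space d)) ∂(volume : Measure (Space d)).toSphere,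
        setIntegral_congr_fun measurableSet_Ioi fun x hx ↦ ?_]
      rw [NNReal.smul_def, Real.coe_toNNReal _ (pow_nonneg hx.out.le _), smul_eq_mul]

theorem setIntegral_halfBall_eq {R : ℝ} (hR : 0 ≤ R) {F : Space d → ℝ}
    (hF : IntegrableOn F (halfBall d R)) :
    ∫ x in halfBall d R, F x = ∫ ρ in (0 : ℝ)..R, ρ ^ d * hemi F ρ := by
  rw [← integral_indicator (measurableSet_halfBall R),
    integral_eq_polar (hF.integrable_indicator (measurableSet_halfBall R)),
    intervalIntegral.integral_of_le hR, integral_Ioc_eq_integral_Ioo,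
    ← integral_indicator measurableSet_Ioi, ← integral_indicator measurableSet_Ioo]
  congr 1
  ext ρ
  by_cases h0 : 0 < ρ
  · rw [indicator_of_mem (show ρ ∈ Ioi (0 : ℝ) from h0)]
    by_cases h1 : ρ < R
    · rw [indicator_of_mem (show ρ ∈ Ioo (0 : ℝ) R from ⟨h0, h1⟩), hemi, hemiMeasure,
        ← integral_indicator measurableSet_hemisphere]
      congr 2
      ext y
      by_cases hy : 0 < lastCoord (y : Space d)
      · rw [indicator_of_mem (smul_mem_halfBall h0 h1 hy), indicator_of_mem (by exact hy)]
      · rw [indicator_of_notMem, indicator_of_notMem (by exact hy)]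
        intro h
        exact hy (pos_of_mul_pos_right (lastCoord_smul ρ (y : Space d) ▸ h.2) h0.le)
    · rw [indicator_of_notMem (fun h => h1 h.2)]
      have : ∀ y : sphere (0 : Space d) 1,
          (halfBall d R).indicator F (ρ • (y : Space d)) = 0 := by
        intro y
        apply indicator_of_notMem
        intro h
        apply h1
        simpa [norm_smul, abs_of_pos h0] using h.1
      simp [this]
  · rw [indicator_of_notMem (show ρ ∉ Ioi (0 : ℝ) from h0), indicator_of_notMem (fun h => h0 h.1)]

theorem aestronglyMeasurable_comp_smul {R ρ : ℝ} (h0 : 0 < ρ) (hR : ρ < R) {F : Space d → ℝ}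
    (hF : ContinuousOn F (halfBall d R)) :
    AEStronglyMeasurable (fun y : sphere (0 : Space d) 1 => F (ρ • (y : Space d)))
      (hemiMeasure d) := by
  refine ContinuousOn.aestronglyMeasurable ?_ measurableSet_hemisphere
  exact hF.comp (by fun_prop) fun y hy => smul_mem_halfBall h0 hR hy

theorem integrable_comp_smul {R ρ C : ℝ} (h0 : 0 < ρ) (hR : ρ < R) {F : Space d → ℝ}
    (hF : ContinuousOn F (halfBall d R)) (hC : ∀ x ∈ halfBall d R, |F x| ≤ C) :
    Integrable (fun y : sphere (0 : Space d) 1 => F (ρ • (y : Space d))) (hemiMeasure d) := by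
  refine Integrable.of_bound (aestronglyMeasurable_comp_smul h0 hR hF) C ?_
  filter_upwards [ae_hemiMeasure] with y hy
  exact hC _ (smul_mem_halfBall h0 hR hy)

theorem integrableOn_halfBall {R C : ℝ} {F : Space d → ℝ}
    (hF : ContinuousOn F (halfBall d R)) (hC : ∀ x ∈ halfBall d R, |F x| ≤ C) :
    IntegrableOn F (halfBall d R) := by
  refine Integrable.of_bound (hF.aestronglyMeasurable (measurableSet_halfBall R)) C ?_
  filter_upwards [ae_restrict_mem (measurableSet_halfBall R)] with x hx
  exact hC x hx

theorem continuousOn_hemi {R C : ℝ} {F : Space d → ℝ}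
    (hF : ContinuousOn F (halfBall d R)) (hC : ∀ x ∈ halfBall d R, |F x| ≤ C) :
    ContinuousOn (hemi F) (Ioo 0 R) := by
  intro ρ hρ
  apply ContinuousAt.continuousWithinAt
  have hnhds : Ioo (0 : ℝ) R ∈ 𝓝 ρ := isOpen_Ioo.mem_nhds hρ
  refine continuousAt_of_dominated (bound := fun _ => C) ?_ ?_ (integrable_const C) ?_
  · filter_upwards [hnhds] with t ht using aestronglyMeasurable_comp_smul ht.1 ht.2 hF
  · filter_upwards [hnhds] with t ht
    filter_upwards [ae_hemiMeasure] with y hy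
    exact hC _ (smul_mem_halfBall ht.1 ht.2 hy)
  · filter_upwards [ae_hemiMeasure] with y hy
    have := hF.continuousAt ((isOpen_halfBall R).mem_nhds (smul_mem_halfBall hρ.1 hρ.2 hy))
    exact ContinuousAt.comp (f := fun t : ℝ => t • (y : Space d)) this (by fun_prop)

theorem abs_hemi_le {R C ρ : ℝ} (h0 : 0 < ρ) (hR : ρ < R) {F : Space d → ℝ}
    (hC : ∀ x ∈ halfBall d R, |F x| ≤ C) :
    |hemi F ρ| ≤ C * (hemiMeasure d).real univ := by
  rw [hemi, ← Real.norm_eq_abs]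
  apply norm_integral_le_of_norm_le_const
  filter_upwards [ae_hemiMeasure] with y hy
  exact hC _ (smul_mem_halfBall h0 hR hy)

theorem hemi_congr {F G : Space d → ℝ} {R ρ : ℝ} (h0 : 0 < ρ) (hR : ρ < R)
    (h : ∀ x ∈ halfBall d R, F x = G x) : hemi F ρ = hemi G ρ := by
  refine integral_congr_ae ?_
  filter_upwards [ae_hemiMeasure] with y hy using h _ (smul_mem_halfBall h0 hR hy)

theorem hasDerivAt_setIntegral_halfBall {R C r : ℝ} {F : Space d → ℝ}
    (hF : ContinuousOn F (halfBall d R)) (hC : ∀ x ∈ halfBall d R, |F x| ≤ C)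
    (h0 : 0 < r) (hr : r < R) :
    HasDerivAt (fun r => ∫ x in halfBall d r, F x) (r ^ d * hemi F r) r := by
  have hcont : ContinuousOn (fun ρ => ρ ^ d * hemi F ρ) (Ioo 0 R) :=
    (continuousOn_id.pow d).mul (continuousOn_hemi hF hC)
  have hnhds : Ioo (0 : ℝ) R ∈ 𝓝 r := isOpen_Ioo.mem_nhds ⟨h0, hr⟩
  have hmeas : StronglyMeasurableAtFilter (fun ρ => ρ ^ d * hemi F ρ) (𝓝 r) :=
    hcont.stronglyMeasurableAtFilter isOpen_Ioo _ ⟨h0, hr⟩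
  have hint : IntervalIntegrable (fun ρ => ρ ^ d * hemi F ρ) volume 0 r := by
    rw [intervalIntegrable_iff_integrableOn_Ioo_of_le h0.le]
    refine Integrable.of_bound (C := R ^ d * (C * (hemiMeasure d).real univ))
      ((hcont.mono (Ioo_subset_Ioo_right hr.le)).aestronglyMeasurable measurableSet_Ioo) ?_
    filter_upwards [ae_restrict_mem measurableSet_Ioo] with ρ hρ
    rw [norm_mul, Real.norm_eq_abs, Real.norm_eq_abs, abs_of_nonneg (pow_nonneg hρ.1.le d)]
    have h1 : ρ ^ d ≤ R ^ d := pow_le_pow_left₀ hρ.1.le (hρ.2.trans hr).le d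
    exact mul_le_mul h1 (abs_hemi_le hρ.1 (hρ.2.trans hr) hC) (abs_nonneg _)
      (pow_nonneg (h0.trans hr).le d)
  have hder := intervalIntegral.integral_hasDerivAt_right hint hmeas
    (hcont.continuousAt hnhds)
  refine hder.congr_of_eventuallyEq ?_
  filter_upwards [hnhds] with t ht
  exact setIntegral_halfBall_eq ht.1.le
    ((integrableOn_halfBall hF hC).mono_set (halfBall_mono ht.2.le))

/-- The radial derivative `x ↦ x · ∇u(x)`. -/
def euler (u : Space d → ℝ) (x : Space d) : ℝ := fderiv ℝ u x x

/-- The chain rule along a ray. -/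
theorem hasDerivAt_comp_smul {u : Space d → ℝ} {y : Space d} {ρ : ℝ}
    (hu : DifferentiableAt ℝ u (ρ • y)) :
    HasDerivAt (fun t : ℝ => u (t • y)) (fderiv ℝ u (ρ • y) y) ρ := by
  have h1 : HasDerivAt (fun t : ℝ => t • y) y ρ := by
    simpa using (hasDerivAt_id ρ).smul_const y
  exact hu.hasFDerivAt.comp_hasDerivAt ρ h1

theorem hasDerivAt_hemi {R C C' r : ℝ} {F : Space d → ℝ}
    (hF : ContDiffOn ℝ 1 F (halfBall d R)) (hC : ∀ x ∈ halfBall d R, |F x| ≤ C)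
    (hC' : ∀ x ∈ halfBall d R, ‖fderiv ℝ F x‖ ≤ C') (h0 : 0 < r) (hr : r < R) :
    HasDerivAt (hemi F) (hemi (euler F) r / r) r := by
  have hnhds : Ioo (0 : ℝ) R ∈ 𝓝 r := isOpen_Ioo.mem_nhds ⟨h0, hr⟩
  have hFc := hF.continuousOn
  have hdiff : ∀ x ∈ halfBall d R, DifferentiableAt ℝ F x := fun x hx =>
    (hF.differentiableOn one_ne_zero).differentiableAt ((isOpen_halfBall R).mem_nhds hx)
  have hfc : ContinuousOn (fun x => fderiv ℝ F x) (halfBall d R) :=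
    hF.continuousOn_fderiv_of_isOpen (isOpen_halfBall R) le_rfl
  have key := hasDerivAt_integral_of_dominated_loc_of_deriv_le (μ := hemiMeasure d)
    (F := fun ρ (y : sphere (0 : Space d) 1) => F (ρ • (y : Space d)))
    (F' := fun ρ (y : sphere (0 : Space d) 1) => fderiv ℝ F (ρ • (y : Space d)) (y : Space d))
    (x₀ := r) (s := Ioo 0 R) (bound := fun _ => C') hnhds ?_ ?_ ?_ ?_ (integrable_const _) ?_
  · have h2 := key.2
    have h3 : (∫ y : sphere (0 : Space d) 1, fderiv ℝ F (r • (y : Space d)) (y : Space d)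
        ∂(hemiMeasure d)) = hemi (euler F) r / r := by
      rw [hemi, ← integral_div]
      refine integral_congr_ae (Eventually.of_forall fun y => ?_)
      simp only [euler, map_smul, smul_eq_mul]
      field_simp
    rw [h3] at h2
    exact h2
  · filter_upwards [hnhds] with t ht using aestronglyMeasurable_comp_smul ht.1 ht.2 hFc
  · exact integrable_comp_smul h0 hr hFc hC
  · refine ContinuousOn.aestronglyMeasurable ?_ measurableSet_hemisphere
    refine ContinuousOn.clm_apply ?_ continuous_subtype_val.continuousOn
    exact hfc.comp (by fun_prop) fun y hy => smul_mem_halfBall h0 hr hy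
  · filter_upwards [ae_hemiMeasure] with y hy t ht
    refine (ContinuousLinearMap.le_opNorm _ _).trans ?_
    have : ‖(y : Space d)‖ = 1 := by simp
    rw [this, mul_one]
    exact hC' _ (smul_mem_halfBall ht.1 ht.2 hy)
  · filter_upwards [ae_hemiMeasure] with y hy t ht
    exact hasDerivAt_comp_smul (hdiff _ (smul_mem_halfBall ht.1 ht.2 hy))

/-! ### Partial derivatives and the weak equation -/

/-- The `i`-th partial derivative. -/
def pd (i : Fin (d + 1)) (u : Space d → ℝ) (x : Space d) : ℝ :=
  fderiv ℝ u x (EuclideanSpace.single i (1 : ℝ))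

/-- The pointwise scalar product `∇u · ∇v` of two gradients. -/
def gdot (u v : Space d → ℝ) (x : Space d) : ℝ := ∑ i, pd i u x * pd i v x

theorem abs_pd_le (i : Fin (d + 1)) (u : Space d → ℝ) (x : Space d) :
    |pd i u x| ≤ ‖fderiv ℝ u x‖ := by
  refine ((fderiv ℝ u x).le_opNorm _).trans ?_
  simp

theorem continuousOn_pd {u : Space d → ℝ} {s : Set (Space d)} (hs : IsOpen s)
    (hu : ContDiffOn ℝ 1 u s) (i : Fin (d + 1)) : ContinuousOn (pd i u) s :=
  (hu.continuousOn_fderiv_of_isOpen hs le_rfl).clm_apply continuousOn_const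

theorem continuousOn_gdot {u v : Space d → ℝ} {s : Set (Space d)} (hs : IsOpen s)
    (hu : ContDiffOn ℝ 1 u s) (hv : ContDiffOn ℝ 1 v s) : ContinuousOn (gdot u v) s :=
  continuousOn_finsetSum _ fun i _ => (continuousOn_pd hs hu i).mul (continuousOn_pd hs hv i)

theorem abs_gdot_le {u v : Space d → ℝ} {x : Space d} {a b : ℝ} (ha : ‖fderiv ℝ u x‖ ≤ a)
    (hb : ‖fderiv ℝ v x‖ ≤ b) : |gdot u v x| ≤ (d + 1) * (a * b) := by
  refine (Finset.abs_sum_le_sum_abs _ _).trans ?_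
  have : ∀ i ∈ Finset.univ, |pd i u x * pd i v x| ≤ a * b := by
    intro i _
    rw [abs_mul]
    exact mul_le_mul ((abs_pd_le i u x).trans ha) ((abs_pd_le i v x).trans hb) (abs_nonneg _)
      ((norm_nonneg _).trans ha)
  refine (Finset.sum_le_sum this).trans (le_of_eq ?_)
  simp

theorem euler_eq_sum (u : Space d → ℝ) (x : Space d) : euler u x = ∑ i, x i * pd i u x := by
  have hx : x = ∑ i, x i • EuclideanSpace.single i (1 : ℝ) := by
    ext j
    simp [Finset.sum_apply, Pi.single_apply]
  unfold euler pd
  conv_lhs => rw [hx]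
  rw [map_sum]
  simp only [map_smul, smul_eq_mul]
  rw [← hx]

theorem laplacian_eq_sum_pd {ζ : Space d → ℝ} (hζ : ContDiff ℝ 2 ζ) (x : Space d) :
    Laplacian.laplacian ζ x = ∑ i, pd i (pd i ζ) x := by
  rw [InnerProductSpace.laplacian_eq_iteratedFDeriv_orthonormalBasis ζ
    (EuclideanSpace.basisFun (Fin (d + 1)) ℝ)]
  refine Finset.sum_congr rfl fun i _ => ?_
  rw [iteratedFDeriv_two_apply]
  have h1 : DifferentiableAt ℝ (fderiv ℝ ζ) x :=
    ((hζ.fderiv_right (m := 1) (by norm_num)).differentiable one_ne_zero) x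
  unfold pd
  rw [fderiv_clm_apply h1 (by fun_prop)]
  simp

/-- Integration by parts against a compactly supported function. -/
theorem setIntegral_mul_pd {s : Set (Space d)} (hs : IsOpen s) {u g : Space d → ℝ}
    (hu : ContDiffOn ℝ 1 u s) (hg : ContDiff ℝ 1 g) (hgc : HasCompactSupport g)
    (hgs : tsupport g ⊆ s) (i : Fin (d + 1)) :
    IntegrableOn (fun x => u x * pd i g x) s ∧ IntegrableOn (fun x => pd i u x * g x) s ∧
    ∫ x in s, u x * pd i g x = - ∫ x in s, pd i u x * g x := by
  have hpg : Continuous (pd i g) := (hg.continuous_fderiv one_ne_zero).clm_apply continuous_const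
  have hpgz : ∀ x, x ∉ tsupport g → pd i g x = 0 := by
    intro x hx
    have : x ∉ tsupport (fderiv ℝ g) := fun h => hx (tsupport_fderiv_subset ℝ h)
    simp [pd, image_eq_zero_of_notMem_tsupport this]
  have hgz : ∀ x, x ∉ tsupport g → g x = 0 := fun x hx => image_eq_zero_of_notMem_tsupport hx
  have aux : ∀ {a b : Space d → ℝ}, ContinuousOn a s → Continuous b →
      (∀ x, x ∉ tsupport g → b x = 0) → Integrable (fun x => a x * b x) := by
    intro a b ha hb hbz
    have h1 : IntegrableOn (fun x => a x * b x) (tsupport g) :=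
      ((ha.mono hgs).mul hb.continuousOn).integrableOn_compact hgc
    rwa [integrableOn_iff_integrable_of_support_subset] at h1
    intro x hx
    by_contra hxg
    exact hx (by simp [hbz x hxg])
  have hpu := continuousOn_pd hs hu i
  have i1 := aux hu.continuousOn hpg hpgz
  have i2 := aux hpu hg.continuous hgz
  have i3 := aux hu.continuousOn hg.continuous hgz
  refine ⟨i1.integrableOn, i2.integrableOn, ?_⟩
  have key := integral_mul_fderiv_eq_neg_fderiv_mul_of_integrable (μ := volume) i2 i1 i3
    (fun x hx => (hu.differentiableOn one_ne_zero).differentiableAt (hs.mem_nhds (hgs hx)))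
    (fun x _ => (hg.differentiable one_ne_zero) x)
  rw [setIntegral_eq_integral_of_forall_compl_eq_zero,
    setIntegral_eq_integral_of_forall_compl_eq_zero]
  · exact key
  · intro x hx; simp [hgz x fun h => hx (hgs h)]
  · intro x hx; simp [hpgz x fun h => hx (hgs h)]

/-- A compactly supported `C¹` function is the pointwise limit of smooth functions with support in
the same open set, together with its partial derivatives and with uniform bounds. -/
theorem tendsto_mollify {ζ : Space d → ℝ} (hζ : ContDiff ℝ 1 ζ) (hc : HasCompactSupport ζ)
    {s : Set (Space d)} (hs : IsOpen s) (hζs : tsupport ζ ⊆ s) :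
    ∃ Z : ℕ → Space d → ℝ, ∃ C : ℝ, (∀ n, ContDiff ℝ ∞ (Z n)) ∧ (∀ n, HasCompactSupport (Z n)) ∧
      (∀ n, tsupport (Z n) ⊆ s) ∧ (∀ n x, |Z n x| ≤ C) ∧ (∀ n i x, |pd i (Z n) x| ≤ C) ∧
      (∀ x, Tendsto (fun n => Z n x) atTop (𝓝 (ζ x))) ∧
      (∀ i x, Tendsto (fun n => pd i (Z n) x) atTop (𝓝 (pd i ζ x))) := by
  obtain ⟨ε, hε, hεs⟩ := IsCompact.exists_cthickening_subset_open hc hs hζs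
  let φ : ℕ → ContDiffBump (0 : Space d) := fun n =>
    { rIn := ε / 2 / (n + 1)
      rOut := ε / (n + 1)
      rIn_pos := by positivity
      rIn_lt_rOut := by
        apply div_lt_div_of_pos_right _ (by positivity)
        linarith }
  have hφ : Tendsto (fun n => (φ n).rOut) atTop (𝓝 0) := by
    have := (tendsto_one_div_add_atTop_nhds_zero_nat (𝕜 := ℝ)).const_mul ε
    simpa [φ, div_eq_mul_inv] using this
  have hφle : ∀ n, (φ n).rOut ≤ ε := by
    intro n
    simp only [φ]
    apply div_le_self hε.le
    have : (0 : ℝ) ≤ n := by positivity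
    linarith
  let L := ContinuousLinearMap.lsmul ℝ ℝ (E := ℝ)
  let Z : ℕ → Space d → ℝ := fun n => convolution ((φ n).normed volume) ζ L volume
  have hpc : ∀ i, Continuous (pd i ζ) := fun i =>
    (hζ.continuous_fderiv one_ne_zero).clm_apply continuous_const
  have hpcs : ∀ i, HasCompactSupport (pd i ζ) := fun i =>
    hc.fderiv_apply (𝕜 := ℝ) _
  have hpd : ∀ n i x, pd i (Z n) x = convolution ((φ n).normed volume) (pd i ζ) L volume x := by
    intro n i x
    have h1 := hc.hasFDerivAt_convolution_right (μ := volume) L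
      ((φ n).continuous_normed (μ := volume)).locallyIntegrable hζ x
    rw [pd, h1.fderiv]
    rw [convolution_precompR_apply]
    · rfl
    · exact ((φ n).continuous_normed (μ := volume)).locallyIntegrable
    · exact hc.fderiv (𝕜 := ℝ)
    · exact hζ.continuous_fderiv one_ne_zero
  have hbound : ∀ g : Space d → ℝ, Continuous g → HasCompactSupport g → ∃ C, ∀ n x,
      |convolution ((φ n).normed volume) g L volume x| ≤ C := by
    intro g hg hgc
    obtain ⟨C, hC⟩ := hgc.exists_bound_of_continuous hg
    refine ⟨3 * C, fun n x => ?_⟩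
    have := (φ n).dist_normed_convolution_le (μ := volume) (g := g) (x₀ := x) (ε := 2 * C)
      hg.aestronglyMeasurable (fun y _ => by
        rw [dist_eq_norm]
        exact (norm_sub_le _ _).trans (by linarith [hC x, hC y]))
    rw [Real.dist_eq] at this
    have h2 := hC x
    rw [Real.norm_eq_abs] at h2
    calc |convolution ((φ n).normed volume) g L volume x|
        = |(convolution ((φ n).normed volume) g L volume x - g x) + g x| := by ring_nf
      _ ≤ _ := abs_add_le _ _
      _ ≤ 3 * C := by linarith
  obtain ⟨C₀, hC₀⟩ := hbound ζ hζ.continuous hc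
  choose C₁ hC₁ using fun i => hbound (pd i ζ) (hpc i) (hpcs i)
  have htsupp : ∀ n, tsupport (Z n) ⊆ cthickening ε (tsupport ζ) := by
    intro n
    refine closure_minimal ?_ isClosed_cthickening
    refine (support_convolution_subset L).trans ?_
    rintro _ ⟨a, ha, b, hb, rfl⟩
    rw [(φ n).support_normed_eq, mem_ball_zero_iff] at ha
    apply mem_cthickening_of_dist_le _ b _ _ (subset_tsupport _ hb)
    rw [dist_eq_norm]
    simpa using ha.le.trans (hφle n)
  refine ⟨Z, C₀ + ∑ i, |C₁ i|, ?_, ?_, ?_, ?_, ?_, ?_, ?_⟩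
  · intro n
    exact (φ n).hasCompactSupport_normed.contDiff_convolution_left L (φ n).contDiff_normed
      hζ.continuous.locallyIntegrable
  · intro n
    exact HasCompactSupport.of_support_subset_isCompact (K := cthickening ε (tsupport ζ))
      (IsCompact.cthickening hc) ((subset_tsupport _).trans (htsupp n))
  · intro n
    exact (htsupp n).trans hεs
  · intro n x
    have : 0 ≤ ∑ i, |C₁ i| := Finset.sum_nonneg fun _ _ => abs_nonneg _
    linarith [hC₀ n x]
  · intro n i x
    rw [hpd]
    have h1 : |C₁ i| ≤ ∑ i, |C₁ i| :=
      Finset.single_le_sum (f := fun i => |C₁ i|) (fun _ _ => abs_nonneg _) (Finset.mem_univ i)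
    have h2 : 0 ≤ C₀ := (abs_nonneg _).trans (hC₀ 0 0)
    linarith [hC₁ i n x, le_abs_self (C₁ i)]
  · intro x
    exact ContDiffBump.convolution_tendsto_right_of_continuous hφ hζ.continuous x
  · intro i x
    simp only [hpd]
    exact ContDiffBump.convolution_tendsto_right_of_continuous hφ (hpc i) x

/-- A bounded function `u` of class `C¹` on the upper half ball with bounded gradient
satisfies `Δu = f` there, tested against `C¹` functions of compact support. The constant `M` bounds
`u` and its gradient, the constant `F` bounds `f`. -/
structure IsWeakSolution (u f : Space d → ℝ) (M F : ℝ) : Prop where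
  contDiffOn : ContDiffOn ℝ 1 u (halfBall d 1)
  abs_le : ∀ x ∈ halfBall d 1, |u x| ≤ M
  fderiv_le : ∀ x ∈ halfBall d 1, ‖fderiv ℝ u x‖ ≤ M
  measurable : Measurable f
  abs_rhs_le : ∀ x ∈ halfBall d 1, |f x| ≤ F
  weak : ∀ ζ : Space d → ℝ, ContDiff ℝ 1 ζ → HasCompactSupport ζ → tsupport ζ ⊆ halfBall d 1 →
    ∫ x in halfBall d 1, (gdot u ζ x + f x * ζ x) = 0

/-- For a `C¹` function with bounded gradient, the distributional equation can be tested with `C¹`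
functions: integrate by parts once, then mollify the test function. -/
theorem HasWeakLaplacian.isWeakSolution {u f : Space d → ℝ} {M F : ℝ}
    (h : HasWeakLaplacian u f) (hu : ContDiffOn ℝ 1 u (halfBall d 1))
    (hM : ∀ x ∈ halfBall d 1, |u x| ≤ M) (hM' : ∀ x ∈ halfBall d 1, ‖fderiv ℝ u x‖ ≤ M)
    (hf : Measurable f) (hF : ∀ x ∈ halfBall d 1, |f x| ≤ F) : IsWeakSolution u f M F := by
  refine ⟨hu, hM, hM', hf, hF, ?_⟩
  have hO : upperHalfBall d = halfBall d 1 := rfl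
  have hop := isOpen_halfBall (d := d) 1
  have hms := measurableSet_halfBall (d := d) 1
  have hfint : ∀ {ζ : Space d → ℝ}, Continuous ζ → HasCompactSupport ζ →
      IntegrableOn (fun x => f x * ζ x) (halfBall d 1) := by
    intro ζ hζ hc
    obtain ⟨C, hC⟩ := hc.exists_bound_of_continuous hζ
    refine Integrable.of_bound (C := F * C) (hf.aestronglyMeasurable.mul hζ.aestronglyMeasurable) ?_
    filter_upwards [ae_restrict_mem hms] with x hx
    rw [norm_mul]
    exact mul_le_mul (hF x hx) (hC x) (norm_nonneg _) ((abs_nonneg _).trans (hF x hx))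
  have smooth : ∀ ζ : Space d → ℝ, ContDiff ℝ ∞ ζ → HasCompactSupport ζ →
      tsupport ζ ⊆ halfBall d 1 → ∫ x in halfBall d 1, (gdot u ζ x + f x * ζ x) = 0 := by
    intro ζ hζ hc hs
    have hw := h ζ hζ hc hs
    rw [hO] at hw
    have hζ2 : ContDiff ℝ 2 ζ := contDiff_infty.mp hζ 2
    have hpi : ∀ i, ContDiff ℝ 1 (pd i ζ) := fun i =>
      (hζ2.fderiv_right (m := 1) (by norm_num)).clm_apply contDiff_const
    have hsub : ∀ i, tsupport (pd i ζ) ⊆ tsupport ζ := by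
      intro i
      refine closure_minimal ?_ (isClosed_tsupport ζ)
      intro x hx
      by_contra hxg
      have : x ∉ tsupport (fderiv ℝ ζ) := fun h => hxg (tsupport_fderiv_subset ℝ h)
      exact hx (by simp [pd, image_eq_zero_of_notMem_tsupport this])
    have hcpi : ∀ i, HasCompactSupport (pd i ζ) := fun i =>
      HasCompactSupport.of_support_subset_isCompact hc ((subset_tsupport _).trans (hsub i))
    have ibp := fun i => setIntegral_mul_pd hop hu (hpi i) (hcpi i) ((hsub i).trans hs) i
    have e1 : ∫ x in halfBall d 1, u x * Laplacian.laplacian ζ x =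
        - ∫ x in halfBall d 1, gdot u ζ x := by
      simp only [laplacian_eq_sum_pd hζ2, Finset.mul_sum, gdot]
      rw [integral_finsetSum _ fun i _ => (ibp i).1, integral_finsetSum _ fun i _ => (ibp i).2.1,
        ← Finset.sum_neg_distrib]
      exact Finset.sum_congr rfl fun i _ => (ibp i).2.2
    have e2 : IntegrableOn (gdot u ζ) (halfBall d 1) := by
      unfold gdot
      exact integrable_finsetSum _ fun i _ => (ibp i).2.1
    rw [integral_add e2 (hfint hζ.continuous hc), ← hw, e1]
    ring
  intro ζ hζ hc hs
  obtain ⟨Z, C, h1, h2, h3, h4, h5, h6, h7⟩ := tendsto_mollify hζ hc hop hs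
  have hlim : Tendsto (fun n => ∫ x in halfBall d 1, (gdot u (Z n) x + f x * Z n x)) atTop
      (𝓝 (∫ x in halfBall d 1, (gdot u ζ x + f x * ζ x))) := by
    refine tendsto_integral_of_dominated_convergence
      (fun _ => (∑ _i : Fin (d + 1), M * C) + F * C) ?_ (integrable_const _) ?_ ?_
    · intro n
      exact ((continuousOn_gdot hop hu
        (contDiff_infty.mp (h1 n) 1).contDiffOn).aestronglyMeasurable hms).add
          (hf.aestronglyMeasurable.mul (h1 n).continuous.aestronglyMeasurable)
    · intro n
      filter_upwards [ae_restrict_mem hms] with x hx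
      refine (norm_add_le _ _).trans (add_le_add ?_ ?_)
      · refine (norm_sum_le _ _).trans (Finset.sum_le_sum fun i _ => ?_)
        rw [norm_mul]
        exact mul_le_mul ((abs_pd_le i u x).trans (hM' x hx)) (h5 n i x) (norm_nonneg _)
          ((norm_nonneg _).trans (hM' x hx))
      · rw [norm_mul]
        exact mul_le_mul (hF x hx) (h4 n x) (norm_nonneg _) ((abs_nonneg _).trans (hF x hx))
    · refine Eventually.of_forall fun x => ?_
      exact (tendsto_finsetSum _ fun i _ => (h7 i x).const_mul _).add ((h6 x).const_mul _)
  have : (fun n => ∫ x in halfBall d 1, (gdot u (Z n) x + f x * Z n x)) = fun _ => 0 :=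
    funext fun n => smooth (Z n) (h1 n) (h2 n) (h3 n)
  rw [this] at hlim
  exact (tendsto_nhds_unique hlim tendsto_const_nhds)

/-! ### Cutoff functions and Green's inequality -/

theorem pd_mul {i : Fin (d + 1)} {u v : Space d → ℝ} {x : Space d} (hu : DifferentiableAt ℝ u x)
    (hv : DifferentiableAt ℝ v x) :
    pd i (fun y => u y * v y) x = u x * pd i v x + v x * pd i u x := by
  unfold pd
  rw [fderiv_fun_mul hu hv]
  simp

theorem gdot_mul {w u v : Space d → ℝ} {x : Space d} (hu : DifferentiableAt ℝ u x)
    (hv : DifferentiableAt ℝ v x) :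
    gdot w (fun y => u y * v y) x = u x * gdot w v x + v x * gdot w u x := by
  unfold gdot
  rw [Finset.mul_sum, Finset.mul_sum, ← Finset.sum_add_distrib]
  refine Finset.sum_congr rfl fun i _ => ?_
  rw [pd_mul hu hv]
  ring

theorem differentiableAt_of_halfBall {R : ℝ} {u : Space d → ℝ}
    (hu : ContDiffOn ℝ 1 u (halfBall d R)) {x : Space d} (hx : x ∈ halfBall d R) :
    DifferentiableAt ℝ u x :=
  (hu.differentiableOn one_ne_zero).differentiableAt ((isOpen_halfBall R).mem_nhds hx)

/-- The weak equation tested with `φ η`, where `φ` is a cutoff and `η` is only defined on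
a half ball. -/
theorem IsWeakSolution.integral_cutoff {u f : Space d → ℝ} {M F : ℝ} (h : IsWeakSolution u f M F)
    {R : ℝ} (hR : R ≤ 1) {η φ : Space d → ℝ} (hη : ContDiffOn ℝ 1 η (halfBall d R))
    (hφ : ContDiff ℝ 1 φ) (hc : HasCompactSupport φ) (hs : tsupport φ ⊆ halfBall d R) :
    ∫ x in halfBall d R, (φ x * (gdot u η x + f x * η x) + η x * gdot u φ x) = 0 := by
  have hop := isOpen_halfBall (d := d) R
  let ζ : Space d → ℝ := fun x => φ x * η x
  have hsupp : tsupport ζ ⊆ tsupport φ := by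
    refine closure_mono fun x hx => ?_
    intro h0
    exact hx (by simp [ζ, h0])
  have hζ : ContDiff ℝ 1 ζ := by
    rw [contDiff_iff_contDiffAt]
    intro x
    by_cases hx : x ∈ halfBall d R
    · exact hφ.contDiffAt.mul (hη.contDiffAt (hop.mem_nhds hx))
    · have : ζ =ᶠ[𝓝 x] 0 := by
        rw [← notMem_tsupport_iff_eventuallyEq]
        exact fun h => hx (hs (hsupp h))
      exact (contDiffAt_const (c := (0 : ℝ))).congr_of_eventuallyEq this
  have hw := h.weak ζ hζ (HasCompactSupport.of_support_subset_isCompact hc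
    ((subset_tsupport _).trans hsupp)) (hsupp.trans (hs.trans (halfBall_mono hR)))
  rw [← hw]
  symm
  have hz : ∀ x, x ∉ halfBall d R → gdot u ζ x + f x * ζ x = 0 := by
    intro x hx
    have h1 : x ∉ tsupport ζ := fun h => hx (hs (hsupp h))
    have h2 : x ∉ tsupport (fderiv ℝ ζ) := fun h => h1 (tsupport_fderiv_subset ℝ h)
    simp [gdot, pd, image_eq_zero_of_notMem_tsupport h1, image_eq_zero_of_notMem_tsupport h2]
  rw [setIntegral_eq_of_subset_of_forall_sdiff_eq_zero (measurableSet_halfBall 1)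
    (halfBall_mono hR) (fun x hx => hz x hx.2)]
  refine setIntegral_congr_fun (measurableSet_halfBall R) fun x hx => ?_
  simp only [ζ]
  rw [gdot_mul (hφ.differentiable one_ne_zero x) (differentiableAt_of_halfBall hη hx)]
  ring

/-- The derivative of the smooth transition function. -/
def transDeriv : ℝ → ℝ := deriv Real.smoothTransition

theorem continuous_transDeriv : Continuous transDeriv :=
  (Real.smoothTransition.contDiff (n := 1)).continuous_deriv (by norm_num)

theorem transDeriv_nonneg (s : ℝ) : 0 ≤ transDeriv s := Real.smoothTransition.monotone.deriv_nonneg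

theorem transDeriv_of_one_lt {s : ℝ} (hs : 1 < s) : transDeriv s = 0 := by
  have : Real.smoothTransition =ᶠ[𝓝 s] fun _ => 1 := by
    filter_upwards [lt_mem_nhds hs] with t ht using Real.smoothTransition.one_of_one_le ht.le
  rw [transDeriv, this.deriv_eq, deriv_const]

theorem transDeriv_of_neg {s : ℝ} (hs : s < 0) : transDeriv s = 0 := by
  have : Real.smoothTransition =ᶠ[𝓝 s] fun _ => 0 := by
    filter_upwards [gt_mem_nhds hs] with t ht using Real.smoothTransition.zero_of_nonpos ht.le
  rw [transDeriv, this.deriv_eq, deriv_const]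

theorem hasDerivAt_smoothTransition (s : ℝ) :
    HasDerivAt Real.smoothTransition (transDeriv s) s :=
  ((Real.smoothTransition.contDiff (n := 1)).differentiable (by norm_num) s).hasDerivAt

theorem pd_smoothTransition_comp {g : Space d → ℝ} {g' : Space d →L[ℝ] ℝ} {x : Space d}
    (hg : HasFDerivAt g g' x) (i : Fin (d + 1)) :
    pd i (fun y => Real.smoothTransition (g y)) x =
      transDeriv (g x) * g' (EuclideanSpace.single i (1 : ℝ)) := by
  have := (hasDerivAt_smoothTransition (g x)).comp_hasFDerivAt x hg
  have h2 := this.fderiv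
  unfold pd
  change fderiv ℝ (Real.smoothTransition ∘ g) x _ = _
  rw [h2]
  simp

/-- A smooth cutoff away from the thin space, equal to `1` for `x_n ≥ 2δ` and to `0` for
`x_n ≤ δ`. -/
def thinCutoff (δ : ℝ) (x : Space d) : ℝ := Real.smoothTransition (δ⁻¹ * lastCoord x - 1)

/-- The linear functional `x ↦ x_n`. -/
def lastCoordL (d : ℕ) : Space d →L[ℝ] ℝ := EuclideanSpace.proj (Fin.last d)

/-- The argument of the smooth transition function in `thinCutoff` is affine. -/
theorem hasFDerivAt_thinArg (δ : ℝ) (x : Space d) :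
    HasFDerivAt (fun x : Space d => δ⁻¹ * lastCoord x - 1) (δ⁻¹ • lastCoordL d) x := by
  have : HasFDerivAt (fun x : Space d => lastCoord x) (lastCoordL d) x :=
    (lastCoordL d).hasFDerivAt
  exact (this.const_mul δ⁻¹).sub_const 1

theorem contDiff_thinCutoff (δ : ℝ) : ContDiff ℝ 1 (thinCutoff (d := d) δ) := by
  refine (Real.smoothTransition.contDiff (n := 1)).comp ?_
  have : ContDiff ℝ 1 (fun x : Space d => lastCoord x) := (lastCoordL d).contDiff
  exact (contDiff_const.mul this).sub contDiff_const

theorem pd_thinCutoff (δ : ℝ) (i : Fin (d + 1)) (x : Space d) :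
    pd i (thinCutoff δ) x =
      if i = Fin.last d then transDeriv (δ⁻¹ * lastCoord x - 1) * δ⁻¹ else 0 := by
  unfold thinCutoff
  rw [pd_smoothTransition_comp (hasFDerivAt_thinArg δ x)]
  split_ifs with h
  · simp [lastCoordL, h]
  · have : (Fin.last d) ≠ i := fun h' => h h'.symm
    simp [lastCoordL, this]

theorem gdot_thinCutoff (u : Space d → ℝ) (δ : ℝ) (x : Space d) :
    gdot u (thinCutoff δ) x =
      transDeriv (δ⁻¹ * lastCoord x - 1) * δ⁻¹ * pd (Fin.last d) u x := by
  simp [gdot, pd_thinCutoff, mul_comm]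

theorem integral_pd_eq_zero {s : Set (Space d)} (hs : IsOpen s) {g : Space d → ℝ}
    (hg : ContDiff ℝ 1 g) (hgc : HasCompactSupport g) (hgs : tsupport g ⊆ s) (i : Fin (d + 1)) :
    ∫ x in s, pd i g x = 0 := by
  have := (setIntegral_mul_pd hs (u := fun _ => 1) contDiffOn_const hg hgc hgs i).2.2
  simpa [pd] using this

/-- Green's inequality with a smooth cutoff `θ` that need not vanish on the thin space. The
integral of `θ ∂_n χ` over the strip near the thin space is controlled by integrating by parts in
the normal direction. -/
theorem IsWeakSolution.green_cutoff {u f : Space d → ℝ} {M F : ℝ} (h : IsWeakSolution u f M F)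
    {R N b : ℝ} (hR : R ≤ 1) (hbR : b < R) {η θ : Space d → ℝ}
    (hη : ContDiffOn ℝ 1 η (halfBall d R))
    (hN : ∀ x ∈ halfBall d R, |η x| ≤ N) (hN' : ∀ x ∈ halfBall d R, ‖fderiv ℝ η x‖ ≤ N)
    (thin : ∀ ε > 0, ∃ δ > 0, ∀ x ∈ halfBall d R, lastCoord x < δ →
      pd (Fin.last d) u x * η x ≤ ε)
    (hθ : ContDiff ℝ 1 θ) (hθ0 : ∀ x, 0 ≤ θ x) (hθb : ∀ x, b ≤ ‖x‖ → θ x = 0) :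
    0 ≤ ∫ x in halfBall d R, (θ x * (gdot u η x + f x * η x) + η x * gdot u θ x) := by
  have hop := isOpen_halfBall (d := d) R
  have hms := measurableSet_halfBall (d := d) R
  have hsub : halfBall d R ⊆ halfBall d 1 := halfBall_mono hR
  have huR : ContDiffOn ℝ 1 u (halfBall d R) := h.contDiffOn.mono hsub
  have hθs : tsupport θ ⊆ closedBall 0 b := by
    refine closure_minimal (fun x hx => ?_) isClosed_closedBall
    rw [mem_closedBall_zero_iff]
    by_contra hxb
    exact hx (hθb x (not_le.mp hxb).le)
  have hθc : HasCompactSupport θ :=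
    HasCompactSupport.of_support_subset_isCompact (isCompact_closedBall 0 b)
      ((subset_tsupport _).trans hθs)
  obtain ⟨Cθ, hCθ⟩ := hθc.exists_bound_of_continuous hθ.continuous
  obtain ⟨Cθ', hCθ'⟩ := (hθc.fderiv (𝕜 := ℝ)).exists_bound_of_continuous
    (hθ.continuous_fderiv one_ne_zero)
  set I : Space d → ℝ := fun x => θ x * (gdot u η x + f x * η x) + η x * gdot u θ x with hI
  have hImeas : AEStronglyMeasurable I (volume.restrict (halfBall d R)) := by
    refine (hθ.continuous.aestronglyMeasurable.mul
      (((continuousOn_gdot hop huR hη).aestronglyMeasurable hms).add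
        (h.measurable.aestronglyMeasurable.mul
          (hη.continuousOn.aestronglyMeasurable hms)))).add
      ((hη.continuousOn.aestronglyMeasurable hms).mul
        ((continuousOn_gdot hop huR hθ.contDiffOn).aestronglyMeasurable hms))
  set K : ℝ := Cθ * ((d + 1) * (M * N) + F * N) + N * ((d + 1) * (M * Cθ')) with hK
  have hIbd : ∀ x ∈ halfBall d R, ‖I x‖ ≤ K := by
    intro x hx
    have hN0 : 0 ≤ N := (abs_nonneg _).trans (hN x hx)
    have hC0 : 0 ≤ Cθ := (norm_nonneg _).trans (hCθ x)
    have hF0 : 0 ≤ F := (abs_nonneg _).trans (h.abs_rhs_le x (hsub hx))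
    refine (norm_add_le _ _).trans (add_le_add ?_ ?_)
    · rw [norm_mul]
      refine mul_le_mul (hCθ x) ?_ (norm_nonneg _) hC0
      refine (norm_add_le _ _).trans (add_le_add ?_ ?_)
      · exact abs_gdot_le (h.fderiv_le x (hsub hx)) (hN' x hx)
      · rw [norm_mul]
        exact mul_le_mul (h.abs_rhs_le x (hsub hx)) (hN x hx) (norm_nonneg _) hF0
    · rw [norm_mul]
      exact mul_le_mul (hN x hx) (abs_gdot_le (h.fderiv_le x (hsub hx)) (hCθ' x)) (norm_nonneg _)
        hN0
  let δ : ℕ → ℝ := fun n => 1 / ((n : ℝ) + 1)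
  have hδ0 : ∀ n, 0 < δ n := fun n => by positivity
  have hδlim : Tendsto δ atTop (𝓝 0) := tendsto_one_div_add_atTop_nhds_zero_nat
  -- the cutoffs converge to one on the open half ball
  have hlim : Tendsto (fun n => ∫ x in halfBall d R, thinCutoff (δ n) x * I x) atTop
      (𝓝 (∫ x in halfBall d R, I x)) := by
    refine tendsto_integral_of_dominated_convergence (fun _ => K) ?_ (integrable_const _) ?_ ?_
    · intro n
      exact (contDiff_thinCutoff (δ n)).continuous.aestronglyMeasurable.mul hImeas
    · intro n
      filter_upwards [ae_restrict_mem hms] with x hx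
      rw [norm_mul, Real.norm_eq_abs, thinCutoff, abs_of_nonneg (Real.smoothTransition.nonneg _)]
      exact (mul_le_of_le_one_left (norm_nonneg _) (Real.smoothTransition.le_one _)).trans
        (hIbd x hx)
    · filter_upwards [ae_restrict_mem hms] with x hx
      have h1 : ∀ᶠ n in atTop, δ n < lastCoord x / 2 :=
        hδlim.eventually (gt_mem_nhds (half_pos hx.2))
      refine tendsto_const_nhds.congr' ?_
      filter_upwards [h1] with n hn
      rw [thinCutoff, Real.smoothTransition.one_of_one_le, one_mul]
      have : 2 ≤ (δ n)⁻¹ * lastCoord x := by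
        rw [inv_mul_eq_div, le_div_iff₀ (hδ0 n)]
        linarith
      linarith
  set C : ℝ := ∫ x in halfBall d R, |pd (Fin.last d) θ x| with hC
  have hpθ : Continuous (pd (Fin.last d) θ) :=
    (hθ.continuous_fderiv one_ne_zero).clm_apply continuous_const
  have hpθint : IntegrableOn (pd (Fin.last d) θ) (halfBall d R) :=
    integrableOn_halfBall hpθ.continuousOn fun x _ => (abs_pd_le _ θ x).trans (hCθ' x)
  -- `∫ χ I = -∫ θ τ ∂_n u η ≥ -ε ∫ θ τ`, where `τ = ∂_n χ`, and `∫ θ τ = -∫ χ ∂_n θ` is bounded by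
  -- `C` independently of `δ`
  have key : ∀ ε > 0, -(ε * C) ≤ ∫ x in halfBall d R, I x := by
    intro ε hε
    obtain ⟨δ₀, hδ₀, hthin⟩ := thin ε hε
    have h1 : ∀ᶠ n in atTop, δ n < δ₀ / 2 := hδlim.eventually (gt_mem_nhds (half_pos hδ₀))
    refine ge_of_tendsto hlim ?_
    filter_upwards [h1] with n hn
    set χ : Space d → ℝ := thinCutoff (δ n) with hχ
    set τ : Space d → ℝ := fun x => transDeriv ((δ n)⁻¹ * lastCoord x - 1) * (δ n)⁻¹ with hτ
    have hτ0 : ∀ x, 0 ≤ τ x := fun x => mul_nonneg (transDeriv_nonneg _) (inv_nonneg.2 (hδ0 n).le)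
    have hχd := contDiff_thinCutoff (d := d) (δ n)
    have hφ : ContDiff ℝ 1 (fun x => χ x * θ x) := hχd.mul hθ
    have hφs : tsupport (fun x => χ x * θ x) ⊆ {x | δ n ≤ lastCoord x} ∩ closedBall 0 b := by
      refine closure_minimal (fun x hx => ?_)
        ((isClosed_le continuous_const continuous_lastCoord).inter isClosed_closedBall)
      refine ⟨?_, hθs (subset_tsupport _ ?_)⟩
      · by_contra hlt
        apply hx
        have : (δ n)⁻¹ * lastCoord x - 1 ≤ 0 := by
          have hlt' : lastCoord x < δ n := not_le.mp hlt
          have : (δ n)⁻¹ * lastCoord x ≤ 1 := by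
            rw [inv_mul_eq_div, div_le_one (hδ0 n)]; exact hlt'.le
          linarith
        simp [hχ, thinCutoff, Real.smoothTransition.zero_of_nonpos this]
      · intro h0
        exact hx (by simp [h0])
    have hφR : tsupport (fun x => χ x * θ x) ⊆ halfBall d R := by
      intro x hx
      have := hφs hx
      exact ⟨(mem_closedBall_zero_iff.1 this.2).trans_lt hbR, (hδ0 n).trans_le this.1⟩
    have hφc : HasCompactSupport (fun x => χ x * θ x) :=
      HasCompactSupport.of_support_subset_isCompact (isCompact_closedBall 0 b)
        ((subset_tsupport _).trans (hφs.trans inter_subset_right))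
    have hzero := h.integral_cutoff hR hη hφ hφc hφR
    have hflux := integral_pd_eq_zero hop hφ hφc hφR (Fin.last d)
    have hχcont : Continuous χ := hχd.continuous
    have hτcont : Continuous τ :=
      (continuous_transDeriv.comp (by
        have := continuous_lastCoord (d := d)
        fun_prop)).mul continuous_const
    -- boundedness of the normal derivative of the thin cutoff
    obtain ⟨Cτ, hCτ⟩ : ∃ Cτ, ∀ x ∈ halfBall d R, |τ x| ≤ Cτ := by
      obtain ⟨Cτ, hCτ⟩ := (isCompact_closedBall (0 : Space d) R).exists_bound_of_continuousOn
        hτcont.continuousOn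
      exact ⟨Cτ, fun x hx => hCτ x (ball_subset_closedBall (halfBall_subset_ball R hx))⟩
    have hpu := continuousOn_pd hop huR (Fin.last d)
    have i1 : IntegrableOn (fun x => χ x * I x) (halfBall d R) := by
      refine Integrable.of_bound (C := K) (hχcont.aestronglyMeasurable.mul hImeas) ?_
      filter_upwards [ae_restrict_mem hms] with x hx
      rw [norm_mul, Real.norm_eq_abs, hχ, thinCutoff,
        abs_of_nonneg (Real.smoothTransition.nonneg _)]
      exact (mul_le_of_le_one_left (norm_nonneg _) (Real.smoothTransition.le_one _)).trans
        (hIbd x hx)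
    have i2 : IntegrableOn (fun x => θ x * τ x * (pd (Fin.last d) u x * η x)) (halfBall d R) := by
      refine integrableOn_halfBall (C := Cθ * Cτ * (M * N))
        ((hθ.continuous.continuousOn.mul hτcont.continuousOn).mul (hpu.mul hη.continuousOn)) ?_
      intro x hx
      rw [abs_mul, abs_mul (θ x), abs_mul (pd _ _ _)]
      have a1 := hCθ x
      rw [Real.norm_eq_abs] at a1
      have a2 := hCτ x hx
      have a3 := (abs_pd_le (Fin.last d) u x).trans (h.fderiv_le x (hsub hx))
      have a4 := hN x hx
      have := (abs_nonneg _).trans a1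
      have := (abs_nonneg _).trans a2
      have := (abs_nonneg _).trans a3
      exact mul_le_mul (mul_le_mul a1 a2 (abs_nonneg _) (by positivity))
        (mul_le_mul a3 a4 (abs_nonneg _) (by positivity)) (by positivity) (by positivity)
    have i3 : IntegrableOn (fun x => θ x * τ x) (halfBall d R) := by
      refine integrableOn_halfBall (C := Cθ * Cτ)
        (hθ.continuous.continuousOn.mul hτcont.continuousOn) ?_
      intro x hx
      rw [abs_mul]
      have a1 := hCθ x
      rw [Real.norm_eq_abs] at a1
      exact mul_le_mul a1 (hCτ x hx) (abs_nonneg _) ((abs_nonneg _).trans a1)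
    have i4 : IntegrableOn (fun x => χ x * pd (Fin.last d) θ x) (halfBall d R) := by
      refine integrableOn_halfBall (C := Cθ')
        (hχcont.continuousOn.mul hpθ.continuousOn) ?_
      intro x hx
      rw [abs_mul, hχ, thinCutoff, abs_of_nonneg (Real.smoothTransition.nonneg _)]
      exact (mul_le_of_le_one_left (abs_nonneg _) (Real.smoothTransition.le_one _)).trans
        ((abs_pd_le _ θ x).trans (hCθ' x))
    have e1 : (∫ x in halfBall d R, χ x * I x) +
        ∫ x in halfBall d R, θ x * τ x * (pd (Fin.last d) u x * η x) = 0 := by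
      rw [← integral_add i1 i2, ← hzero]
      refine setIntegral_congr_fun hms fun x hx => ?_
      simp only [hI]
      rw [gdot_mul (hχd.differentiable one_ne_zero x) (hθ.differentiable one_ne_zero x),
        gdot_thinCutoff]
      simp only [hτ]
      ring
    have e2 : (∫ x in halfBall d R, χ x * pd (Fin.last d) θ x) +
        ∫ x in halfBall d R, θ x * τ x = 0 := by
      rw [← integral_add i4 i3, ← hflux]
      refine setIntegral_congr_fun hms fun x hx => ?_
      rw [pd_mul (hχd.differentiable one_ne_zero x) (hθ.differentiable one_ne_zero x),
        hχ, pd_thinCutoff, if_pos rfl]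
    have e3 : ∫ x in halfBall d R, θ x * τ x * (pd (Fin.last d) u x * η x) ≤
        ε * ∫ x in halfBall d R, θ x * τ x := by
      rw [← integral_const_mul]
      refine setIntegral_mono_on i2 (i3.const_mul ε) hms fun x hx => ?_
      by_cases hxδ : lastCoord x < δ₀
      · have := mul_le_mul_of_nonneg_left (hthin x hx hxδ) (mul_nonneg (hθ0 x) (hτ0 x))
        linarith
      · have hτz : τ x = 0 := by
          simp only [hτ]
          rw [transDeriv_of_one_lt, zero_mul]
          have : 2 < (δ n)⁻¹ * lastCoord x := by
            rw [inv_mul_eq_div, lt_div_iff₀ (hδ0 n)]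
            linarith
          linarith
        simp [hτz]
    have e4 : -C ≤ ∫ x in halfBall d R, χ x * pd (Fin.last d) θ x := by
      rw [hC, ← integral_neg]
      refine setIntegral_mono_on hpθint.abs.neg i4 hms fun x hx => ?_
      have hχ0 : 0 ≤ χ x := Real.smoothTransition.nonneg _
      have hχ1 : χ x ≤ 1 := Real.smoothTransition.le_one _
      have : |χ x * pd (Fin.last d) θ x| ≤ |pd (Fin.last d) θ x| := by
        rw [abs_mul, abs_of_nonneg hχ0]
        exact mul_le_of_le_one_left (abs_nonneg _) hχ1
      have := neg_abs_le (χ x * pd (Fin.last d) θ x)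
      linarith
    have e5 : ε * ∫ x in halfBall d R, θ x * τ x ≤ ε * C :=
      mul_le_mul_of_nonneg_left (by linarith) hε.le
    linarith
  have hfin : Tendsto (fun ε : ℝ => -(ε * C)) (𝓝[>] 0) (𝓝 0) := by
    have : Continuous fun ε : ℝ => -(ε * C) := by fun_prop
    have := this.tendsto 0
    simp only [zero_mul, neg_zero] at this
    exact this.mono_left nhdsWithin_le_nhds
  refine le_of_tendsto hfin ?_
  filter_upwards [self_mem_nhdsWithin] with ε hε using key ε hε

/-- A smooth radial cutoff, equal to `1` on the ball of radius `a` and to `0` outside the ball of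
radius `r`. -/
def radialCutoff (a r : ℝ) (x : Space d) : ℝ :=
  Real.smoothTransition ((r ^ 2 - a ^ 2)⁻¹ * (r ^ 2 - ‖x‖ ^ 2))

/-- Minus the radial derivative of `radialCutoff` divided by the radius. -/
def radialDensity (a r ρ : ℝ) : ℝ :=
  2 * (r ^ 2 - a ^ 2)⁻¹ * transDeriv ((r ^ 2 - a ^ 2)⁻¹ * (r ^ 2 - ρ ^ 2))

theorem contDiff_radialCutoff (a r : ℝ) : ContDiff ℝ 1 (radialCutoff (d := d) a r) := by
  refine (Real.smoothTransition.contDiff (n := 1)).comp ?_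
  exact contDiff_const.mul (contDiff_const.sub (contDiff_norm_sq ℝ))

theorem gdot_radialCutoff (u : Space d → ℝ) (a r : ℝ) (x : Space d) :
    gdot u (radialCutoff a r) x = -(radialDensity a r ‖x‖ * euler u x) := by
  have h1 : HasFDerivAt (fun y : Space d => (r ^ 2 - a ^ 2)⁻¹ * (r ^ 2 - ‖y‖ ^ 2))
      ((r ^ 2 - a ^ 2)⁻¹ • (-((2 : ℝ) • (innerSL ℝ x)) : Space d →L[ℝ] ℝ)) x := by
    have h2 : HasFDerivAt (fun y : Space d => ‖y‖ ^ 2) ((2 : ℝ) • (innerSL ℝ x)) x := by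
      have h3 := (hasStrictFDerivAt_norm_sq x).hasFDerivAt
      rwa [← Nat.cast_smul_eq_nsmul ℝ] at h3
    exact (h2.const_sub (r ^ 2)).const_mul _
  have h3 : ∀ i, pd i (radialCutoff a r) x = -(radialDensity a r ‖x‖ * x i) := by
    intro i
    unfold radialCutoff radialDensity
    rw [pd_smoothTransition_comp h1]
    simp [EuclideanSpace.inner_single_right]
    ring
  rw [gdot, euler_eq_sum, Finset.mul_sum, ← Finset.sum_neg_distrib]
  refine Finset.sum_congr rfl fun i _ => ?_
  rw [h3]
  ring

theorem continuousOn_euler {u : Space d → ℝ} {s : Set (Space d)} (hs : IsOpen s)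
    (hu : ContDiffOn ℝ 1 u s) : ContinuousOn (euler u) s :=
  (hu.continuousOn_fderiv_of_isOpen hs le_rfl).clm_apply continuousOn_id

theorem abs_euler_le {u : Space d → ℝ} {x : Space d} {M : ℝ} (hM : ‖fderiv ℝ u x‖ ≤ M)
    (hx : ‖x‖ ≤ 1) : |euler u x| ≤ M := by
  refine ((fderiv ℝ u x).le_opNorm _).trans ?_
  have := mul_le_mul hM hx (norm_nonneg x) ((norm_nonneg _).trans hM)
  linarith

theorem radialDensity_nonneg {a r : ℝ} (ha : 0 ≤ a) (har : a < r) (ρ : ℝ) :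
    0 ≤ radialDensity a r ρ := by
  have : 0 < r ^ 2 - a ^ 2 := by nlinarith
  exact mul_nonneg (by positivity) (transDeriv_nonneg _)

theorem radialDensity_eq_zero {a r ρ : ℝ} (ha : 0 ≤ a) (har : a < r) (hρ : 0 ≤ ρ)
    (h : ρ < a ∨ r < ρ) : radialDensity a r ρ = 0 := by
  have h0 : 0 < r ^ 2 - a ^ 2 := by nlinarith
  unfold radialDensity
  rcases h with h | h
  · rw [transDeriv_of_one_lt, mul_zero]
    rw [inv_mul_eq_div, one_lt_div h0]
    nlinarith
  · rw [transDeriv_of_neg, mul_zero]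
    rw [inv_mul_eq_div]
    exact div_neg_of_neg_of_pos (by nlinarith) h0

theorem integral_radialDensity {a r R : ℝ} (ha : 0 < a) (har : a < r) (hrR : r < R) :
    ∫ ρ in (0 : ℝ)..R, ρ * radialDensity a r ρ = 1 := by
  have h0 : 0 < r ^ 2 - a ^ 2 := by nlinarith
  let g : ℝ → ℝ := fun ρ => -Real.smoothTransition ((r ^ 2 - a ^ 2)⁻¹ * (r ^ 2 - ρ ^ 2))
  have hd : ∀ ρ, HasDerivAt g (ρ * radialDensity a r ρ) ρ := by
    intro ρ
    have h1 : HasDerivAt (fun ρ : ℝ => (r ^ 2 - a ^ 2)⁻¹ * (r ^ 2 - ρ ^ 2))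
        ((r ^ 2 - a ^ 2)⁻¹ * (-(2 * ρ))) ρ := by
      have h2 : HasDerivAt (fun ρ : ℝ => ρ ^ 2) (2 * ρ) ρ := by simpa using hasDerivAt_pow 2 ρ
      exact (h2.const_sub (r ^ 2)).const_mul _
    have h3 := ((hasDerivAt_smoothTransition _).comp ρ h1).neg
    refine HasDerivAt.congr_deriv (f := g) h3 ?_
    unfold radialDensity
    ring
  have hcont : Continuous fun ρ => ρ * radialDensity a r ρ := by
    have := continuous_transDeriv
    unfold radialDensity
    fun_prop
  rw [intervalIntegral.integral_eq_sub_of_hasDerivAt (fun x _ => hd x)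
    (hcont.intervalIntegrable _ _)]
  simp only [g]
  rw [Real.smoothTransition.zero_of_nonpos, Real.smoothTransition.one_of_one_le]
  · ring
  · rw [inv_mul_eq_div, one_le_div h0]
    nlinarith
  · rw [inv_mul_eq_div]
    exact div_nonpos_of_nonpos_of_nonneg (by nlinarith) h0.le

/-- Green's inequality on half balls for a test function `η` whose product with the normal
derivative of `u` is asymptotically nonpositive at the thin space. No trace of the normal derivative
is needed. -/
theorem IsWeakSolution.green_le {u f : Space d → ℝ} {M F : ℝ} (h : IsWeakSolution u f M F)
    {R N r : ℝ} (hR : R ≤ 1) (hr : 0 < r) (hrR : r < R) {η : Space d → ℝ}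
    (hη : ContDiffOn ℝ 1 η (halfBall d R))
    (hN : ∀ x ∈ halfBall d R, |η x| ≤ N) (hN' : ∀ x ∈ halfBall d R, ‖fderiv ℝ η x‖ ≤ N)
    (thin : ∀ ε > 0, ∃ δ > 0, ∀ x ∈ halfBall d R, lastCoord x < δ →
      pd (Fin.last d) u x * η x ≤ ε) :
    r ^ d * (hemi (fun x => euler u x * η x) r / r) ≤
      ∫ x in halfBall d r, (gdot u η x + f x * η x) := by
  have hop := isOpen_halfBall (d := d) R
  have hms := measurableSet_halfBall (d := d) R
  have hsub : halfBall d R ⊆ halfBall d 1 := halfBall_mono hR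
  have huR : ContDiffOn ℝ 1 u (halfBall d R) := h.contDiffOn.mono hsub
  set g : Space d → ℝ := fun x => gdot u η x + f x * η x with hg
  set B : Space d → ℝ := fun x => euler u x * η x with hB
  have hgint : IntegrableOn g (halfBall d R) := by
    refine Integrable.of_bound (C := (d + 1) * (M * N) + F * N)
      (((continuousOn_gdot hop huR hη).aestronglyMeasurable hms).add
        (h.measurable.aestronglyMeasurable.mul
          (hη.continuousOn.aestronglyMeasurable hms))) ?_
    filter_upwards [ae_restrict_mem hms] with x hx
    refine (norm_add_le _ _).trans (add_le_add ?_ ?_)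
    · exact abs_gdot_le (h.fderiv_le x (hsub hx)) (hN' x hx)
    · rw [norm_mul]
      exact mul_le_mul (h.abs_rhs_le x (hsub hx)) (hN x hx) (norm_nonneg _)
        ((abs_nonneg _).trans (h.abs_rhs_le x (hsub hx)))
  have hBc : ContinuousOn B (halfBall d R) := (continuousOn_euler hop huR).mul hη.continuousOn
  have hBb : ∀ x ∈ halfBall d R, |B x| ≤ M * N := by
    intro x hx
    rw [abs_mul]
    have := abs_euler_le (h.fderiv_le x (hsub hx)) (hx.1.le.trans hR)
    exact mul_le_mul this (hN x hx) (abs_nonneg _) ((abs_nonneg _).trans this)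
  set β : ℝ → ℝ := fun ρ => ρ ^ d * (hemi B ρ / ρ) with hβ
  have hβc : ContinuousOn β (Ioo 0 R) :=
    (continuousOn_id.pow d).mul
      ((continuousOn_hemi hBc hBb).div continuousOn_id fun x hx => hx.1.ne')
  have hβr : ContinuousAt β r := hβc.continuousAt (isOpen_Ioo.mem_nhds ⟨hr, hrR⟩)
  -- inequality with a radial cutoff
  have step : ∀ a, 0 < a → a < r →
      ∫ ρ in (0 : ℝ)..R, (ρ * radialDensity a r ρ) * β ρ ≤
        ∫ x in halfBall d R, radialCutoff a r x * g x := by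
    intro a ha har
    have h0 : 0 < r ^ 2 - a ^ 2 := by nlinarith
    have hθ := contDiff_radialCutoff (d := d) a r
    have hdc : Continuous (radialDensity a r) := by
      have := continuous_transDeriv
      unfold radialDensity
      fun_prop
    have hgc := h.green_cutoff hR hrR hη hN hN' thin hθ
      (fun x => Real.smoothTransition.nonneg _) (fun x hx => by
        refine Real.smoothTransition.zero_of_nonpos ?_
        rw [inv_mul_eq_div]
        exact div_nonpos_of_nonpos_of_nonneg (by nlinarith) h0.le)
    have i1 : IntegrableOn (fun x => radialCutoff a r x * g x) (halfBall d R) := by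
      refine Integrable.mono hgint (hθ.continuous.aestronglyMeasurable.mul hgint.1) ?_
      refine Eventually.of_forall fun x => ?_
      rw [norm_mul, Real.norm_eq_abs, radialCutoff, abs_of_nonneg (Real.smoothTransition.nonneg _)]
      exact mul_le_of_le_one_left (norm_nonneg _) (Real.smoothTransition.le_one _)
    obtain ⟨Cρ, hCρ⟩ := (isCompact_Icc (a := (0 : ℝ)) (b := R)).exists_bound_of_continuousOn
      hdc.continuousOn
    have i2 : IntegrableOn (fun x => radialDensity a r ‖x‖ * B x) (halfBall d R) := by
      refine integrableOn_halfBall (C := Cρ * (M * N))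
        ((hdc.comp continuous_norm).continuousOn.mul hBc) fun x hx => ?_
      rw [abs_mul]
      have := hCρ ‖x‖ ⟨norm_nonneg x, hx.1.le⟩
      exact mul_le_mul this (hBb x hx) (abs_nonneg _) ((abs_nonneg _).trans this)
    have e1 : ∫ x in halfBall d R, (radialCutoff a r x * g x + η x * gdot u (radialCutoff a r) x) =
        (∫ x in halfBall d R, radialCutoff a r x * g x) -
          ∫ x in halfBall d R, radialDensity a r ‖x‖ * B x := by
      rw [← integral_sub i1 i2]
      refine setIntegral_congr_fun hms fun x hx => ?_
      simp only [hB]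
      rw [gdot_radialCutoff]
      ring
    have e2 : ∫ x in halfBall d R, radialDensity a r ‖x‖ * B x =
        ∫ ρ in (0 : ℝ)..R, (ρ * radialDensity a r ρ) * β ρ := by
      rw [setIntegral_halfBall_eq (hr.trans hrR).le i2]
      refine intervalIntegral.integral_congr_ae (Eventually.of_forall fun ρ hρ => ?_)
      rw [uIoc_of_le (hr.trans hrR).le] at hρ
      have : hemi (fun x => radialDensity a r ‖x‖ * B x) ρ = radialDensity a r ρ * hemi B ρ := by
        unfold hemi
        rw [← integral_const_mul]
        refine integral_congr_ae (Eventually.of_forall fun y => ?_)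
        simp [norm_smul, abs_of_pos hρ.1]
      rw [this, hβ]
      have := hρ.1.ne'
      field_simp
    rw [e1, e2] at hgc
    linarith
  -- the radial density is an approximation of the point mass at `r`
  have step2 : ∀ ε > 0, ∀ᶠ a in 𝓝[<] r,
      β r - ε ≤ ∫ x in halfBall d R, radialCutoff a r x * g x := by
    intro ε hε
    have h1 : ∀ᶠ ρ in 𝓝 r, β r - ε < β ρ := hβr.eventually (lt_mem_nhds (by linarith))
    obtain ⟨l, hl, hlε⟩ : ∃ l < r, ∀ ρ, l < ρ → ρ ≤ r → β r - ε < β ρ := by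
      obtain ⟨l, hl, h2⟩ := exists_Ioc_subset_of_mem_nhds h1 ⟨r - 1, by linarith⟩
      exact ⟨l, hl, fun ρ h3 h4 => h2 ⟨h3, h4⟩⟩
    filter_upwards [Ioo_mem_nhdsLT (max_lt hl hr)] with a ha
    have hal : l < a := (le_max_left _ _).trans_lt ha.1
    have ha0 : 0 < a := (le_max_right _ _).trans_lt ha.1
    refine le_trans ?_ (step a ha0 ha.2)
    have hdc : Continuous fun ρ => ρ * radialDensity a r ρ := by
      have := continuous_transDeriv
      unfold radialDensity
      fun_prop
    have e : β r - ε = ∫ ρ in (0 : ℝ)..R, (ρ * radialDensity a r ρ) * (β r - ε) := by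
      rw [intervalIntegral.integral_mul_const, integral_radialDensity ha0 ha.2 hrR, one_mul]
    rw [e]
    have hmain : ∀ ρ ∈ Ioo 0 R, (ρ * radialDensity a r ρ) * (β r - ε) ≤
        (ρ * radialDensity a r ρ) * β ρ := by
      intro ρ hρ
      by_cases hin : a ≤ ρ ∧ ρ ≤ r
      · exact mul_le_mul_of_nonneg_left (hlε ρ (hal.trans_le hin.1) hin.2).le
          (mul_nonneg hρ.1.le (radialDensity_nonneg ha0.le ha.2 ρ))
      · rw [radialDensity_eq_zero ha0.le ha.2 hρ.1.le]
        · simp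
        · by_contra hc
          push Not at hc
          exact hin hc
    rw [intervalIntegral.integral_of_le (hr.trans hrR).le,
      intervalIntegral.integral_of_le (hr.trans hrR).le, integral_Ioc_eq_integral_Ioo,
      integral_Ioc_eq_integral_Ioo]
    refine setIntegral_mono_on ?_ ?_ measurableSet_Ioo hmain
    · exact ((hdc.mul continuous_const).integrableOn_Icc (a := 0) (b := R)).mono_set
        Ioo_subset_Icc_self
    · -- the integrand is continuous and supported in a compact subset of the open interval
      have hsupp : ∀ ρ ∈ Ioo 0 R \ Icc a r, (ρ * radialDensity a r ρ) * β ρ = 0 := by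
        intro ρ hρ
        rw [radialDensity_eq_zero ha0.le ha.2 hρ.1.1.le]
        · simp
        · by_contra hc
          push Not at hc
          exact hρ.2 hc
      have hsubI : Icc a r ⊆ Ioo 0 R := fun ρ hρ => ⟨ha0.trans_le hρ.1, hρ.2.trans_lt hrR⟩
      have : IntegrableOn (fun ρ => (ρ * radialDensity a r ρ) * β ρ) (Icc a r) :=
        (hdc.continuousOn.mul (hβc.mono hsubI)).integrableOn_Icc
      exact this.of_forall_sdiff_eq_zero measurableSet_Ioo hsupp
  have hlim : Tendsto (fun a => ∫ x in halfBall d R, radialCutoff a r x * g x) (𝓝[<] r)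
      (𝓝 (∫ x in halfBall d r, g x)) := by
    have e : ∫ x in halfBall d r, g x =
        ∫ x in halfBall d R, (halfBall d r).indicator g x := by
      rw [setIntegral_indicator (measurableSet_halfBall r),
        inter_eq_self_of_subset_right (halfBall_mono hrR.le)]
    rw [e]
    refine tendsto_integral_filter_of_dominated_convergence (fun x => ‖g x‖) ?_ ?_ hgint.norm ?_
    · exact Eventually.of_forall fun a =>
        (contDiff_radialCutoff a r).continuous.aestronglyMeasurable.mul hgint.1
    · refine Eventually.of_forall fun a => Eventually.of_forall fun x => ?_
      rw [norm_mul, Real.norm_eq_abs, radialCutoff, abs_of_nonneg (Real.smoothTransition.nonneg _)]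
      exact mul_le_of_le_one_left (norm_nonneg _) (Real.smoothTransition.le_one _)
    · filter_upwards [ae_restrict_mem hms] with x hx
      refine tendsto_const_nhds.congr' ?_
      by_cases hxr : ‖x‖ < r
      · rw [indicator_of_mem (show x ∈ halfBall d r from ⟨hxr, hx.2⟩)]
        filter_upwards [Ioo_mem_nhdsLT hxr] with a ha
        have ha0 : 0 ≤ a := (norm_nonneg x).trans ha.1.le
        have h0 : 0 < r ^ 2 - a ^ 2 := by nlinarith [ha.2]
        rw [radialCutoff, Real.smoothTransition.one_of_one_le, one_mul]
        rw [inv_mul_eq_div, one_le_div h0]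
        nlinarith [norm_nonneg x, ha.1]
      · rw [indicator_of_notMem (fun hh => hxr hh.1)]
        filter_upwards [Ioo_mem_nhdsLT hr] with a ha
        have h0 : 0 < r ^ 2 - a ^ 2 := by nlinarith [ha.2, ha.1]
        rw [radialCutoff, Real.smoothTransition.zero_of_nonpos, zero_mul]
        rw [inv_mul_eq_div]
        exact div_nonpos_of_nonpos_of_nonneg (by nlinarith) h0.le
  have : ∀ ε > 0, β r ≤ (∫ x in halfBall d r, g x) + ε := by
    intro ε hε
    have := ge_of_tendsto hlim (step2 ε hε)
    linarith
  exact le_of_forall_pos_le_add this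

/-! ### Solutions in half-ball form and the energy of rescalings -/

/-- The half-ball form of a solution of the thin obstacle problem. The field `thin` says that, for
every competitor `w` that is nonnegative on the thin space, `∂_n u (w - u)` is asymptotically
nonpositive at the thin space. It encodes the sign of `∂_n u` and complementarity without traces of
the gradient. The bound on `f` holds everywhere in the half ball. -/
structure IsSignorini (k : ℕ) (u f : Space d → ℝ) (M : ℝ) : Prop extends
    IsWeakSolution u f M M where
  continuousOn : ContinuousOn u (upperBall d)
  nonneg : ∀ x ∈ thinBall d 1, 0 ≤ u x
  thin : ∀ R < 1, ∀ w : Space d → ℝ, ContinuousOn w {x | ‖x‖ ≤ R ∧ 0 ≤ lastCoord x} →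
    (∀ x, ‖x‖ ≤ R → lastCoord x = 0 → 0 ≤ w x) → ∀ ε > 0, ∃ δ > 0, ∀ x ∈ halfBall d R,
      lastCoord x < δ → pd (Fin.last d) u x * (w x - u x) ≤ ε
  abs_rhs_le_pow : ∀ x ∈ halfBall d 1, |f x| ≤ M * ‖x‖ ^ (k - 1)

/-- A function that vanishes at `a` and is nonnegative to the right of `a` has a nonnegative
derivative at `a`. -/
theorem nonneg_of_hasDerivAt_of_eventually_nonneg {K : ℝ → ℝ} {K' a : ℝ} (hK : HasDerivAt K K' a)
    (h0 : K a = 0) (hpos : ∀ᶠ t in 𝓝[>] a, 0 ≤ K t) : 0 ≤ K' := by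
  have h1 : Tendsto (slope K a) (𝓝[>] a) (𝓝 K') :=
    (hasDerivAt_iff_tendsto_slope.1 hK).mono_left
      (nhdsWithin_mono _ fun x hx => ne_of_gt hx)
  refine ge_of_tendsto h1 ?_
  filter_upwards [hpos, self_mem_nhdsWithin] with t ht hta
  rw [slope_def_field, h0, sub_zero]
  exact div_nonneg ht (sub_nonneg.2 (le_of_lt hta))

/-- The function `x · ∇u - l u`, which vanishes when `u` is homogeneous of degree `l`. -/
def homDefect (l : ℝ) (u : Space d → ℝ) (x : Space d) : ℝ := euler u x - l * u x

/-- The derivative at `t = 1` of integrals of the rescalings `t ^ (-l) u (t x)`. -/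
theorem hasDerivAt_integral_rescale {X : Type*} [TopologicalSpace X] [MeasurableSpace X]
    [OpensMeasurableSpace X] {s : Set X} (hs : MeasurableSet s)
    {μ : Measure X} [IsFiniteMeasure (μ.restrict s)] {P : X → Space d} (hP : Continuous P) {ρ : ℝ}
    (hρ : 0 < ρ) (hρ1 : ρ < 1) (hPs : ∀ x ∈ s, P x ∈ halfBall d ρ) {a : X → ℝ} {A M : ℝ}
    (ha : AEStronglyMeasurable a (μ.restrict s)) (hA : ∀ x ∈ s, |a x| ≤ A)
    {u : Space d → ℝ} (hu : ContDiffOn ℝ 1 u (halfBall d 1)) (hM : ∀ x ∈ halfBall d 1, |u x| ≤ M)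
    (hM' : ∀ x ∈ halfBall d 1, ‖fderiv ℝ u x‖ ≤ M) (l : ℝ) :
    HasDerivAt (fun t : ℝ => ∫ x in s, a x * (t ^ (-l) * u (t • P x) - u (P x)) ∂μ)
      (∫ x in s, a x * homDefect l u (P x) ∂μ) 1 := by
  obtain ⟨ε, hε, hε1, hερ⟩ : ∃ ε : ℝ, 0 < ε ∧ ε ≤ 1 / 2 ∧ (1 + ε) * ρ < 1 := by
    refine ⟨min (1 / 2) ((1 - ρ) / 2), lt_min (by norm_num) (by linarith), min_le_left _ _, ?_⟩
    have := min_le_right (1 / 2 : ℝ) ((1 - ρ) / 2)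
    nlinarith
  have hIpos : ∀ t ∈ Ioo (1 - ε) (1 + ε), 0 < t := fun t ht => by linarith [ht.1]
  have hmem : ∀ t ∈ Ioo (1 - ε) (1 + ε), ∀ x ∈ s, t • P x ∈ halfBall d 1 := by
    intro t ht x hx
    have ht0 := hIpos t ht
    refine ⟨?_, ?_⟩
    · rw [norm_smul, Real.norm_eq_abs, abs_of_pos ht0]
      calc t * ‖P x‖ ≤ (1 + ε) * ρ :=
            mul_le_mul ht.2.le (hPs x hx).1.le (norm_nonneg _) (by linarith)
        _ < 1 := hερ
    · rw [lastCoord_smul]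
      exact mul_pos ht0 (hPs x hx).2
  have hsub : halfBall d ρ ⊆ halfBall d 1 := halfBall_mono hρ1.le
  obtain ⟨C₁, hC₁⟩ := (isCompact_Icc (a := (1 / 2 : ℝ)) (b := 3 / 2)).exists_bound_of_continuousOn
    (f := fun t : ℝ => t ^ (-l)) (by
      refine continuousOn_id.rpow_const fun x hx => Or.inl ?_
      have : (1 / 2 : ℝ) ≤ x := hx.1
      simp only [id]; linarith)
  obtain ⟨C₂, hC₂⟩ := (isCompact_Icc (a := (1 / 2 : ℝ)) (b := 3 / 2)).exists_bound_of_continuousOn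
    (f := fun t : ℝ => (-l) * t ^ (-l - 1)) (by
      refine continuousOn_const.mul (continuousOn_id.rpow_const fun x hx => Or.inl ?_)
      have : (1 / 2 : ℝ) ≤ x := hx.1
      simp only [id]; linarith)
  have hIcc : ∀ t ∈ Ioo (1 - ε) (1 + ε), t ∈ Icc (1 / 2 : ℝ) (3 / 2) := fun t ht =>
    ⟨by linarith [ht.1], by linarith [ht.2]⟩
  have h1mem : (1 : ℝ) ∈ Ioo (1 - ε) (1 + ε) := ⟨by linarith, by linarith⟩
  have hnhds : Ioo (1 - ε) (1 + ε) ∈ 𝓝 (1 : ℝ) := isOpen_Ioo.mem_nhds h1mem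
  have hcomp : ∀ t ∈ Ioo (1 - ε) (1 + ε),
      AEStronglyMeasurable (fun x => u (t • P x)) (μ.restrict s) := by
    intro t ht
    refine ContinuousOn.aestronglyMeasurable ?_ hs
    exact hu.continuousOn.comp (hP.const_smul t).continuousOn (hmem t ht)
  have hcomp0 : AEStronglyMeasurable (fun x => u (P x)) (μ.restrict s) := by
    refine ContinuousOn.aestronglyMeasurable ?_ hs
    exact hu.continuousOn.comp hP.continuousOn fun x hx => hsub (hPs x hx)
  have key := hasDerivAt_integral_of_dominated_loc_of_deriv_le (μ := μ.restrict s)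
    (F := fun t x => a x * (t ^ (-l) * u (t • P x) - u (P x)))
    (F' := fun t x => a x * ((-l) * t ^ (-l - 1) * u (t • P x) +
      t ^ (-l) * fderiv ℝ u (t • P x) (P x)))
    (x₀ := 1) (s := Ioo (1 - ε) (1 + ε)) (bound := fun _ => A * (C₂ * M + C₁ * M)) hnhds
    ?_ ?_ ?_ ?_ (integrable_const _) ?_
  · have h2 := key.2
    refine h2.congr_deriv ?_
    refine integral_congr_ae (Eventually.of_forall fun x => ?_)
    simp only [homDefect, euler, Real.one_rpow, one_smul, mul_one, one_mul]
    ring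
  · filter_upwards [hnhds] with t ht
    exact ha.mul (((hcomp t ht).const_mul _).sub hcomp0)
  · simp only [Real.one_rpow, one_smul, one_mul, sub_self, mul_zero]
    exact integrable_zero _ _ _
  · refine ha.mul (((hcomp 1 h1mem).const_mul _).add (AEStronglyMeasurable.const_mul ?_ _))
    refine ContinuousOn.aestronglyMeasurable ?_ hs
    have hfc : ContinuousOn (fun x => fderiv ℝ u x) (halfBall d 1) :=
      hu.continuousOn_fderiv_of_isOpen (isOpen_halfBall 1) le_rfl
    have hmap : MapsTo (fun x => (1 : ℝ) • P x) s (halfBall d 1) := hmem 1 h1mem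
    have hc : ContinuousOn (fun x => fderiv ℝ u ((1 : ℝ) • P x)) s :=
      hfc.comp (f := fun x => (1 : ℝ) • P x) (by fun_prop) hmap
    exact hc.clm_apply hP.continuousOn
  · filter_upwards [ae_restrict_mem hs] with x hx t ht
    have hA0 : 0 ≤ A := (abs_nonneg _).trans (hA x hx)
    have hC10 : 0 ≤ C₁ := (norm_nonneg _).trans (hC₁ t (hIcc t ht))
    have hC20 : 0 ≤ C₂ := (norm_nonneg _).trans (hC₂ t (hIcc t ht))
    have b1 : |(-l) * t ^ (-l - 1)| ≤ C₂ := hC₂ t (hIcc t ht)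
    have b2 : |t ^ (-l)| ≤ C₁ := hC₁ t (hIcc t ht)
    have b3 : |u (t • P x)| ≤ M := hM _ (hmem t ht x hx)
    have b4 : |fderiv ℝ u (t • P x) (P x)| ≤ M := by
      rw [← Real.norm_eq_abs]
      refine (ContinuousLinearMap.le_opNorm _ _).trans ?_
      have h1 := hM' _ (hmem t ht x hx)
      have h2 : ‖P x‖ ≤ 1 := ((hPs x hx).1.trans hρ1).le
      have := mul_le_mul h1 h2 (norm_nonneg _) ((norm_nonneg _).trans h1)
      linarith
    have b5 := mul_le_mul b1 b3 (abs_nonneg _) hC20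
    have b6 := mul_le_mul b2 b4 (abs_nonneg _) hC10
    rw [← abs_mul] at b5 b6
    have b7 := mul_le_mul (hA x hx) ((abs_add_le _ _).trans (add_le_add b5 b6)) (abs_nonneg _) hA0
    rwa [← abs_mul] at b7
  · filter_upwards [ae_restrict_mem hs] with x hx t ht
    have h1 := Real.hasDerivAt_rpow_const (p := -l) (Or.inl (hIpos t ht).ne')
    have h2 := hasDerivAt_comp_smul (y := P x) (differentiableAt_of_halfBall hu (hmem t ht x hx))
    exact (((h1.mul h2).sub_const (u (P x))).const_mul (a x))

theorem halfBall_smul {t r : ℝ} (ht : 0 < t) : t • halfBall d r = halfBall d (t * r) := by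
  ext x
  rw [mem_smul_set_iff_inv_smul_mem₀ ht.ne']
  simp only [halfBall, mem_ofPred_eq, norm_smul, lastCoord_smul, norm_inv, Real.norm_eq_abs,
    abs_of_pos ht]
  rw [inv_mul_lt_iff₀ ht]
  exact and_congr_right fun _ => mul_pos_iff_of_pos_left (inv_pos.2 ht)

theorem hasFDerivAt_rescale {u : Space d → ℝ} {t c : ℝ} {x : Space d}
    (hu : DifferentiableAt ℝ u (t • x)) :
    HasFDerivAt (fun y => c * u (t • y)) (c • (t • fderiv ℝ u (t • x))) x := by
  have h1 : HasFDerivAt (fun y : Space d => t • y) (t • ContinuousLinearMap.id ℝ (Space d)) x :=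
    (hasFDerivAt_id x).const_smul t
  have h2 := (hu.hasFDerivAt.comp x h1).const_mul c
  refine h2.congr_fderiv ?_
  ext v
  simp

/-- The derivative of the Dirichlet energy along the rescalings `t ^ (-l) u (t x)`, which are
admissible competitors for `u`. -/
theorem IsSignorini.energy_deriv_ge {k : ℕ} {u f : Space d → ℝ} {M : ℝ}
    (h : IsSignorini k u f M) {r : ℝ} (hr : 0 < r) (hr1 : r < 1) (l : ℝ) :
    2 * (r ^ d * (hemi (fun x => euler u x * homDefect l u x) r / r)) -
        2 * ∫ x in halfBall d r, f x * homDefect l u x ≤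
      r * (r ^ d * hemi (gdot u u) r) -
        ((d : ℝ) - 1 + 2 * l) * ∫ x in halfBall d r, gdot u u x := by
  have hop1 := isOpen_halfBall (d := d) 1
  have hgc : ContinuousOn (gdot u u) (halfBall d 1) :=
    continuousOn_gdot hop1 h.contDiffOn h.contDiffOn
  have hgb : ∀ x ∈ halfBall d 1, |gdot u u x| ≤ (d + 1) * (M * M) := fun x hx =>
    abs_gdot_le (h.fderiv_le x hx) (h.fderiv_le x hx)
  set D : ℝ → ℝ := fun r => ∫ x in halfBall d r, gdot u u x with hD
  have hDder : HasDerivAt D (r ^ d * hemi (gdot u u) r) r :=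
    hasDerivAt_setIntegral_halfBall hgc hgb hr hr1
  set η : ℝ → Space d → ℝ := fun t x => t ^ (-l) * u (t • x) - u x with hη
  -- `K` vanishes at `t = 1` and is nonnegative for `t > 1` by Green's inequality with `η t`, as
  -- `2 ∇u · ∇η ≤ |∇(u + η)|² - |∇u|²`; the claim is `0 ≤ K' 1`
  set K : ℝ → ℝ := fun t => t ^ (2 - 2 * l) * ((t ^ (d + 1))⁻¹ * D (t * r)) - D r +
    2 * (∫ x in halfBall d r, f x * η t x) -
    2 * (r ^ d * (hemi (fun x => euler u x * η t x) r / r)) with hK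
  have hKder : HasDerivAt K (r * (r ^ d * hemi (gdot u u) r) - ((d : ℝ) - 1 + 2 * l) * D r +
      2 * (∫ x in halfBall d r, f x * homDefect l u x) -
      2 * (r ^ d * (hemi (fun x => euler u x * homDefect l u x) r / r))) 1 := by
    have h1 : HasDerivAt (fun t : ℝ => t ^ (2 - 2 * l)) (2 - 2 * l) 1 := by
      simpa using Real.hasDerivAt_rpow_const (x := 1) (p := 2 - 2 * l) (Or.inl one_ne_zero)
    have h2 : HasDerivAt (fun t : ℝ => (t ^ (d + 1))⁻¹) (-((d : ℝ) + 1)) 1 := by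
      have := (hasDerivAt_pow (d + 1) (1 : ℝ)).inv (by simp)
      refine HasDerivAt.congr_deriv (f := fun t : ℝ => (t ^ (d + 1))⁻¹) this ?_
      simp
    have h3 : HasDerivAt (fun t : ℝ => D (t * r)) (r ^ d * hemi (gdot u u) r * r) 1 := by
      have h4 : HasDerivAt (fun t : ℝ => t * r) r 1 := by
        simpa using (hasDerivAt_id (1 : ℝ)).mul_const r
      have h5 : HasDerivAt D (r ^ d * hemi (gdot u u) r) (1 * r) := by rwa [one_mul]
      exact h5.comp (1 : ℝ) h4
    have h4 : HasDerivAt (fun t : ℝ => ∫ x in halfBall d r, f x * η t x)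
        (∫ x in halfBall d r, f x * homDefect l u x) 1 :=
      hasDerivAt_integral_rescale (measurableSet_halfBall r) (P := id) continuous_id hr hr1
        (fun x hx => hx) h.measurable.aestronglyMeasurable
        (fun x hx => h.abs_rhs_le x (halfBall_mono hr1.le hx)) h.contDiffOn h.abs_le h.fderiv_le l
    have h5 : HasDerivAt (fun t : ℝ => hemi (fun x => euler u x * η t x) r)
        (hemi (fun x => euler u x * homDefect l u x) r) 1 := by
      have : IsFiniteMeasure ((volume : Measure (Space d)).toSphere.restrict
          {y : sphere (0 : Space d) 1 | 0 < lastCoord (y : Space d)}) := inferInstance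
      refine hasDerivAt_integral_rescale (ρ := (1 + r) / 2) (A := M) measurableSet_hemisphere
        (P := fun y : sphere (0 : Space d) 1 => r • (y : Space d)) (by fun_prop)
        (by linarith) (by linarith)
        (fun y hy => smul_mem_halfBall hr (by linarith) hy)
        (aestronglyMeasurable_comp_smul hr hr1 (continuousOn_euler hop1 h.contDiffOn)) ?_
        h.contDiffOn h.abs_le h.fderiv_le l
      intro y hy
      have := smul_mem_halfBall hr hr1 hy
      exact abs_euler_le (h.fderiv_le _ this) this.1.le
    have h6 := (((h1.mul (h2.mul h3)).sub_const (D r)).add (h4.const_mul 2)).sub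
      (((h5.div_const r).const_mul (r ^ d)).const_mul 2)
    refine h6.congr_deriv ?_
    simp only [Real.one_rpow, one_pow, inv_one, one_mul, Pi.mul_apply]
    ring
  have hK0 : K 1 = 0 := by
    simp [hK, hη, hemi]
  have hpos : ∀ᶠ t in 𝓝[>] (1 : ℝ), 0 ≤ K t := by
    have h1r : (1 : ℝ) < 1 / r := by rwa [lt_div_iff₀ hr, one_mul]
    filter_upwards [Ioo_mem_nhdsGT h1r] with t ht
    have ht0 : 0 < t := zero_lt_one.trans ht.1
    have htr : t * r < 1 := by
      have := ht.2
      rwa [lt_div_iff₀ hr] at this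
    -- the rescaling is defined on a half ball slightly larger than that of radius `r`
    obtain ⟨R, hrR, hRt⟩ : ∃ R, r < R ∧ R < 1 / t := exists_between (by
      rwa [lt_div_iff₀ ht0, mul_comm])
    have htR : t * R < 1 := by
      rwa [lt_div_iff₀ ht0, mul_comm] at hRt
    have hR1 : R < 1 := by nlinarith [ht.1]
    have hsub : halfBall d R ⊆ halfBall d 1 := halfBall_mono hR1.le
    have hmem : ∀ x ∈ halfBall d R, t • x ∈ halfBall d 1 := by
      intro x hx
      have : t • x ∈ t • halfBall d R := smul_mem_smul_set hx
      rw [halfBall_smul ht0] at this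
      exact halfBall_mono htR.le this
    set c : ℝ := t ^ (-l) with hc
    have hc0 : 0 ≤ c := Real.rpow_nonneg ht0.le _
    have hdu : ∀ x ∈ halfBall d R, DifferentiableAt ℝ u x := fun x hx =>
      differentiableAt_of_halfBall h.contDiffOn (hsub hx)
    have hdw : ∀ x ∈ halfBall d R, HasFDerivAt (fun y => c * u (t • y))
        (c • (t • fderiv ℝ u (t • x))) x := fun x hx =>
      hasFDerivAt_rescale (differentiableAt_of_halfBall h.contDiffOn (hmem x hx))
    have hηd : ContDiffOn ℝ 1 (η t) (halfBall d R) := by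
      refine ContDiffOn.sub (contDiffOn_const.mul ?_) (h.contDiffOn.mono hsub)
      exact h.contDiffOn.comp (contDiff_const_smul t).contDiffOn hmem
    have hη' : ∀ x ∈ halfBall d R,
        HasFDerivAt (η t) (c • (t • fderiv ℝ u (t • x)) - fderiv ℝ u x) x := fun x hx =>
      (hdw x hx).sub (hdu x hx).hasFDerivAt
    have hN : ∀ x ∈ halfBall d R, |η t x| ≤ (c * M + M) + (c * (t * M) + M) := by
      intro x hx
      have hM : 0 ≤ M := (abs_nonneg _).trans (h.abs_le x (hsub hx))
      have h1 : |η t x| ≤ c * M + M := by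
        refine (abs_sub _ _).trans (add_le_add ?_ (h.abs_le x (hsub hx)))
        rw [abs_mul, abs_of_nonneg hc0]
        exact mul_le_mul_of_nonneg_left (h.abs_le _ (hmem x hx)) hc0
      have : 0 ≤ c * (t * M) + M := by positivity
      linarith
    have hN' : ∀ x ∈ halfBall d R, ‖fderiv ℝ (η t) x‖ ≤ (c * M + M) + (c * (t * M) + M) := by
      intro x hx
      have hM : 0 ≤ M := (abs_nonneg _).trans (h.abs_le x (hsub hx))
      rw [(hη' x hx).fderiv]
      have h1 : ‖c • (t • fderiv ℝ u (t • x)) - fderiv ℝ u x‖ ≤ c * (t * M) + M := by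
        refine (norm_sub_le _ _).trans (add_le_add ?_ (h.fderiv_le x (hsub hx)))
        rw [norm_smul, norm_smul, Real.norm_eq_abs, Real.norm_eq_abs, abs_of_nonneg hc0,
          abs_of_pos ht0]
        gcongr
        exact h.fderiv_le _ (hmem x hx)
      have : 0 ≤ c * M + M := by positivity
      linarith
    have hthin := h.thin R hR1 (fun x => c * u (t • x)) (by
        refine continuousOn_const.mul (h.continuousOn.comp (by fun_prop) ?_)
        intro x hx
        refine ⟨?_, ?_⟩
        · rw [norm_smul, Real.norm_eq_abs, abs_of_pos ht0]
          exact (mul_le_mul_of_nonneg_left hx.1 ht0.le).trans_lt htR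
        · rw [lastCoord_smul]
          exact mul_nonneg ht0.le hx.2) (by
        intro x hx hx0
        refine mul_nonneg hc0 (h.nonneg _ ⟨?_, ?_⟩)
        · rw [norm_smul, Real.norm_eq_abs, abs_of_pos ht0]
          exact (mul_le_mul_of_nonneg_left hx ht0.le).trans_lt htR
        · rw [lastCoord_smul, hx0, mul_zero])
    have hgreen := h.green_le hR1.le hr hrR hηd hN hN' hthin
    have hsr : halfBall d r ⊆ halfBall d R := halfBall_mono hrR.le
    have hms := measurableSet_halfBall (d := d) r
    have hopr := isOpen_halfBall (d := d) r
    have i0 : IntegrableOn (gdot u u) (halfBall d r) :=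
      integrableOn_halfBall (hgc.mono (hsr.trans hsub)) fun x hx => hgb x (hsub (hsr hx))
    have i1 : IntegrableOn (gdot u (η t)) (halfBall d r) :=
      integrableOn_halfBall (continuousOn_gdot hopr (h.contDiffOn.mono (hsr.trans hsub))
        (hηd.mono hsr)) fun x hx => abs_gdot_le (h.fderiv_le x (hsub (hsr hx))) (hN' x (hsr hx))
    have i2 : IntegrableOn (fun x => f x * η t x) (halfBall d r) := by
      refine Integrable.of_bound (C := M * ((c * M + M) + (c * (t * M) + M)))
        (h.measurable.aestronglyMeasurable.mul
          ((hηd.mono hsr).continuousOn.aestronglyMeasurable hms)) ?_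
      filter_upwards [ae_restrict_mem hms] with x hx
      rw [norm_mul]
      have := h.abs_rhs_le x (hsub (hsr hx))
      exact mul_le_mul this (hN x (hsr hx)) (norm_nonneg _) ((abs_nonneg _).trans this)
    have i3 : IntegrableOn (fun x => (c * t) ^ 2 * gdot u u (t • x)) (halfBall d r) := by
      refine integrableOn_halfBall (C := (c * t) ^ 2 * ((d + 1) * (M * M)))
        (continuousOn_const.mul (hgc.comp (by fun_prop) fun x hx => hmem x (hsr hx))) ?_
      intro x hx
      rw [abs_mul, abs_of_nonneg (sq_nonneg _)]
      exact mul_le_mul_of_nonneg_left (hgb _ (hmem x (hsr hx))) (sq_nonneg _)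
    have hpt : ∀ x ∈ halfBall d r,
        2 * gdot u (η t) x ≤ (c * t) ^ 2 * gdot u u (t • x) - gdot u u x := by
      intro x hx
      have e : ∀ i, pd i (η t) x = c * t * pd i u (t • x) - pd i u x := by
        intro i
        unfold pd
        rw [(hη' x (hsr hx)).fderiv]
        simp
        ring
      simp only [gdot, e]
      rw [Finset.mul_sum, Finset.mul_sum, ← Finset.sum_sub_distrib]
      refine Finset.sum_le_sum fun i _ => ?_
      nlinarith [sq_nonneg (c * t * pd i u (t • x) - pd i u x)]
    have hint : 2 * ∫ x in halfBall d r, gdot u (η t) x ≤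
        (c * t) ^ 2 * ((t ^ (d + 1))⁻¹ * D (t * r)) - D r := by
      have e1 : ∫ x in halfBall d r, gdot u u (t • x) = (t ^ (d + 1))⁻¹ * D (t * r) := by
        rw [Measure.setIntegral_comp_smul_of_pos _ _ _ ht0, halfBall_smul ht0]
        simp [hD]
      rw [← integral_const_mul, ← e1, ← integral_const_mul, hD, ← integral_sub i3 i0]
      exact setIntegral_mono_on (i1.const_mul 2) (i3.sub i0) hms hpt
    have hct : (c * t) ^ 2 = t ^ (2 - 2 * l) := by
      rw [hc, mul_pow, ← Real.rpow_natCast (t ^ (-l)), ← Real.rpow_mul ht0.le,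
        ← Real.rpow_natCast t, ← Real.rpow_add ht0]
      congr 1
      push_cast
      ring
    rw [integral_add i1 i2] at hgreen
    rw [hct] at hint
    simp only [hK]
    linarith
  have := nonneg_of_hasDerivAt_of_eventually_nonneg hKder hK0 hpos
  linarith

/-! ### The Weiss functional -/

theorem volume_real_halfBall {r : ℝ} (hr : 0 < r) :
    (volume : Measure (Space d)).real (halfBall d r) =
      r ^ (d + 1) * (volume : Measure (Space d)).real (halfBall d 1) := by
  have h1 : halfBall d r = r • halfBall d 1 := by rw [halfBall_smul hr, mul_one]
  rw [h1, measureReal_def, Measure.addHaar_smul, ENNReal.toReal_mul, measureReal_def]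
  congr 1
  rw [ENNReal.toReal_ofReal (abs_nonneg _)]
  simp [abs_of_pos hr]

/-- A bound on the hemispheric integrals gives a bound on the half ball. -/
theorem abs_setIntegral_le_of_hemi {r B : ℝ} (hr : 0 < r) {F : Space d → ℝ}
    (hF : IntegrableOn F (halfBall d r)) (hB : ∀ ρ, 0 < ρ → ρ < r → |hemi F ρ| ≤ B) :
    |∫ x in halfBall d r, F x| ≤ B * r ^ (d + 1) := by
  rw [setIntegral_halfBall_eq hr.le hF, intervalIntegral.integral_of_le hr.le,
    integral_Ioc_eq_integral_Ioo, ← Real.norm_eq_abs]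
  have hv : (volume : Measure ℝ) (Ioo 0 r) < ⊤ := measure_Ioo_lt_top
  refine (norm_setIntegral_le_of_norm_le_const (C := r ^ d * B) hv fun ρ hρ => ?_).trans
    (le_of_eq ?_)
  · rw [norm_mul, Real.norm_eq_abs, Real.norm_eq_abs, abs_of_nonneg (pow_nonneg hρ.1.le d)]
    exact mul_le_mul (pow_le_pow_left₀ hρ.1.le hρ.2.le d) (hB ρ hρ.1 hρ.2) (abs_nonneg _)
      (pow_nonneg hr.le d)
  · simp [hr.le, pow_succ]
    ring

theorem hemi_add {R ρ C C' : ℝ} (h0 : 0 < ρ) (hR : ρ < R) {F G : Space d → ℝ}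
    (hF : ContinuousOn F (halfBall d R)) (hC : ∀ x ∈ halfBall d R, |F x| ≤ C)
    (hG : ContinuousOn G (halfBall d R)) (hC' : ∀ x ∈ halfBall d R, |G x| ≤ C') :
    hemi (fun x => F x + G x) ρ = hemi F ρ + hemi G ρ :=
  integral_add (integrable_comp_smul h0 hR hF hC) (integrable_comp_smul h0 hR hG hC')

theorem hemi_const_mul (c : ℝ) (F : Space d → ℝ) (ρ : ℝ) :
    hemi (fun x => c * F x) ρ = c * hemi F ρ :=
  integral_const_mul _ _

theorem hemi_nonneg {F : Space d → ℝ} (hF : ∀ x, 0 ≤ F x) (ρ : ℝ) : 0 ≤ hemi F ρ :=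
  integral_nonneg fun _ => hF _

/-- The Cauchy-Schwarz inequality `(x · ∇u)² ≤ |x|² |∇u|²`. -/
theorem euler_sq_le (u : Space d → ℝ) (x : Space d) :
    euler u x ^ 2 ≤ ‖x‖ ^ 2 * gdot u u x := by
  rw [euler_eq_sum, EuclideanSpace.norm_sq_eq]
  refine (Finset.sum_mul_sq_le_sq_mul_sq _ _ _).trans (le_of_eq ?_)
  congr 1
  · simp
  · simp [gdot, sq]

theorem gdot_self_nonneg (u : Space d → ℝ) (x : Space d) : 0 ≤ gdot u u x :=
  Finset.sum_nonneg fun _ _ => mul_self_nonneg _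

theorem abs_mul_le_of {a b A B : ℝ} (ha : |a| ≤ A) (hb : |b| ≤ B) : |a * b| ≤ A * B := by
  rw [abs_mul]
  exact mul_le_mul ha hb (abs_nonneg _) ((abs_nonneg _).trans ha)

theorem abs_sq_le_of {a N : ℝ} (h : |a| ≤ N) : |a ^ 2| ≤ N ^ 2 := by
  rw [abs_pow]
  exact pow_le_pow_left₀ (abs_nonneg _) h 2

theorem rpow_mul_sq_pow_le_one {k : ℕ} {l r : ℝ} (hl : 1 ≤ l) (hlk : l + 1 ≤ k) (hr : 0 < r)
    (hr1 : r ≤ 1) : r ^ (-(2 * l)) * (r ^ (k - 1)) ^ 2 ≤ 1 := by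
  have h1k : 1 ≤ k := by
    have : (1 : ℝ) ≤ k := by linarith
    exact_mod_cast this
  rw [← pow_mul, ← Real.rpow_natCast r, ← Real.rpow_add hr]
  refine Real.rpow_le_one hr.le hr1 ?_
  push_cast [Nat.cast_sub h1k]
  linarith

theorem continuousOn_homDefect {w : Space d → ℝ} (hw : ContDiffOn ℝ 1 w (halfBall d 1)) (l : ℝ) :
    ContinuousOn (homDefect l w) (halfBall d 1) :=
  (continuousOn_euler (isOpen_halfBall 1) hw).sub (continuousOn_const.mul hw.continuousOn)

theorem abs_homDefect_le {w : Space d → ℝ} {N : ℝ} (l : ℝ) {x : Space d}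
    (hx : x ∈ halfBall d 1) (hN : |w x| ≤ N) (hN' : ‖fderiv ℝ w x‖ ≤ N) :
    |homDefect l w x| ≤ N + |l| * N := by
  refine (abs_sub _ _).trans (add_le_add (abs_euler_le hN' hx.1.le) ?_)
  rw [abs_mul]
  exact mul_le_mul_of_nonneg_left hN (abs_nonneg _)

/-- The derivative of the mean square on spheres, in terms of the defect of `l`-homogeneity. -/
theorem hasDerivAt_hemi_sq {w : Space d → ℝ} {N : ℝ} (hw : ContDiffOn ℝ 1 w (halfBall d 1))
    (hN : ∀ x ∈ halfBall d 1, |w x| ≤ N) (hN' : ∀ x ∈ halfBall d 1, ‖fderiv ℝ w x‖ ≤ N) (l : ℝ)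
    {r : ℝ} (hr : 0 < r) (hr1 : r < 1) :
    HasDerivAt (hemi fun x => w x ^ 2)
      (2 * (hemi (fun x => w x * homDefect l w x) r + l * hemi (fun x => w x ^ 2) r) / r) r := by
  have hfd : ∀ x ∈ halfBall d 1,
      HasFDerivAt (fun y => w y ^ 2) ((2 * w x) • fderiv ℝ w x) x := by
    intro x hx
    have := (differentiableAt_of_halfBall hw hx).hasFDerivAt.pow 2
    refine this.congr_fderiv ?_
    simp
  have hb : ∀ x ∈ halfBall d 1, |w x ^ 2| ≤ N ^ 2 := fun x hx =>
    abs_sq_le_of (hN x hx)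
  have key := hasDerivAt_hemi (F := fun x => w x ^ 2) (C := N ^ 2) (C' := 2 * N * N) (hw.pow 2) hb
    (fun x hx => by
      rw [(hfd x hx).fderiv, norm_smul]
      have h1 : ‖2 * w x‖ ≤ 2 * N := by
        rw [norm_mul, Real.norm_eq_abs, Real.norm_eq_abs, abs_two]
        exact mul_le_mul_of_nonneg_left (hN x hx) zero_le_two
      exact mul_le_mul h1 (hN' x hx) (norm_nonneg _) ((norm_nonneg _).trans h1)) hr hr1
  refine key.congr_deriv ?_
  congr 1
  rw [← hemi_const_mul l, ← hemi_add (F := fun x => w x * homDefect l w x)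
    (G := fun x => l * w x ^ 2) hr hr1
    (hw.continuousOn.mul (continuousOn_homDefect hw l))
    (fun x hx => abs_mul_le_of (hN x hx) (abs_homDefect_le l hx (hN x hx) (hN' x hx)))
    (continuousOn_const.mul (hw.continuousOn.pow 2))
    (fun x hx => abs_mul_le_of (le_refl |l|) (hb x hx)), ← hemi_const_mul]
  refine hemi_congr hr hr1 fun x hx => ?_
  rw [euler, (hfd x hx).fderiv]
  simp only [homDefect, euler, smul_apply, smul_eq_mul]
  ring

section Signorini

variable {k : ℕ} {u f : Space d → ℝ} {M : ℝ}

/-- The term containing the right hand side is estimated by `f w ≤ w² + f² / 4`. -/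
theorem IsSignorini.abs_integral_rhs_mul_le (h : IsSignorini k u f M) {r N : ℝ} (hr : 0 < r)
    (hr1 : r < 1) {w : Space d → ℝ} (hw : ContinuousOn w (halfBall d 1))
    (hN : ∀ x ∈ halfBall d 1, |w x| ≤ N) :
    |∫ x in halfBall d r, f x * w x| ≤ (∫ x in halfBall d r, w x ^ 2) +
      M ^ 2 * (volume : Measure (Space d)).real (halfBall d 1) / 4 *
        (r ^ (d + 1) * (r ^ (k - 1)) ^ 2) := by
  have hsub : halfBall d r ⊆ halfBall d 1 := halfBall_mono hr1.le
  have hms := measurableSet_halfBall (d := d) r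
  have i1 : IntegrableOn (fun x => w x ^ 2) (halfBall d r) :=
    integrableOn_halfBall (C := N ^ 2) ((hw.mono hsub).pow 2) fun x hx =>
      abs_sq_le_of (hN x (hsub hx))
  have i2 : IntegrableOn (fun _ : Space d => M ^ 2 / 4 * (r ^ (k - 1)) ^ 2) (halfBall d r) :=
    integrable_const _
  have e : M ^ 2 * (volume : Measure (Space d)).real (halfBall d 1) / 4 *
      (r ^ (d + 1) * (r ^ (k - 1)) ^ 2) =
      ∫ _ in halfBall d r, M ^ 2 / 4 * (r ^ (k - 1)) ^ 2 := by
    rw [setIntegral_const, volume_real_halfBall hr, smul_eq_mul]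
    ring
  rw [e, ← integral_add i1 i2, ← Real.norm_eq_abs]
  refine norm_integral_le_of_norm_le (i1.add i2) ?_
  filter_upwards [ae_restrict_mem hms] with x hx
  have h1 : |f x| ≤ M * r ^ (k - 1) := by
    refine (h.abs_rhs_le_pow x (hsub hx)).trans ?_
    have hM : 0 ≤ M := (abs_nonneg _).trans (h.abs_le x (hsub hx))
    exact mul_le_mul_of_nonneg_left (pow_le_pow_left₀ (norm_nonneg _) hx.1.le _) hM
  rw [norm_mul, Real.norm_eq_abs, Real.norm_eq_abs]
  have h2 : |f x| * |w x| ≤ M * r ^ (k - 1) * |w x| :=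
    mul_le_mul_of_nonneg_right h1 (abs_nonneg _)
  nlinarith [sq_nonneg (|w x| - M * r ^ (k - 1) / 2), sq_abs (w x)]

/-- The sign of the derivative of the corrected Weiss functional. Here `a = r ^ (-2 l)`,
`P = r ^ d`, and `D`, `Z`, `A`, `G`, `U`, `Φ` are the integrals entering the functional. -/
theorem weiss_deriv_aux {a P r e D Z A G U Φ l n c C q : ℝ} (ha : 0 < a) (hP : 0 < P) (hr : 0 < r)
    (hr1 : r < 1) (hc1 : c ≤ 1) (hC : 0 ≤ C) (hG : 0 ≤ G) (hnc : n * c = 2)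
    (hak : a * q ≤ 1) (hΦ : Φ ≤ Z + C * (P * r * q))
    (hE : 2 * (P * ((G + l * U) / r)) - 2 * Φ ≤ r * (P * e) - n * D) :
    0 ≤ -n * (a * (r / P) / r) * (D - c * Z) + a * (r / P) * (P * e - c * (P * G)) -
        l * (-(2 * l) * (a / r) * A + a * (2 * (U + l * A) / r)) + C * (2 * r) := by
  have hΦ3 : a / P * (2 * Φ) ≤ a / P * (2 * Z) + 2 * C * r := by
    have h1 : a / P * (2 * Φ) ≤ a / P * (2 * (Z + C * (P * r * q))) :=
      mul_le_mul_of_nonneg_left (by linarith) (by positivity)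
    have h2 : a / P * (2 * (Z + C * (P * r * q))) = a / P * (2 * Z) + 2 * C * r * (a * q) := by
      field_simp
    have h3 : 2 * C * r * (a * q) ≤ 2 * C * r * 1 :=
      mul_le_mul_of_nonneg_left hak (by positivity)
    linarith
  have hE2 := mul_le_mul_of_nonneg_left hE (div_pos ha hP).le
  have e1 : -n * (a * (r / P) / r) * (D - c * Z) + a * (r / P) * (P * e - c * (P * G)) -
      l * (-(2 * l) * (a / r) * A + a * (2 * (U + l * A) / r)) + C * (2 * r) =
      a / P * (r * (P * e) - n * D) + a / P * ((n * c) * Z)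
        - c * (a * r * G) - a / P * (2 * (P * (l * U / r))) + 2 * C * r := by
    field_simp
    ring
  have e2 : a / P * (2 * (P * ((G + l * U) / r)) - 2 * Φ) =
      2 * (a * G / r) + a / P * (2 * (P * (l * U / r))) - a / P * (2 * Φ) := by
    field_simp
  rw [e1, hnc]
  have h4 : c * (a * r * G) ≤ 2 * (a * G / r) := by
    have h5 : a * r * G ≤ a * G / r := by
      rw [le_div_iff₀ hr]
      have : a * r * G * r = a * G * (r * r) := by ring
      rw [this]
      exact mul_le_of_le_one_right (by positivity) (by nlinarith)
    have h6 : 0 ≤ a * r * G := by positivity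
    nlinarith
  linarith

/-- The Weiss functional is almost nonnegative for every exponent `l` for which the mean square
of `u` on spheres is `o(r ^ (2 l))`. -/
theorem IsSignorini.weiss_ge (h : IsSignorini k u f M) (hd : 1 ≤ d) {l : ℝ} (hl : 1 ≤ l)
    (hlk : l + 1 ≤ k)
    (hdecay : Tendsto (fun r : ℝ => r ^ (-(2 * l)) * hemi (fun x => u x ^ 2) r) (𝓝[>] 0) (𝓝 0))
    {r : ℝ} (hr : 0 < r) (hr1 : r < 1) :
    -(M ^ 2 * (volume : Measure (Space d)).real (halfBall d 1) / 4 * r ^ 2) ≤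
      r ^ (-(2 * l)) * (r / r ^ d * (∫ x in halfBall d r, gdot u u x) -
        l * hemi (fun x => u x ^ 2) r) := by
  have hop := isOpen_halfBall (d := d) 1
  set A : ℝ → ℝ := hemi fun x => u x ^ 2 with hA
  set D : ℝ → ℝ := fun r => ∫ x in halfBall d r, gdot u u x with hD
  set Z : ℝ → ℝ := fun r => ∫ x in halfBall d r, homDefect l u x ^ 2 with hZ
  set C : ℝ := M ^ 2 * (volume : Measure (Space d)).real (halfBall d 1) / 4 with hC
  have hC0 : 0 ≤ C := by
    have : 0 ≤ (volume : Measure (Space d)).real (halfBall d 1) := measureReal_nonneg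
    positivity
  have hd1 : (1 : ℝ) ≤ d := by exact_mod_cast hd
  set n : ℝ := (d : ℝ) - 1 + 2 * l with hn
  have hn2 : 2 ≤ n := by linarith
  set c : ℝ := 2 / n with hc
  have hc0 : 0 < c := by positivity
  have hc1 : c ≤ 1 := by rw [hc, div_le_one (by linarith)]; exact hn2
  have hzc := continuousOn_homDefect h.contDiffOn l
  have hzb : ∀ x ∈ halfBall d 1, |homDefect l u x| ≤ M + |l| * M := fun x hx =>
    abs_homDefect_le l hx (h.abs_le x hx) (h.fderiv_le x hx)
  have hgc : ContinuousOn (gdot u u) (halfBall d 1) :=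
    continuousOn_gdot hop h.contDiffOn h.contDiffOn
  have hgb : ∀ x ∈ halfBall d 1, |gdot u u x| ≤ (d + 1) * (M * M) := fun x hx =>
    abs_gdot_le (h.fderiv_le x hx) (h.fderiv_le x hx)
  have hz2b : ∀ x ∈ halfBall d 1, |homDefect l u x ^ 2| ≤ (M + |l| * M) ^ 2 := fun x hx =>
    abs_sq_le_of (hzb x hx)
  have hu2b : ∀ x ∈ halfBall d 1, |u x ^ 2| ≤ M ^ 2 := fun x hx =>
    abs_sq_le_of (h.abs_le x hx)
  have hA0 : ∀ r, 0 ≤ A r := hemi_nonneg fun x => sq_nonneg _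
  have hD0 : ∀ r, 0 ≤ D r := fun r => integral_nonneg fun x => gdot_self_nonneg u x
  have hZ0 : ∀ r, 0 ≤ Z r := fun r => integral_nonneg fun x => sq_nonneg _
  -- the corrected Weiss functional: `c Z` absorbs the integral of `f (x · ∇u - l u)` in the energy
  -- inequality, and `c ≤ 1` keeps the derivative of the correction below the square term
  set V : ℝ → ℝ := fun r => r ^ (-n) * (D r - c * Z r) - l * (r ^ (-(2 * l)) * A r) + C * r ^ 2
    with hV
  -- factorization of the powers of `r`
  have hpow : ∀ r : ℝ, 0 < r → r ^ (-n) = r ^ (-(2 * l)) * (r / r ^ d) := by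
    intro r hr
    have : -n = -(2 * l) + 1 - (d : ℝ) := by rw [hn]; ring
    rw [this, Real.rpow_sub hr, Real.rpow_add hr, Real.rpow_one, Real.rpow_natCast, mul_div_assoc]
  have hVder : ∀ r, 0 < r → r < 1 → ∃ V', HasDerivAt V V' r ∧ 0 ≤ V' := by
    intro r hr hr1
    have dD : HasDerivAt D (r ^ d * hemi (gdot u u) r) r :=
      hasDerivAt_setIntegral_halfBall hgc hgb hr hr1
    have dZ : HasDerivAt Z (r ^ d * hemi (fun x => homDefect l u x ^ 2) r) r :=
      hasDerivAt_setIntegral_halfBall (hzc.pow 2) hz2b hr hr1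
    have dA := hasDerivAt_hemi_sq h.contDiffOn h.abs_le h.fderiv_le l hr hr1
    have dn : HasDerivAt (fun r : ℝ => r ^ (-n)) (-n * r ^ (-n - 1)) r :=
      Real.hasDerivAt_rpow_const (Or.inl hr.ne')
    have dl : HasDerivAt (fun r : ℝ => r ^ (-(2 * l))) (-(2 * l) * r ^ (-(2 * l) - 1)) r :=
      Real.hasDerivAt_rpow_const (Or.inl hr.ne')
    have d2 : HasDerivAt (fun r : ℝ => r ^ 2) (2 * r) r := by simpa using hasDerivAt_pow 2 r
    have dV := ((dn.mul (dD.sub (dZ.const_mul c))).sub ((dl.mul dA).const_mul l)).add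
      (d2.const_mul C)
    refine ⟨_, dV, ?_⟩
    have hE := h.energy_deriv_ge hr hr1 l
    have hΦ := h.abs_integral_rhs_mul_le hr hr1 hzc hzb
    set G := hemi (fun x => homDefect l u x ^ 2) r with hG
    set U := hemi (fun x => u x * homDefect l u x) r with hU
    have hGU : hemi (fun x => euler u x * homDefect l u x) r = G + l * U := by
      rw [hU, hG, ← hemi_const_mul l, ← hemi_add (F := fun x => homDefect l u x ^ 2)
        (G := fun x => l * (u x * homDefect l u x)) hr hr1 (hzc.pow 2) hz2b
        (continuousOn_const.mul (h.contDiffOn.continuousOn.mul hzc))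
        (fun x hx => abs_mul_le_of (le_refl |l|) (abs_mul_le_of (h.abs_le x hx) (hzb x hx)))]
      refine hemi_congr hr hr1 fun x hx => ?_
      simp only [homDefect]
      ring
    rw [hGU] at hE
    have hG0 : 0 ≤ G := hemi_nonneg (fun x => sq_nonneg _) r
    have hnc : n * c = 2 := by rw [hc]; field_simp
    have hak := rpow_mul_sq_pow_le_one hl hlk hr hr1.le
    have hΦ2 := (abs_le.1 hΦ).2
    rw [pow_succ r d] at hΦ2
    simp only [Pi.sub_apply]
    rw [Real.rpow_sub_one hr.ne', Real.rpow_sub_one hr.ne', hpow r hr]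
    exact weiss_deriv_aux (Real.rpow_pos_of_pos hr _) (pow_pos hr d) hr hr1 hc1 hC0 hG0 hnc
      hak hΦ2 hE
  have hVmono : MonotoneOn V (Ioo 0 1) := by
    refine monotoneOn_of_deriv_nonneg (convex_Ioo 0 1) ?_ ?_ ?_
    · intro x hx
      obtain ⟨_, h1, _⟩ := hVder x hx.1 hx.2
      exact h1.continuousAt.continuousWithinAt
    · intro x hx
      rw [interior_Ioo] at hx
      obtain ⟨_, h1, _⟩ := hVder x hx.1 hx.2
      exact h1.differentiableAt.differentiableWithinAt
    · intro x hx
      rw [interior_Ioo] at hx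
      obtain ⟨_, h1, h2⟩ := hVder x hx.1 hx.2
      rwa [h1.deriv]
  -- the decay of the mean square forces a nonnegative limit of `V` at zero
  have hV0 : 0 ≤ V r := by
    have hbound : ∀ ε > 0, -((l + 2 * l ^ 2) * ε) ≤ V r := by
      intro ε hε
      have h1 : ∀ᶠ s in 𝓝[>] (0 : ℝ), s ^ (-(2 * l)) * A s < ε :=
        hdecay.eventually (gt_mem_nhds hε)
      obtain ⟨s₀, hs₀, hs₀'⟩ := mem_nhdsGT_iff_exists_Ioo_subset.1 h1
      have hs₀p : (0 : ℝ) < s₀ := hs₀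
      obtain ⟨s, hs, hs'⟩ : ∃ s, 0 < s ∧ s < min s₀ (min r (1 / 2)) :=
        exists_between (lt_min hs₀p (lt_min hr (by norm_num)))
      have hss₀ : s < s₀ := hs'.trans_le (min_le_left _ _)
      have hsr : s < r := hs'.trans_le ((min_le_right _ _).trans (min_le_left _ _))
      have hs2 : s < 1 / 2 := hs'.trans_le ((min_le_right _ _).trans (min_le_right _ _))
      have hs1 : s < 1 := by linarith
      refine le_trans ?_ (hVmono ⟨hs, hs1⟩ ⟨hr, hr1⟩ hsr.le)
      have hAρ : ∀ ρ, 0 < ρ → ρ ≤ s → A ρ ≤ ε * s ^ (2 * l) := by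
        intro ρ h0 hρs
        have h2 : ρ ^ (-(2 * l)) * A ρ < ε := hs₀' ⟨h0, hρs.trans_lt hss₀⟩
        rw [Real.rpow_neg h0.le, inv_mul_lt_iff₀ (Real.rpow_pos_of_pos h0 _)] at h2
        have h3 : ρ ^ (2 * l) ≤ s ^ (2 * l) := Real.rpow_le_rpow h0.le hρs (by linarith)
        nlinarith
      have hsub : halfBall d s ⊆ halfBall d 1 := halfBall_mono hs1.le
      have iu : IntegrableOn (fun x => u x ^ 2) (halfBall d s) :=
        integrableOn_halfBall ((h.contDiffOn.continuousOn.mono hsub).pow 2)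
          fun x hx => hu2b x (hsub hx)
      have hX : ∫ x in halfBall d s, u x ^ 2 ≤ ε * s ^ (2 * l) * s ^ (d + 1) := by
        refine (le_abs_self _).trans (abs_setIntegral_le_of_hemi hs iu fun ρ h0 hρs => ?_)
        rw [abs_of_nonneg (hA0 ρ)]
        exact hAρ ρ h0 hρs.le
      have ig : IntegrableOn (gdot u u) (halfBall d s) :=
        integrableOn_halfBall (hgc.mono hsub) fun x hx => hgb x (hsub hx)
      have iz : IntegrableOn (fun x => homDefect l u x ^ 2) (halfBall d s) :=
        integrableOn_halfBall ((hzc.mono hsub).pow 2) fun x hx => hz2b x (hsub hx)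
      have hZs : Z s ≤ 2 * s ^ 2 * D s + 2 * l ^ 2 * ∫ x in halfBall d s, u x ^ 2 := by
        simp only [hZ, hD]
        rw [← integral_const_mul, ← integral_const_mul,
          ← integral_add (ig.const_mul _) (iu.const_mul _)]
        refine setIntegral_mono_on iz ((ig.const_mul _).add (iu.const_mul _))
          (measurableSet_halfBall s) fun x hx => ?_
        have h2 := euler_sq_le u x
        have h3 : ‖x‖ ^ 2 * gdot u u x ≤ s ^ 2 * gdot u u x :=
          mul_le_mul_of_nonneg_right (pow_le_pow_left₀ (norm_nonneg _) hx.1.le 2)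
            (gdot_self_nonneg u x)
        unfold homDefect
        nlinarith [sq_nonneg (euler u x + l * u x)]
      have hs2' : 2 * s ^ 2 ≤ 1 := by nlinarith
      have hDZ : -(2 * l ^ 2 * (ε * s ^ (2 * l) * s ^ (d + 1))) ≤ D s - c * Z s := by
        have h2 : c * Z s ≤ Z s := mul_le_of_le_one_left (hZ0 s) hc1
        have h3 : 2 * s ^ 2 * D s ≤ D s := mul_le_of_le_one_left (hD0 s) hs2'
        have h4 : 2 * l ^ 2 * ∫ x in halfBall d s, u x ^ 2 ≤
            2 * l ^ 2 * (ε * s ^ (2 * l) * s ^ (d + 1)) :=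
          mul_le_mul_of_nonneg_left hX (by positivity)
        linarith
      have hsn : 0 ≤ s ^ (-n) := Real.rpow_nonneg hs.le _
      have h5 := mul_le_mul_of_nonneg_left hDZ hsn
      have h6 : s ^ (-n) * -(2 * l ^ 2 * (ε * s ^ (2 * l) * s ^ (d + 1))) =
          -(2 * l ^ 2 * ε * s ^ 2) := by
        rw [hpow s hs, Real.rpow_neg hs.le, pow_succ]
        have : 0 < s ^ (2 * l) := Real.rpow_pos_of_pos hs _
        field_simp
        ring
      have h7 : s ^ (-(2 * l)) * A s ≤ ε := (hs₀' ⟨hs, hss₀⟩ : _ < ε).le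
      have h8 : l * (s ^ (-(2 * l)) * A s) ≤ l * ε := mul_le_mul_of_nonneg_left h7 (by linarith)
      have h9 : 2 * l ^ 2 * ε * s ^ 2 ≤ 2 * l ^ 2 * ε :=
        mul_le_of_le_one_right (by positivity) (by nlinarith)
      have h10 : 0 ≤ C * s ^ 2 := by positivity
      simp only [hV]
      rw [h6] at h5
      linarith
    have hfin : Tendsto (fun ε : ℝ => -((l + 2 * l ^ 2) * ε)) (𝓝[>] 0) (𝓝 0) := by
      have : Continuous fun ε : ℝ => -((l + 2 * l ^ 2) * ε) := by fun_prop
      have := this.tendsto 0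
      simp only [mul_zero, neg_zero] at this
      exact this.mono_left nhdsWithin_le_nhds
    refine le_of_tendsto hfin ?_
    filter_upwards [self_mem_nhdsWithin] with ε hε using hbound ε hε
  simp only [hV] at hV0
  rw [hpow r hr] at hV0
  have h1 : 0 ≤ r ^ (-(2 * l)) * (r / r ^ d) * (c * Z r) := by
    have := hZ0 r
    positivity
  have e : r ^ (-(2 * l)) * (r / r ^ d * D r - l * A r) =
      r ^ (-(2 * l)) * (r / r ^ d) * (D r - c * Z r) - l * (r ^ (-(2 * l)) * A r) +
        r ^ (-(2 * l)) * (r / r ^ d) * (c * Z r) := by ring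
  rw [e]
  linarith

end Signorini

/-! ### Green's identity for a harmonic competitor -/

/-- The projection of a point onto the thin space. -/
def thinProj (x : Space d) : Space d := x - lastCoord x • lastVec d

theorem lastCoord_thinProj (x : Space d) : lastCoord (thinProj x) = 0 := by
  simp [thinProj, lastCoord, lastVec]

theorem norm_lastVec : ‖lastVec d‖ = 1 := by simp [lastVec]

theorem dist_thinProj (x : Space d) : dist x (thinProj x) = |lastCoord x| := by
  rw [dist_eq_norm, thinProj, sub_sub_cancel, norm_smul, norm_lastVec, mul_one, Real.norm_eq_abs]

theorem norm_thinProj_le (x : Space d) : ‖thinProj x‖ ≤ ‖x‖ := by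
  rw [EuclideanSpace.norm_eq, EuclideanSpace.norm_eq]
  refine Real.sqrt_le_sqrt (Finset.sum_le_sum fun i _ => ?_)
  by_cases hi : i = Fin.last d
  · subst hi
    have : (thinProj x) (Fin.last d) = 0 := lastCoord_thinProj x
    rw [this]
    simpa using sq_nonneg (x (Fin.last d))
  · have : (thinProj x) i = x i := by
      simp [thinProj, lastVec, hi]
    rw [this]

/-- A continuous function that is nonpositive on the thin space is almost nonpositive near it. -/
theorem le_of_thin_nonpos {R : ℝ} {G : Space d → ℝ}
    (hG : ContinuousOn G {x | ‖x‖ ≤ R ∧ 0 ≤ lastCoord x})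
    (h0 : ∀ x, ‖x‖ ≤ R → lastCoord x = 0 → G x ≤ 0) {ε : ℝ} (hε : 0 < ε) :
    ∃ δ > 0, ∀ x ∈ halfBall d R, lastCoord x < δ → G x ≤ ε := by
  have hK : IsCompact {x : Space d | ‖x‖ ≤ R ∧ 0 ≤ lastCoord x} := by
    have : {x : Space d | ‖x‖ ≤ R ∧ 0 ≤ lastCoord x} =
        closedBall 0 R ∩ {x | 0 ≤ lastCoord x} := by
      ext x; simp
    rw [this]
    exact (isCompact_closedBall 0 R).inter_right (isClosed_le continuous_const continuous_lastCoord)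
  have huc := hK.uniformContinuousOn_of_continuous hG
  rw [Metric.uniformContinuousOn_iff] at huc
  obtain ⟨δ, hδ, h⟩ := huc ε hε
  refine ⟨δ, hδ, fun x hx hxδ => ?_⟩
  have h1 := h x ⟨hx.1.le, hx.2.le⟩ (thinProj x)
    ⟨(norm_thinProj_le x).trans hx.1.le, (lastCoord_thinProj x).ge⟩
    (by rw [dist_thinProj, abs_of_pos hx.2]; exact hxδ)
  have h2 := h0 (thinProj x) ((norm_thinProj_le x).trans hx.1.le) (lastCoord_thinProj x)
  rw [Real.dist_eq] at h1
  have := (abs_lt.1 h1).2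
  linarith

theorem exists_bound_halfBall {q : Space d → ℝ} (hq : ContDiff ℝ 1 q) :
    ∃ N, (∀ x ∈ halfBall d 1, |q x| ≤ N) ∧ ∀ x ∈ halfBall d 1, ‖fderiv ℝ q x‖ ≤ N := by
  obtain ⟨N₁, h1⟩ := (isCompact_closedBall (0 : Space d) 1).exists_bound_of_continuousOn
    hq.continuous.continuousOn
  obtain ⟨N₂, h2⟩ := (isCompact_closedBall (0 : Space d) 1).exists_bound_of_continuousOn
    (hq.continuous_fderiv one_ne_zero).continuousOn
  refine ⟨max N₁ N₂, fun x hx => ?_, fun x hx => ?_⟩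
  · exact (h1 x (ball_subset_closedBall (halfBall_subset_ball 1 hx))).trans (le_max_left _ _)
  · exact (h2 x (ball_subset_closedBall (halfBall_subset_ball 1 hx))).trans (le_max_right _ _)

/-- A harmonic function is a weak solution with vanishing right hand side. -/
theorem isWeakSolution_of_harmonic {q : Space d → ℝ} (hq : ContDiff ℝ 2 q)
    (hΔ : ∀ x, ∑ i, pd i (pd i q) x = 0) {N : ℝ} (hN : ∀ x ∈ halfBall d 1, |q x| ≤ N)
    (hN' : ∀ x ∈ halfBall d 1, ‖fderiv ℝ q x‖ ≤ N) : IsWeakSolution q (fun _ => 0) N 0 := by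
  refine ⟨(hq.of_le one_le_two).contDiffOn, hN, hN', measurable_const, fun x _ => by simp, ?_⟩
  intro ζ hζ hc hs
  have hpi : ∀ i, ContDiff ℝ 1 (pd i q) := fun i =>
    (hq.fderiv_right (m := 1) (by norm_num)).clm_apply contDiff_const
  have ibp := fun i => setIntegral_mul_pd (isOpen_halfBall 1) (hpi i).contDiffOn hζ hc hs i
  simp only [zero_mul, add_zero, gdot]
  rw [integral_finsetSum _ fun i _ => (ibp i).1]
  have e : ∑ i, ∫ x in halfBall d 1, pd i q x * pd i ζ x =
      -∑ i, ∫ x in halfBall d 1, pd i (pd i q) x * ζ x := by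
    rw [← Finset.sum_neg_distrib]
    exact Finset.sum_congr rfl fun i _ => (ibp i).2.2
  rw [e, ← integral_finsetSum _ fun i _ => (ibp i).2.1]
  simp [← Finset.sum_mul, hΔ]

/-- Green's identity between a bounded `C¹` function and a harmonic function that is homogeneous of
degree `l` and whose normal derivative vanishes on the thin space. -/
theorem integral_gdot_harmonic {q w : Space d → ℝ} {l M : ℝ} (hq : ContDiff ℝ 2 q)
    (hΔ : ∀ x, ∑ i, pd i (pd i q) x = 0) (hhom : ∀ x, euler q x = l * q x)
    (hn : ∀ x, lastCoord x = 0 → pd (Fin.last d) q x = 0)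
    (hw : ContDiffOn ℝ 1 w (halfBall d 1)) (hM : ∀ x ∈ halfBall d 1, |w x| ≤ M)
    (hM' : ∀ x ∈ halfBall d 1, ‖fderiv ℝ w x‖ ≤ M) {r : ℝ} (hr : 0 < r) (hr1 : r < 1) :
    ∫ x in halfBall d r, gdot w q x = l * (r ^ d * (hemi (fun x => w x * q x) r / r)) := by
  obtain ⟨N, hN, hN'⟩ := exists_bound_halfBall (hq.of_le one_le_two)
  have hqs := isWeakSolution_of_harmonic hq hΔ hN hN'
  have hpn : Continuous (pd (Fin.last d) q) :=
    ((hq.of_le one_le_two).continuous_fderiv one_ne_zero).clm_apply continuous_const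
  have thin : ∀ ε > 0, ∃ δ > 0, ∀ x ∈ halfBall d 1, lastCoord x < δ →
      |pd (Fin.last d) q x| * |w x| ≤ ε := by
    intro ε hε
    obtain ⟨δ, hδ, h⟩ := le_of_thin_nonpos (R := 1) (G := fun x => |pd (Fin.last d) q x|)
      hpn.abs.continuousOn (fun x _ hx => by simp [hn x hx]) (ε := ε / (|M| + 1)) (by positivity)
    refine ⟨δ, hδ, fun x hx hxδ => ?_⟩
    calc |pd (Fin.last d) q x| * |w x| ≤ ε / (|M| + 1) * (|M| + 1) := by
          refine mul_le_mul (h x hx hxδ) ?_ (abs_nonneg _) (by positivity)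
          linarith [hM x hx, le_abs_self M]
      _ = ε := by field_simp
  have h1 := hqs.green_le le_rfl hr hr1 hw hM hM' (fun ε hε => by
    obtain ⟨δ, hδ, h⟩ := thin ε hε
    refine ⟨δ, hδ, fun x hx hxδ => (le_abs_self _).trans ?_⟩
    rw [abs_mul]
    exact h x hx hxδ)
  have h2 := hqs.green_le le_rfl hr hr1 (η := fun x => -w x) hw.neg
    (fun x hx => by rw [abs_neg]; exact hM x hx)
    (fun x hx => by rw [fderiv_fun_neg, norm_neg]; exact hM' x hx) (fun ε hε => by
    obtain ⟨δ, hδ, h⟩ := thin ε hε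
    refine ⟨δ, hδ, fun x hx hxδ => (le_abs_self _).trans ?_⟩
    rw [abs_mul, abs_neg]
    exact h x hx hxδ)
  have e1 : hemi (fun x => euler q x * w x) r = l * hemi (fun x => w x * q x) r := by
    rw [← hemi_const_mul]
    congr 1
    ext x
    rw [hhom]
    ring
  have e2 : hemi (fun x => euler q x * -w x) r = -(l * hemi (fun x => w x * q x) r) := by
    rw [← hemi_const_mul, ← neg_one_mul, ← hemi_const_mul]
    congr 1
    ext x
    rw [hhom]
    ring
  have e3 : ∀ x, gdot q (fun x => -w x) x = -gdot w q x := by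
    intro x
    simp only [gdot, pd, fderiv_fun_neg, ← Finset.sum_neg_distrib]
    refine Finset.sum_congr rfl fun i _ => ?_
    simp
    ring
  have e4 : ∀ x, gdot q w x = gdot w q x := fun x =>
    Finset.sum_congr rfl fun i _ => mul_comm _ _
  simp only [zero_mul, add_zero, e1, e2, e3, e4, integral_neg] at h1 h2
  have e5 : r ^ d * (-(l * hemi (fun x => w x * q x) r) / r) =
      -(r ^ d * (l * hemi (fun x => w x * q x) r / r)) := by ring
  rw [e5] at h2
  have e6 : l * (r ^ d * (hemi (fun x => w x * q x) r / r)) =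
      r ^ d * (l * hemi (fun x => w x * q x) r / r) := by ring
  rw [e6]
  linarith

section Signorini

variable {k : ℕ} {u f : Space d → ℝ} {M : ℝ}

/-- Green's inequality with the competitor `q`, in the form that enters the derivative of the
Monneau functional. The cross term `hcross` is Green's identity for `q`. -/
theorem IsSignorini.hemi_mul_homDefect_ge (h : IsSignorini k u f M) {q : Space d → ℝ}
    (hq : ContDiff ℝ 1 q) (hq0 : ∀ x, lastCoord x = 0 → 0 ≤ q x) {l r : ℝ} (hr : 0 < r)
    (hr1 : r < 1) (hcross : ∫ x in halfBall d r, gdot u q x =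
      l * (r ^ d * (hemi (fun x => u x * q x) r / r))) :
    r / r ^ d * ((∫ x in halfBall d r, gdot u u x) + ∫ x in halfBall d r, f x * (u x - q x)) -
        l * hemi (fun x => u x ^ 2) r ≤
      hemi (fun x => (u x - q x) * homDefect l u x) r := by
  obtain ⟨N, hN, hN'⟩ := exists_bound_halfBall hq
  obtain ⟨R, hrR, hR1⟩ := exists_between hr1
  have hop := isOpen_halfBall (d := d) 1
  have hsub : halfBall d R ⊆ halfBall d 1 := halfBall_mono hR1.le
  have hsr : halfBall d r ⊆ halfBall d 1 := halfBall_mono hr1.le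
  have hηd : ContDiffOn ℝ 1 (fun x => q x - u x) (halfBall d 1) := hq.contDiffOn.sub h.contDiffOn
  have hηb : ∀ x ∈ halfBall d 1, |q x - u x| ≤ N + M := fun x hx =>
    (abs_sub _ _).trans (add_le_add (hN x hx) (h.abs_le x hx))
  have hfd : ∀ x ∈ halfBall d 1, fderiv ℝ (fun x => q x - u x) x =
      fderiv ℝ q x - fderiv ℝ u x := fun x hx =>
    fderiv_fun_sub (hq.differentiable one_ne_zero x) (differentiableAt_of_halfBall h.contDiffOn hx)
  have hηb' : ∀ x ∈ halfBall d 1, ‖fderiv ℝ (fun x => q x - u x) x‖ ≤ N + M := fun x hx => by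
    rw [hfd x hx]
    exact (norm_sub_le _ _).trans (add_le_add (hN' x hx) (h.fderiv_le x hx))
  have hgreen := h.green_le hR1.le hr hrR (hηd.mono hsub) (fun x hx => hηb x (hsub hx))
    (fun x hx => hηb' x (hsub hx)) (h.thin R hR1 q hq.continuous.continuousOn
      fun x _ hx => hq0 x hx)
  have i1 : IntegrableOn (gdot u q) (halfBall d r) :=
    integrableOn_halfBall ((continuousOn_gdot hop h.contDiffOn hq.contDiffOn).mono hsr)
      fun x hx => abs_gdot_le (h.fderiv_le x (hsr hx)) (hN' x (hsr hx))
  have i2 : IntegrableOn (gdot u u) (halfBall d r) :=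
    integrableOn_halfBall ((continuousOn_gdot hop h.contDiffOn h.contDiffOn).mono hsr)
      fun x hx => abs_gdot_le (h.fderiv_le x (hsr hx)) (h.fderiv_le x (hsr hx))
  have i3 : IntegrableOn (fun x => f x * (u x - q x)) (halfBall d r) := by
    refine Integrable.of_bound (C := M * (N + M))
      (h.measurable.aestronglyMeasurable.mul
        (((h.contDiffOn.continuousOn.sub hq.continuous.continuousOn).mono hsr).aestronglyMeasurable
          (measurableSet_halfBall r))) ?_
    filter_upwards [ae_restrict_mem (measurableSet_halfBall r)] with x hx
    refine abs_mul_le_of (h.abs_rhs_le x (hsr hx)) ?_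
    rw [abs_sub_comm]
    exact hηb x (hsr hx)
  have e1 : ∫ x in halfBall d r, (gdot u (fun x => q x - u x) x + f x * (q x - u x)) =
      (∫ x in halfBall d r, gdot u q x) - (∫ x in halfBall d r, gdot u u x) -
        ∫ x in halfBall d r, f x * (u x - q x) := by
    have i12 : IntegrableOn (fun x => gdot u q x - gdot u u x) (halfBall d r) := i1.sub i2
    rw [← integral_sub i1 i2, ← integral_sub i12 i3]
    refine setIntegral_congr_fun (measurableSet_halfBall r) fun x hx => ?_
    have : gdot u (fun x => q x - u x) x = gdot u q x - gdot u u x := by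
      simp only [gdot, pd]
      rw [hfd x (hsr hx), ← Finset.sum_sub_distrib]
      refine Finset.sum_congr rfl fun i _ => ?_
      simp only [sub_apply]
      ring
    simp only [this]
    ring
  have hEc := continuousOn_euler hop h.contDiffOn
  have hEb : ∀ x ∈ halfBall d 1, |euler u x| ≤ M := fun x hx =>
    abs_euler_le (h.fderiv_le x hx) hx.1.le
  have huc := h.contDiffOn.continuousOn
  have hqc : ContinuousOn q (halfBall d 1) := hq.continuous.continuousOn
  have e2 : hemi (fun x => (u x - q x) * homDefect l u x) r =
      -hemi (fun x => euler u x * (q x - u x)) r - l * hemi (fun x => u x ^ 2) r +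
        l * hemi (fun x => u x * q x) r := by
    have j1 := integrable_comp_smul hr hr1 (hEc.mul (hqc.sub huc))
      (fun x hx => abs_mul_le_of (hEb x hx) (hηb x hx))
    have j2 := integrable_comp_smul hr hr1 (huc.mul huc)
      (fun x hx => abs_mul_le_of (h.abs_le x hx) (h.abs_le x hx))
    have j3 := integrable_comp_smul hr hr1 (huc.mul hqc)
      (fun x hx => abs_mul_le_of (h.abs_le x hx) (hN x hx))
    unfold hemi
    rw [← integral_neg, ← integral_const_mul, ← integral_const_mul, ← integral_sub, ← integral_add]
    · refine integral_congr_ae (Eventually.of_forall fun y => ?_)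
      simp only [homDefect]
      ring
    · refine (j1.neg.sub (j2.const_mul l)).congr (Eventually.of_forall fun y => ?_)
      simp [sq]
    · exact j3.const_mul l
    · exact j1.neg
    · refine (j2.const_mul l).congr (Eventually.of_forall fun y => ?_)
      simp [sq]
  rw [e1, hcross] at hgreen
  rw [e2]
  have hP : 0 < r ^ d := pow_pos hr d
  have h3 := mul_le_mul_of_nonneg_left hgreen (div_pos hr hP).le
  have e3 : r / r ^ d * (r ^ d * (hemi (fun x => euler u x * (q x - u x)) r / r)) =
      hemi (fun x => euler u x * (q x - u x)) r := by field_simp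
  have e4 : r / r ^ d * (l * (r ^ d * (hemi (fun x => u x * q x) r / r)) -
      (∫ x in halfBall d r, gdot u u x) - ∫ x in halfBall d r, f x * (u x - q x)) =
      l * hemi (fun x => u x * q x) r - r / r ^ d * ((∫ x in halfBall d r, gdot u u x) +
        ∫ x in halfBall d r, f x * (u x - q x)) := by
    field_simp
    ring
  rw [e3, e4] at h3
  linarith

end Signorini

/-! ### Growth of the mean square -/

section Signorini

variable {k : ℕ} {u f : Space d → ℝ} {M : ℝ}

/-- Uniform growth: the mean square of `u` on the sphere of radius `r` is at most
a multiple of `r ^ (2 l)`, with a constant that depends only on `d`, `M` and `l`. The supremum `S`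
of the normalized mean square satisfies `S ≤ a + S / 4`. -/
theorem IsSignorini.growth (h : IsSignorini k u f M) (hd : 1 ≤ d) {l : ℝ} (hl : 1 ≤ l)
    (hlk : l + 1 ≤ k)
    (hdecay : Tendsto (fun r : ℝ => r ^ (-(2 * l)) * hemi (fun x => u x ^ 2) r) (𝓝[>] 0) (𝓝 0))
    {r : ℝ} (hr : 0 < r) (hr2 : r ≤ 1 / 2) :
    r ^ (-(2 * l)) * hemi (fun x => u x ^ 2) r ≤
      4 / 3 * ((1 / 2 : ℝ) ^ (-(2 * l)) * (M ^ 2 * (hemiMeasure d).real univ) +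
        M ^ 2 * (volume : Measure (Space d)).real (halfBall d 1) / 4 / 2) := by
  set A : ℝ → ℝ := hemi fun x => u x ^ 2 with hA
  set C : ℝ := M ^ 2 * (volume : Measure (Space d)).real (halfBall d 1) / 4 with hC
  set φ : ℝ → ℝ := fun r => r ^ (-(2 * l)) * A r with hφ
  have hC0 : 0 ≤ C := by
    have : 0 ≤ (volume : Measure (Space d)).real (halfBall d 1) := measureReal_nonneg
    positivity
  have hA0 : ∀ r, 0 ≤ A r := hemi_nonneg fun x => sq_nonneg _
  have hφ0 : ∀ r, 0 < r → 0 ≤ φ r := fun r hr => mul_nonneg (Real.rpow_nonneg hr.le _) (hA0 r)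
  have huc := h.contDiffOn.continuousOn
  have hφder : ∀ r, 0 < r → r < 1 → HasDerivAt φ
      (2 * (r ^ (-(2 * l)) * hemi (fun x => u x * homDefect l u x) r) / r) r := by
    intro r hr hr1
    have dA := hasDerivAt_hemi_sq h.contDiffOn h.abs_le h.fderiv_le l hr hr1
    have dl : HasDerivAt (fun r : ℝ => r ^ (-(2 * l))) (-(2 * l) * r ^ (-(2 * l) - 1)) r :=
      Real.hasDerivAt_rpow_const (Or.inl hr.ne')
    refine (dl.mul dA).congr_deriv ?_
    rw [Real.rpow_sub_one hr.ne']
    field_simp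
    ring
  have hφc : ContinuousOn φ (Ioo 0 1) := fun r hr =>
    (hφder r hr.1 hr.2).continuousAt.continuousWithinAt
  -- the normalized mean square is bounded
  have hbdd : BddAbove (φ '' Ioc 0 (1 / 2)) := by
    have h1 : ∀ᶠ s in 𝓝[>] (0 : ℝ), φ s < 1 := hdecay.eventually (gt_mem_nhds one_pos)
    obtain ⟨s₀, hs₀, hs₀'⟩ := mem_nhdsGT_iff_exists_Ioo_subset.1 h1
    have hs₀p : (0 : ℝ) < s₀ := hs₀
    have hsub : Icc (s₀ / 2) (1 / 2) ⊆ Ioo (0 : ℝ) 1 := fun x hx =>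
      ⟨by linarith [hx.1], by linarith [hx.2]⟩
    obtain ⟨B, hB⟩ := (isCompact_Icc (a := s₀ / 2) (b := 1 / 2)).exists_bound_of_continuousOn
      (hφc.mono hsub)
    refine ⟨max 1 B, ?_⟩
    rintro _ ⟨x, hx, rfl⟩
    by_cases hxs : x < s₀
    · exact ((hs₀' ⟨hx.1, hxs⟩ : φ x < 1).le).trans (le_max_left _ _)
    · exact ((le_abs_self _).trans (hB x ⟨by linarith, hx.2⟩)).trans (le_max_right _ _)
  set S : ℝ := sSup (φ '' Ioc 0 (1 / 2)) with hS
  have hφS : ∀ r, 0 < r → r ≤ 1 / 2 → φ r ≤ S := fun r h0 h1 =>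
    le_csSup hbdd (mem_image_of_mem _ ⟨h0, h1⟩)
  have hS0 : 0 ≤ S := (hφ0 _ hr).trans (hφS r hr hr2)
  -- Green's inequality with the competitor zero, combined with the Weiss bound
  have hlow : ∀ r, 0 < r → r < 1 / 2 →
      -((2 * C + S) * r ^ 2) ≤ r ^ (-(2 * l)) * hemi (fun x => u x * homDefect l u x) r := by
    intro r hr hr2
    have hr1 : r < 1 := by linarith
    have hW := h.weiss_ge hd hl hlk hdecay hr hr1
    have hM := h.hemi_mul_homDefect_ge (q := fun _ => 0) contDiff_const (fun _ _ => le_rfl)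
      (l := l) hr hr1 (by simp [hemi, gdot, pd])
    simp only [sub_zero] at hM
    have hfu := (abs_le.1 (h.abs_integral_rhs_mul_le hr hr1 huc h.abs_le)).1
    have hsub : halfBall d r ⊆ halfBall d 1 := halfBall_mono hr1.le
    have iu : IntegrableOn (fun x => u x ^ 2) (halfBall d r) :=
      integrableOn_halfBall ((huc.mono hsub).pow 2) fun x hx => abs_sq_le_of (h.abs_le x (hsub hx))
    have hX : ∫ x in halfBall d r, u x ^ 2 ≤ S * r ^ (2 * l) * r ^ (d + 1) := by
      refine (le_abs_self _).trans (abs_setIntegral_le_of_hemi hr iu fun ρ h0 hρr => ?_)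
      rw [abs_of_nonneg (hA0 ρ)]
      have h2 : ρ ^ (-(2 * l)) * A ρ ≤ S := hφS ρ h0 (by linarith)
      rw [Real.rpow_neg h0.le, inv_mul_le_iff₀ (Real.rpow_pos_of_pos h0 _)] at h2
      have h3 : ρ ^ (2 * l) ≤ r ^ (2 * l) := Real.rpow_le_rpow h0.le hρr.le (by linarith)
      nlinarith
    have hak := rpow_mul_sq_pow_le_one hl hlk hr hr1.le
    have hrl : r ^ (-(2 * l)) * r ^ (2 * l) = 1 := by
      rw [← Real.rpow_add hr]; simp
    rw [pow_succ r d] at hX hfu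
    rw [← hC] at hfu hW
    set a := r ^ (-(2 * l)) with ha
    have ha0 : 0 < a := Real.rpow_pos_of_pos hr _
    set P := r ^ d with hP
    have hP0 : 0 < P := pow_pos hr d
    set q := (r ^ (k - 1)) ^ 2 with hq
    have h4 := mul_le_mul_of_nonneg_left hM ha0.le
    have h5 : -(S * (P * r) * r ^ (2 * l) + C * (P * r * q)) ≤ ∫ x in halfBall d r, f x * u x := by
      linarith
    have h6 := mul_le_mul_of_nonneg_left h5 (show 0 ≤ a * (r / P) by positivity)
    have e1 : a * (r / P) * -(S * (P * r) * r ^ (2 * l) + C * (P * r * q)) =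
        -(S * r ^ 2 * (a * r ^ (2 * l)) + C * r ^ 2 * (a * q)) := by
      field_simp
    have h7 : C * r ^ 2 * (a * q) ≤ C * r ^ 2 * 1 :=
      mul_le_mul_of_nonneg_left hak (by positivity)
    rw [e1, hrl] at h6
    have e2 : a * (r / P * ((∫ x in halfBall d r, gdot u u x) + ∫ x in halfBall d r, f x * u x) -
        l * hemi (fun x => u x ^ 2) r) =
          a * (r / P * (∫ x in halfBall d r, gdot u u x) - l * hemi (fun x => u x ^ 2) r) +
          a * (r / P) * ∫ x in halfBall d r, f x * u x := by ring
    rw [e2] at h4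
    linarith
  have hmono : MonotoneOn (fun r => φ r + (2 * C + S) * r ^ 2) (Ioc 0 (1 / 2)) := by
    have hder : ∀ r, 0 < r → r < 1 → HasDerivAt (fun r => φ r + (2 * C + S) * r ^ 2)
        (2 * (r ^ (-(2 * l)) * hemi (fun x => u x * homDefect l u x) r) / r +
          (2 * C + S) * (2 * r)) r := by
      intro r hr hr1
      have d2 : HasDerivAt (fun r : ℝ => r ^ 2) (2 * r) r := by simpa using hasDerivAt_pow 2 r
      exact (hφder r hr hr1).add (d2.const_mul _)
    refine monotoneOn_of_deriv_nonneg (convex_Ioc 0 (1 / 2)) ?_ ?_ ?_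
    · intro x hx
      exact (hder x hx.1 (by linarith [hx.2])).continuousAt.continuousWithinAt
    · intro x hx
      rw [interior_Ioc] at hx
      exact (hder x hx.1 (by linarith [hx.2])).differentiableAt.differentiableWithinAt
    · intro x hx
      rw [interior_Ioc] at hx
      rw [(hder x hx.1 (by linarith [hx.2])).deriv]
      have h1 := hlow x hx.1 hx.2
      have h2 : -(2 * C + S) * (2 * x) ≤
          2 * (x ^ (-(2 * l)) * hemi (fun y => u y * homDefect l u y) x) / x := by
        rw [le_div_iff₀ hx.1]
        nlinarith
      linarith
  have hle : ∀ r, 0 < r → r ≤ 1 / 2 → φ r ≤ φ (1 / 2) + (2 * C + S) / 4 := by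
    intro r hr hr2
    have := hmono ⟨hr, hr2⟩ ⟨by norm_num, le_rfl⟩ hr2
    simp only at this
    have h3 : 0 ≤ (2 * C + S) * r ^ 2 := by positivity
    linarith
  have hSle : S ≤ φ (1 / 2) + (2 * C + S) / 4 := by
    refine csSup_le ⟨_, mem_image_of_mem _ ⟨hr, hr2⟩⟩ ?_
    rintro _ ⟨x, hx, rfl⟩
    exact hle x hx.1 hx.2
  have hφ2 : φ (1 / 2) ≤ (1 / 2 : ℝ) ^ (-(2 * l)) * (M ^ 2 * (hemiMeasure d).real univ) := by
    refine mul_le_mul_of_nonneg_left ?_ (Real.rpow_nonneg (by norm_num) _)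
    refine (le_abs_self _).trans (abs_hemi_le (R := 1) (by norm_num) (by norm_num) fun x hx => ?_)
    exact abs_sq_le_of (h.abs_le x hx)
  have := hφS r hr hr2
  simp only [hφ] at this
  linarith

/-- The constant in the uniform growth estimate. -/
def growthConst (d : ℕ) (κ M : ℝ) : ℝ :=
  4 / 3 * ((1 / 2 : ℝ) ^ (-(2 * κ)) * (M ^ 2 * (hemiMeasure d).real univ) +
    M ^ 2 * (volume : Measure (Space d)).real (halfBall d 1) / 4 / 2)

theorem growthConst_nonneg (κ M : ℝ) : 0 ≤ growthConst d κ M := by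
  unfold growthConst
  have : 0 ≤ (volume : Measure (Space d)).real (halfBall d 1) := measureReal_nonneg
  have : 0 ≤ (hemiMeasure d).real univ := measureReal_nonneg
  have : (0 : ℝ) ≤ (1 / 2 : ℝ) ^ (-(2 * κ)) := Real.rpow_nonneg (by norm_num) _
  positivity

theorem tendsto_rpow_neg_two_mul {r κ : ℝ} (hr : 0 < r) :
    Tendsto (fun l : ℝ => r ^ (-(2 * l))) (𝓝[<] κ) (𝓝 (r ^ (-(2 * κ)))) := by
  have : Continuous fun l : ℝ => r ^ (-(2 * l)) :=
    Continuous.rpow continuous_const (by fun_prop) fun _ => Or.inl hr.ne'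
  exact (this.tendsto κ).mono_left nhdsWithin_le_nhds

/-- The growth estimate at the limiting exponent `κ`. -/
theorem IsSignorini.growth_limit (h : IsSignorini k u f M) (hd : 1 ≤ d) {κ : ℝ} (hκ : 1 < κ)
    (hκk : κ + 1 ≤ k) (hdecay : ∀ l, 1 ≤ l → l < κ →
      Tendsto (fun r : ℝ => r ^ (-(2 * l)) * hemi (fun x => u x ^ 2) r) (𝓝[>] 0) (𝓝 0))
    {r : ℝ} (hr : 0 < r) (hr2 : r ≤ 1 / 2) :
    r ^ (-(2 * κ)) * hemi (fun x => u x ^ 2) r ≤ growthConst d κ M := by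
  have hlim := (tendsto_rpow_neg_two_mul (κ := κ) hr).mul_const (hemi (fun x => u x ^ 2) r)
  refine le_of_tendsto hlim ?_
  filter_upwards [Ioo_mem_nhdsLT hκ] with l hl
  refine (h.growth hd hl.1.le (by linarith [hl.2]) (hdecay l hl.1.le hl.2) hr hr2).trans ?_
  unfold growthConst
  have : (1 / 2 : ℝ) ^ (-(2 * l)) ≤ (1 / 2 : ℝ) ^ (-(2 * κ)) :=
    Real.rpow_le_rpow_of_exponent_ge (by norm_num) (by norm_num) (by linarith [hl.2])
  have : 0 ≤ M ^ 2 * (hemiMeasure d).real univ := mul_nonneg (sq_nonneg _) measureReal_nonneg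
  gcongr

/-- The lower bound on the Weiss functional at the limiting exponent `κ`. -/
theorem IsSignorini.weiss_limit (h : IsSignorini k u f M) (hd : 1 ≤ d) {κ : ℝ} (hκ : 1 < κ)
    (hκk : κ + 1 ≤ k) (hdecay : ∀ l, 1 ≤ l → l < κ →
      Tendsto (fun r : ℝ => r ^ (-(2 * l)) * hemi (fun x => u x ^ 2) r) (𝓝[>] 0) (𝓝 0))
    {r : ℝ} (hr : 0 < r) (hr1 : r < 1) :
    -(M ^ 2 * (volume : Measure (Space d)).real (halfBall d 1) / 4 * r ^ 2) ≤
      r ^ (-(2 * κ)) * (r / r ^ d * (∫ x in halfBall d r, gdot u u x) -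
        κ * hemi (fun x => u x ^ 2) r) := by
  have hl : Tendsto (fun l : ℝ => l) (𝓝[<] κ) (𝓝 κ) := tendsto_id.mono_left nhdsWithin_le_nhds
  have hlim := (tendsto_rpow_neg_two_mul (κ := κ) hr).mul
    ((tendsto_const_nhds (x := r / r ^ d * ∫ x in halfBall d r, gdot u u x)).sub
      (hl.mul_const (hemi (fun x => u x ^ 2) r)))
  refine ge_of_tendsto hlim ?_
  filter_upwards [Ioo_mem_nhdsLT hκ] with l hl
  exact h.weiss_ge hd hl.1.le (by linarith [hl.2]) (hdecay l hl.1.le hl.2) hr hr1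

end Signorini

/-! ### The Monneau functional on the hemisphere -/

theorem euler_of_homogeneous {q : Space d → ℝ} {n : ℕ} (hq : ContDiff ℝ 1 q)
    (hhom : ∀ t : ℝ, ∀ x, q (t • x) = t ^ n * q x) (x : Space d) : euler q x = n * q x := by
  have h1 : HasDerivAt (fun t : ℝ => q (t • x)) (fderiv ℝ q ((1 : ℝ) • x) x) 1 :=
    hasDerivAt_comp_smul (hq.differentiable one_ne_zero _)
  have h2 : HasDerivAt (fun t : ℝ => q (t • x)) (n * q x) 1 := by
    simp only [hhom]
    simpa using (hasDerivAt_pow n (1 : ℝ)).mul_const (q x)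
  rw [one_smul] at h1
  exact h1.unique h2

/-- The Cauchy-Schwarz inequality on the hemisphere, up to a constant. -/
theorem hemi_abs_sq_le {q : Space d → ℝ} (hq : Continuous q) :
    hemi (fun x => |q x|) 1 ^ 2 ≤
      ((hemiMeasure d).real univ + 1) * hemi (fun x => q x ^ 2) 1 := by
  set s := (hemiMeasure d).real univ with hs
  have hs0 : 0 ≤ s := measureReal_nonneg
  set Q := hemi (fun x => |q x|) 1 with hQ
  set t := Q / (s + 1) with ht
  obtain ⟨B, hB⟩ := (isCompact_closedBall (0 : Space d) 2).exists_bound_of_continuousOn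
    hq.continuousOn
  have hB2 : ∀ x ∈ halfBall d 2, |q x| ≤ B := fun x hx =>
    hB x (ball_subset_closedBall (halfBall_subset_ball 2 hx))
  have i1 := integrable_comp_smul (F := fun x => q x ^ 2) one_pos one_lt_two
    (hq.pow 2).continuousOn (fun x hx => abs_sq_le_of (hB2 x hx))
  have i2 := integrable_comp_smul (F := fun x => |q x|) (C := B) one_pos one_lt_two
    hq.abs.continuousOn (fun x hx => by rw [abs_abs]; exact hB2 x hx)
  have h0 : 0 ≤ hemi (fun x => (|q x| - t) ^ 2) 1 := hemi_nonneg (fun x => sq_nonneg _) 1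
  have e : hemi (fun x => (|q x| - t) ^ 2) 1 =
      hemi (fun x => q x ^ 2) 1 - 2 * t * Q + t ^ 2 * s := by
    have i3 : Integrable (fun _ : sphere (0 : Space d) 1 => t ^ 2) (hemiMeasure d) :=
      integrable_const _
    have e3 : ∫ _ : sphere (0 : Space d) 1, t ^ 2 ∂(hemiMeasure d) = t ^ 2 * s := by
      rw [integral_const, smul_eq_mul, mul_comm]
    rw [hQ, ← e3]
    simp only [hemi]
    have i12 : Integrable (fun y : sphere (0 : Space d) 1 => q ((1 : ℝ) • (y : Space d)) ^ 2 -
        2 * t * |q ((1 : ℝ) • (y : Space d))|) (hemiMeasure d) := i1.sub (i2.const_mul _)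
    rw [← integral_const_mul, ← integral_sub i1 (i2.const_mul _), ← integral_add i12 i3]
    refine integral_congr_ae (Eventually.of_forall fun y => ?_)
    simp only
    rw [← sq_abs (q _)]
    ring
  rw [e] at h0
  have h1 : t * (s + 1) = Q := by rw [ht]; field_simp
  nlinarith [sq_nonneg t]

section Signorini

variable {k : ℕ} {u f : Space d → ℝ} {M : ℝ}

/-- The contribution of the right hand side to the derivative of the Monneau functional. -/
theorem IsSignorini.abs_integral_rhs_mul_sub_le (h : IsSignorini k u f M) (hM : 0 ≤ M) {n : ℕ}
    (hnk : n + 1 ≤ k) {S : ℝ}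
    (hS : ∀ ρ : ℝ, 0 < ρ → ρ ≤ 1 / 2 → hemi (fun x => u x ^ 2) ρ ≤ S * (ρ ^ n) ^ 2)
    {q : Space d → ℝ} (hq : ContDiff ℝ 1 q) (hhom : ∀ t : ℝ, ∀ x, q (t • x) = t ^ n * q x)
    {r : ℝ} (hr : 0 < r) (hr2 : r < 1 / 2) :
    |∫ x in halfBall d r, f x * (u x - q x)| ≤
      M * (((hemiMeasure d).real univ + S) / 2 + hemi (fun x => |q x|) 1) * (r ^ n) ^ 2 *
        r ^ (d + 1) := by
  set s := (hemiMeasure d).real univ with hs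
  set Q := hemi (fun x => |q x|) 1 with hQ
  obtain ⟨N, hN, -⟩ := exists_bound_halfBall hq
  have hr1 : r < 1 := by linarith
  have hsr : halfBall d r ⊆ halfBall d 1 := halfBall_mono hr1.le
  have huc := h.contDiffOn.continuousOn
  have i3 : IntegrableOn (fun x => f x * (u x - q x)) (halfBall d r) := by
    refine Integrable.of_bound (C := M * (M + N))
      (h.measurable.aestronglyMeasurable.mul
        (((huc.sub hq.continuous.continuousOn).mono hsr).aestronglyMeasurable
          (measurableSet_halfBall r))) ?_
    filter_upwards [ae_restrict_mem (measurableSet_halfBall r)] with x hx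
    exact abs_mul_le_of (h.abs_rhs_le x (hsr hx))
      ((abs_sub _ _).trans (add_le_add (h.abs_le x (hsr hx)) (hN x (hsr hx))))
  refine abs_setIntegral_le_of_hemi hr i3 fun ρ h0 hρr => ?_
  have hρ1 : ρ < 1 := hρr.trans hr1
  have hρn : 0 < ρ ^ n := pow_pos h0 n
  have iu2 := integrable_comp_smul (F := fun x => u x ^ 2) h0 hρ1 (huc.pow 2)
    (fun x hx => abs_sq_le_of (h.abs_le x hx))
  have iq := integrable_comp_smul (F := fun x => |q x|) (C := N) h0 hρ1
    hq.continuous.abs.continuousOn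
    (fun x hx => by rw [abs_abs]; exact hN x hx)
  have ic : Integrable (fun _ : sphere (0 : Space d) 1 => M * (ρ ^ n) ^ 2 / 2) (hemiMeasure d) :=
    integrable_const _
  have hQρ : hemi (fun x => |q x|) ρ = ρ ^ n * Q := by
    rw [hQ]
    unfold hemi
    rw [← integral_const_mul]
    refine integral_congr_ae (Eventually.of_forall fun y => ?_)
    simp only [one_smul]
    rw [hhom, abs_mul, abs_of_pos hρn]
  have hbound : |hemi (fun x => f x * (u x - q x)) ρ| ≤
      ∫ y : sphere (0 : Space d) 1, ((M * (ρ ^ n) ^ 2 / 2 + M / 2 * u (ρ • (y : Space d)) ^ 2) +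
        M * ρ ^ n * |q (ρ • (y : Space d))|) ∂(hemiMeasure d) := by
    rw [← Real.norm_eq_abs]
    refine norm_integral_le_of_norm_le ((ic.add (iu2.const_mul _)).add (iq.const_mul _)) ?_
    filter_upwards [ae_hemiMeasure] with y hy
    have hmem := smul_mem_halfBall h0 hρ1 hy
    set x := ρ • (y : Space d) with hx
    have hnorm : ‖x‖ = ρ := by simp [hx, norm_smul, abs_of_pos h0]
    have h1 : |f x| ≤ M * ρ ^ n := by
      refine (h.abs_rhs_le_pow x hmem).trans (mul_le_mul_of_nonneg_left ?_ hM)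
      rw [hnorm]
      exact pow_le_pow_of_le_one h0.le hρ1.le (by omega)
    rw [norm_mul, Real.norm_eq_abs, Real.norm_eq_abs]
    have h2 : |f x| * |u x - q x| ≤ M * ρ ^ n * (|u x| + |q x|) :=
      mul_le_mul h1 (abs_sub _ _) (abs_nonneg _) (by positivity)
    have h3 : ρ ^ n * |u x| ≤ (ρ ^ n) ^ 2 / 2 + u x ^ 2 / 2 := by
      nlinarith [sq_nonneg (ρ ^ n - |u x|), sq_abs (u x)]
    have h4 := mul_le_mul_of_nonneg_left h3 hM
    linarith
  refine hbound.trans ?_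
  have iA : Integrable (fun y : sphere (0 : Space d) 1 =>
      M * (ρ ^ n) ^ 2 / 2 + M / 2 * u (ρ • (y : Space d)) ^ 2) (hemiMeasure d) :=
    ic.add (iu2.const_mul _)
  rw [integral_add iA (iq.const_mul _), integral_add ic (iu2.const_mul _), integral_const,
    integral_const_mul, integral_const_mul, smul_eq_mul]
  change s * (M * (ρ ^ n) ^ 2 / 2) + M / 2 * hemi (fun x => u x ^ 2) ρ +
    M * ρ ^ n * hemi (fun x => |q x|) ρ ≤ _
  rw [hQρ]
  have h5 := mul_le_mul_of_nonneg_left (hS ρ h0 (by linarith)) (show 0 ≤ M / 2 by positivity)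
  have h6 : (ρ ^ n) ^ 2 ≤ (r ^ n) ^ 2 :=
    pow_le_pow_left₀ hρn.le (pow_le_pow_left₀ h0.le hρr.le n) 2
  have hQ0 : 0 ≤ Q := hemi_nonneg (fun x => abs_nonneg _) 1
  have hs0 : 0 ≤ s := measureReal_nonneg
  have hS0 : 0 ≤ S := by
    have h7 := (hemi_nonneg (fun x => sq_nonneg (u x)) ρ).trans (hS ρ h0 (by linarith))
    exact nonneg_of_mul_nonneg_left h7 (by positivity)
  have h8 := mul_le_mul_of_nonneg_left h6 (show 0 ≤ M * ((s + S) / 2 + Q) by positivity)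
  nlinarith

/-- The Monneau functional on the half sphere, for a harmonic homogeneous competitor `q` with
vanishing normal derivative: it is differentiable, with the derivative bounded below. -/
theorem IsSignorini.hasDerivAt_monneau (h : IsSignorini k u f M) (hd : 1 ≤ d) (hM : 0 ≤ M) {n : ℕ}
    (hn : 2 ≤ n) (hnk : n + 1 ≤ k)
    (hdecay : ∀ l : ℝ, 1 ≤ l → l < n →
      Tendsto (fun r : ℝ => r ^ (-(2 * l)) * hemi (fun x => u x ^ 2) r) (𝓝[>] 0) (𝓝 0))
    {q : Space d → ℝ} (hq : ContDiff ℝ 2 q) (hhom : ∀ t : ℝ, ∀ x, q (t • x) = t ^ n * q x)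
    (hΔ : ∀ x, ∑ i, pd i (pd i q) x = 0)
    (hqn : ∀ x, lastCoord x = 0 → pd (Fin.last d) q x = 0)
    (hq0 : ∀ x, lastCoord x = 0 → 0 ≤ q x) {r : ℝ} (hr : 0 < r) (hr2 : r < 1 / 2) :
    ∃ D' : ℝ, HasDerivAt (fun r => ((r ^ n) ^ 2)⁻¹ * hemi (fun x => (u x - q x) ^ 2) r) D' r ∧
      -(2 * (M ^ 2 * (volume : Measure (Space d)).real (halfBall d 1) / 4 +
        M * (((hemiMeasure d).real univ + growthConst d n M) / 2 +
          hemi (fun x => |q x|) 1))) ≤ D' := by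
  have hq1 : ContDiff ℝ 1 q := hq.of_le one_le_two
  have hr1 : r < 1 := by linarith
  have hpow : ∀ r : ℝ, 0 < r → r ^ (-(2 * (n : ℝ))) = ((r ^ n) ^ 2)⁻¹ := by
    intro r hr
    rw [Real.rpow_neg hr.le, ← pow_mul, ← Real.rpow_natCast r (n * 2)]
    congr 2
    push_cast
    ring
  have hn1 : (1 : ℝ) < n := by exact_mod_cast hn
  have hnk' : (n : ℝ) + 1 ≤ k := by exact_mod_cast hnk
  have hS : ∀ ρ : ℝ, 0 < ρ → ρ ≤ 1 / 2 →
      hemi (fun x => u x ^ 2) ρ ≤ growthConst d n M * (ρ ^ n) ^ 2 := by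
    intro ρ h0 h2
    have := h.growth_limit hd hn1 hnk' hdecay h0 h2
    rwa [hpow ρ h0, inv_mul_le_iff₀ (by positivity), mul_comm] at this
  obtain ⟨N, hN, hN'⟩ := exists_bound_halfBall hq1
  have hwd : ContDiffOn ℝ 1 (fun x => u x - q x) (halfBall d 1) := h.contDiffOn.sub hq1.contDiffOn
  have hfd : ∀ x ∈ halfBall d 1, fderiv ℝ (fun x => u x - q x) x =
      fderiv ℝ u x - fderiv ℝ q x := fun x hx =>
    fderiv_fun_sub (differentiableAt_of_halfBall h.contDiffOn hx) (hq1.differentiable one_ne_zero x)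
  have heul := euler_of_homogeneous hq1 hhom
  -- the homogeneous function `q` does not contribute to the defect
  have hdef : ∀ x ∈ halfBall d 1, homDefect n (fun x => u x - q x) x = homDefect n u x := by
    intro x hx
    have := heul x
    simp only [homDefect, euler] at this ⊢
    rw [hfd x hx, sub_apply, this]
    ring
  have dH := hasDerivAt_hemi_sq (N := M + N) hwd
    (fun x hx => (abs_sub _ _).trans (add_le_add (h.abs_le x hx) (hN x hx)))
    (fun x hx => by
      rw [hfd x hx]
      exact (norm_sub_le _ _).trans (add_le_add (h.fderiv_le x hx) (hN' x hx))) n hr hr1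
  have e1 : hemi (fun x => (u x - q x) * homDefect n (fun x => u x - q x) x) r =
      hemi (fun x => (u x - q x) * homDefect n u x) r :=
    hemi_congr hr hr1 fun x hx => by rw [hdef x hx]
  rw [e1] at dH
  have dl : HasDerivAt (fun r : ℝ => ((r ^ n) ^ 2)⁻¹)
      (-(2 * (n : ℝ)) * (((r ^ n) ^ 2)⁻¹ / r)) r := by
    have h1 : HasDerivAt (fun r : ℝ => r ^ (-(2 * (n : ℝ))))
        (-(2 * (n : ℝ)) * r ^ (-(2 * (n : ℝ)) - 1)) r :=
      Real.hasDerivAt_rpow_const (Or.inl hr.ne')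
    rw [Real.rpow_sub_one hr.ne', hpow r hr] at h1
    refine h1.congr_of_eventuallyEq ?_
    filter_upwards [lt_mem_nhds hr] with t ht using (hpow t ht).symm
  -- the derivative equals `2 / r` times `r ^ (-2 n) hemi ((u - q) (x · ∇u - n u)) r`
  refine ⟨_, dl.mul dH, ?_⟩
  have hcross := integral_gdot_harmonic hq hΔ heul hqn h.contDiffOn h.abs_le h.fderiv_le hr hr1
  have hge := h.hemi_mul_homDefect_ge hq1 hq0 hr hr1 hcross
  have hW := h.weiss_limit hd hn1 hnk' hdecay hr hr1
  have hF := (abs_le.1 (h.abs_integral_rhs_mul_sub_le hM hnk hS hq1 hhom hr hr2)).1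
  rw [hpow r hr] at hW
  rw [pow_succ r d] at hF
  set a := ((r ^ n) ^ 2)⁻¹ with ha
  have ha0 : 0 < a := by positivity
  have han : a * (r ^ n) ^ 2 = 1 := by rw [ha]; field_simp
  set C := M ^ 2 * (volume : Measure (Space d)).real (halfBall d 1) / 4 with hC
  set E := M * (((hemiMeasure d).real univ + growthConst d n M) / 2 + hemi (fun x => |q x|) 1)
    with hE
  set P := r ^ d with hP
  have hP0 : 0 < P := pow_pos hr d
  have hQ0 : 0 ≤ hemi (fun x => |q x|) 1 := hemi_nonneg (fun x => abs_nonneg _) 1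
  have hC0 : 0 ≤ C := by
    have : 0 ≤ (volume : Measure (Space d)).real (halfBall d 1) := measureReal_nonneg
    positivity
  have hE0 : 0 ≤ E := by
    have : 0 ≤ (hemiMeasure d).real univ := measureReal_nonneg
    have := growthConst_nonneg (d := d) n M
    positivity
  have h1 := mul_le_mul_of_nonneg_left hge ha0.le
  have h2 := mul_le_mul_of_nonneg_left hF (show 0 ≤ a * (r / P) by positivity)
  have e2 : a * (r / P) * -(E * (r ^ n) ^ 2 * (P * r)) = -(E * r ^ 2 * (a * (r ^ n) ^ 2)) := by
    field_simp
  rw [e2, han] at h2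
  set T := hemi (fun x => (u x - q x) * homDefect n u x) r with hT
  have e3 : a * (r / P * ((∫ x in halfBall d r, gdot u u x) +
      ∫ x in halfBall d r, f x * (u x - q x)) - n * hemi (fun x => u x ^ 2) r) =
      a * (r / P * (∫ x in halfBall d r, gdot u u x) - n * hemi (fun x => u x ^ 2) r) +
        a * (r / P) * ∫ x in halfBall d r, f x * (u x - q x) := by ring
  rw [e3] at h1
  have h3 : -((C + E) * r ^ 2) ≤ a * T := by linarith
  have e4 : -(2 * (n : ℝ)) * (a / r) * hemi (fun x => (u x - q x) ^ 2) r +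
      a * (2 * (T + n * hemi (fun x => (u x - q x) ^ 2) r) / r) = 2 * (a * T) / r := by
    field_simp
    ring
  rw [e4, le_div_iff₀ hr]
  have h4 : (C + E) * r ^ 2 ≤ (C + E) * r := by
    refine mul_le_mul_of_nonneg_left ?_ (by positivity)
    nlinarith
  linarith

end Signorini

/-! ### Reflection in the thin space -/

/-- The reflection in `{x_n = 0}` as a linear isometry. -/
def reflectIso (d : ℕ) : Space d ≃ₗᵢ[ℝ] Space d := (Submodule.span ℝ {lastVec d})ᗮ.reflection

theorem inner_lastVec (x : Space d) : inner ℝ (lastVec d) x = lastCoord x := by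
  simp [lastVec, lastCoord, EuclideanSpace.inner_single_left]

theorem reflectIso_apply (x : Space d) : reflectIso d x = reflect x := by
  rw [reflectIso, Submodule.reflection_orthogonal_apply, Submodule.reflection_singleton_apply,
    inner_lastVec, norm_lastVec, reflect]
  simp [two_smul, add_smul, two_mul]

theorem norm_reflect (x : Space d) : ‖reflect x‖ = ‖x‖ := by
  rw [← reflectIso_apply, LinearIsometryEquiv.norm_map]

theorem reflect_reflect (x : Space d) : reflect (reflect x) = x := by
  rw [← reflectIso_apply, ← reflectIso_apply]
  exact Submodule.reflection_reflection _ x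

theorem lastCoord_reflect (x : Space d) : lastCoord (reflect x) = -lastCoord x := by
  simp [reflect, lastCoord, lastVec]
  ring

theorem reflect_smul (t : ℝ) (x : Space d) : reflect (t • x) = t • reflect x := by
  rw [← reflectIso_apply, ← reflectIso_apply, map_smul]

theorem reflect_eq_self {x : Space d} (hx : lastCoord x = 0) : reflect x = x := by
  simp [reflect, hx]

/-- The reflection of the unit sphere in `{x_n = 0}`. -/
def sphereReflect (d : ℕ) : sphere (0 : Space d) 1 ≃ₜ sphere (0 : Space d) 1 where
  toFun y := ⟨reflect (y : Space d), by simp [norm_reflect]⟩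
  invFun y := ⟨reflect (y : Space d), by simp [norm_reflect]⟩
  left_inv y := Subtype.ext (reflect_reflect _)
  right_inv y := Subtype.ext (reflect_reflect _)
  continuous_toFun := by
    simp only [← reflectIso_apply]
    fun_prop
  continuous_invFun := by
    simp only [← reflectIso_apply]
    fun_prop

theorem sphereReflect_coe (y : sphere (0 : Space d) 1) :
    (sphereReflect d y : Space d) = reflect (y : Space d) := rfl

/-- The surface measure is invariant under the reflection, since cones over sets in the sphere are
mapped to cones of the same volume. -/
theorem measurePreserving_sphereReflect :
    MeasurePreserving (sphereReflect d) (volume : Measure (Space d)).toSphere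
      (volume : Measure (Space d)).toSphere := by
  refine ⟨(sphereReflect d).continuous.measurable, ?_⟩
  ext s hs
  rw [Measure.map_apply (sphereReflect d).continuous.measurable hs, Measure.toSphere_apply' _ hs,
    Measure.toSphere_apply' _ ((sphereReflect d).continuous.measurable hs)]
  congr 1
  rw [← (reflectIso d).measurePreserving.measure_preimage_equiv
    (f := (reflectIso d).toMeasurableEquiv)]
  congr 1
  ext x
  simp only [mem_preimage, LinearIsometryEquiv.coe_toMeasurableEquiv, reflectIso_apply]
  constructor
  · rintro ⟨t, ht, -, ⟨y, hy, rfl⟩, h⟩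
    refine ⟨t, ht, _, ⟨sphereReflect d y, hy, rfl⟩, ?_⟩
    simp only [sphereReflect_coe, ← reflect_smul] at h ⊢
    rw [h, reflect_reflect]
  · rintro ⟨t, ht, -, ⟨y, hy, rfl⟩, rfl⟩
    refine ⟨t, ht, _, ⟨sphereReflect d y, ?_, rfl⟩, by simp only [sphereReflect_coe, reflect_smul]⟩
    change sphereReflect d (sphereReflect d y) ∈ s
    convert hy
    exact Subtype.ext (reflect_reflect _)

/-- The equator has measure zero on the sphere, since its cone lies in a hyperplane. -/
theorem toSphere_equator :
    (volume : Measure (Space d)).toSphere {y | lastCoord (y : Space d) = 0} = 0 := by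
  have hm : MeasurableSet {y : sphere (0 : Space d) 1 | lastCoord (y : Space d) = 0} :=
    (isClosed_eq (continuous_lastCoord.comp continuous_subtype_val)
      continuous_const).measurableSet
  rw [Measure.toSphere_apply' _ hm]
  refine mul_eq_zero_of_right _ (measure_mono_null
    (t := ((Submodule.span ℝ {lastVec d})ᗮ : Submodule ℝ (Space d))) ?_ ?_)
  · rintro - ⟨t, -, -, ⟨y, hy, rfl⟩, rfl⟩
    rw [SetLike.mem_coe, Submodule.mem_orthogonal_singleton_iff_inner_right, inner_lastVec]
    have : lastCoord (y : Space d) = 0 := hy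
    simp [lastCoord_smul, this]
  · refine Measure.addHaar_submodule _ _ fun h => ?_
    have : lastVec d ∈ (Submodule.span ℝ {lastVec d})ᗮ := h ▸ Submodule.mem_top
    rw [Submodule.mem_orthogonal_singleton_iff_inner_right, inner_lastVec] at this
    simp [lastCoord, lastVec] at this

/-- Integrals over the sphere in terms of the upper hemisphere. -/
theorem integral_toSphere_eq_hemi {F : Space d → ℝ} {r : ℝ}
    (h1 : Integrable (fun y : sphere (0 : Space d) 1 => F (r • (y : Space d))) (hemiMeasure d))
    (h2 : Integrable (fun y : sphere (0 : Space d) 1 => F (reflect (r • (y : Space d))))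
      (hemiMeasure d)) :
    ∫ y : sphere (0 : Space d) 1, F (r • (y : Space d)) ∂(volume : Measure (Space d)).toSphere =
      hemi F r + hemi (fun x => F (reflect x)) r := by
  set σ := (volume : Measure (Space d)).toSphere
  set G : sphere (0 : Space d) 1 → ℝ := fun y => F (r • (y : Space d)) with hG
  set Sp := {y : sphere (0 : Space d) 1 | 0 < lastCoord (y : Space d)} with hSp
  set Sm := {y : sphere (0 : Space d) 1 | lastCoord (y : Space d) < 0} with hSm
  have hmp := measurePreserving_sphereReflect (d := d)
  have hemb := (sphereReflect d).measurableEmbedding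
  have hpre : sphereReflect d ⁻¹' Sm = Sp := by
    ext y
    simp [hSm, hSp, sphereReflect_coe, lastCoord_reflect]
  have hGr : (fun y : sphere (0 : Space d) 1 => F (reflect (r • (y : Space d)))) =
      G ∘ sphereReflect d := by
    ext y
    simp [hG, sphereReflect_coe, reflect_smul]
  have hm : IntegrableOn G Sm σ := by
    rw [← hmp.integrableOn_comp_preimage hemb, hpre, ← hGr]
    exact h2
  have hSmm : MeasurableSet Sm :=
    (isOpen_lt (continuous_lastCoord.comp continuous_subtype_val) continuous_const).measurableSet
  have hae : (univ : Set (sphere (0 : Space d) 1)) =ᵐ[σ]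
      (Sp ∪ Sm : Set (sphere (0 : Space d) 1)) := by
    have h0 : ∀ᵐ y : sphere (0 : Space d) 1 ∂σ, lastCoord (y : Space d) ≠ 0 := by
      rw [ae_iff]
      simpa using toSphere_equator
    filter_upwards [h0] with y hy
    refine propext ⟨fun _ => ?_, fun _ => mem_univ y⟩
    rcases lt_or_gt_of_ne hy with h | h
    · exact Or.inr h
    · exact Or.inl h
  have hdisj : Disjoint Sp Sm := Set.disjoint_left.2 fun y hp hn =>
    lt_asymm (show 0 < lastCoord (y : Space d) from hp) hn
  rw [← setIntegral_univ, setIntegral_congr_set hae, setIntegral_union hdisj hSmm h1 hm,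
    ← hmp.setIntegral_preimage_emb hemb G Sm, hpre]
  rw [hemi, hemi, hGr]
  rfl

/-! ### Even parts and harmonic polynomials -/

/-- The part of a function that is even in `x_n`. -/
def evenPart (P : Space d → ℝ) (x : Space d) : ℝ := (P x + P (reflect x)) / 2

/-- The part of a function that is odd in `x_n`. -/
def oddPart (P : Space d → ℝ) (x : Space d) : ℝ := (P x - P (reflect x)) / 2

theorem contDiff_reflect {n : WithTop ℕ∞} : ContDiff ℝ n (reflect : Space d → Space d) := by
  have : (reflect : Space d → Space d) = reflectIso d := funext fun x => (reflectIso_apply x).symm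
  rw [this]
  exact (reflectIso d).contDiff

theorem contDiff_evenPart {n : WithTop ℕ∞} {P : Space d → ℝ} (hP : ContDiff ℝ n P) :
    ContDiff ℝ n (evenPart P) :=
  (hP.add (hP.comp contDiff_reflect)).div_const 2

theorem contDiff_oddPart {n : WithTop ℕ∞} {P : Space d → ℝ} (hP : ContDiff ℝ n P) :
    ContDiff ℝ n (oddPart P) :=
  (hP.sub (hP.comp contDiff_reflect)).div_const 2

theorem reflect_single (i : Fin (d + 1)) :
    reflect (EuclideanSpace.single i (1 : ℝ) : Space d) =
      (if i = Fin.last d then (-1 : ℝ) else 1) • EuclideanSpace.single i (1 : ℝ) := by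
  split_ifs with h
  · subst h
    rw [reflect]
    simp [lastCoord, lastVec, two_smul]
  · rw [reflect_eq_self, one_smul]
    simp [lastCoord, Ne.symm h]

theorem pd_comp_reflect {P : Space d → ℝ} (hP : Differentiable ℝ P) (i : Fin (d + 1))
    (x : Space d) : pd i (fun x => P (reflect x)) x =
      (if i = Fin.last d then (-1 : ℝ) else 1) * pd i P (reflect x) := by
  have h1 : HasFDerivAt (fun x => P (reflect x))
      ((fderiv ℝ P (reflect x)).comp (reflectIso d : Space d →L[ℝ] Space d)) x := by
    have := (hP (reflect x)).hasFDerivAt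
    rw [← reflectIso_apply] at this
    have h2 := this.comp x (reflectIso d).toContinuousLinearEquiv.hasFDerivAt
    rw [reflectIso_apply] at h2
    have h3 : (fun x => P (reflect x)) = P ∘ reflectIso d :=
      funext fun x => by rw [Function.comp_apply, reflectIso_apply]
    rw [h3]
    exact h2
  rw [pd, h1.fderiv, ContinuousLinearMap.comp_apply]
  have h3 : (reflectIso d : Space d →L[ℝ] Space d) (EuclideanSpace.single i 1) =
      reflect (EuclideanSpace.single i 1) := reflectIso_apply _
  rw [h3, reflect_single, map_smul, smul_eq_mul, pd]

theorem pd_half_add {f g : Space d → ℝ} {x : Space d} (hf : DifferentiableAt ℝ f x)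
    (hg : DifferentiableAt ℝ g x) (s : ℝ) (i : Fin (d + 1)) :
    pd i (fun x => (f x + s * g x) / 2) x = (pd i f x + s * pd i g x) / 2 := by
  have h1 : (fun x => (f x + s * g x) / 2) = fun x => (2 : ℝ)⁻¹ * (f x + s * g x) := by
    ext x; ring
  have h2 := (hf.hasFDerivAt.add (hg.hasFDerivAt.const_mul s)).const_mul (2 : ℝ)⁻¹
  rw [h1, pd, HasFDerivAt.fderiv (f := fun x => (2 : ℝ)⁻¹ * (f x + s * g x)) h2]
  simp only [smul_apply, add_apply, smul_eq_mul, pd]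
  ring

theorem pd_evenPart {P : Space d → ℝ} (hP : Differentiable ℝ P) (i : Fin (d + 1)) (x : Space d) :
    pd i (evenPart P) x = (pd i P x +
      (if i = Fin.last d then (-1 : ℝ) else 1) * pd i P (reflect x)) / 2 := by
  have hR : DifferentiableAt ℝ (fun x => P (reflect x)) x :=
    (hP _).comp x (contDiff_reflect.differentiable one_ne_zero x)
  rw [← pd_comp_reflect hP]
  have h := pd_half_add (hP x) hR 1 i
  simp only [one_mul] at h
  exact h

/-- The even part of a harmonic function is harmonic. -/
theorem harmonic_evenPart {P : Space d → ℝ} (hP : ContDiff ℝ 2 P)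
    (hΔ : ∀ x, ∑ i, pd i (pd i P) x = 0) (x : Space d) :
    ∑ i, pd i (pd i (evenPart P)) x = 0 := by
  have hP1 : Differentiable ℝ P := hP.differentiable two_ne_zero
  have hpi : ∀ i, Differentiable ℝ (pd i P) := fun i =>
    ((hP.fderiv_right (m := 1) (by norm_num)).clm_apply contDiff_const).differentiable one_ne_zero
  have h1 : ∀ i, pd i (pd i (evenPart P)) x =
      (pd i (pd i P) x + pd i (pd i P) (reflect x)) / 2 := by
    intro i
    set s : ℝ := if i = Fin.last d then -1 else 1 with hs
    have hss : s * s = 1 := by rw [hs]; split_ifs <;> norm_num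
    have h2 : pd i (evenPart P) = fun x => (pd i P x + s * pd i P (reflect x)) / 2 := by
      ext x; rw [pd_evenPart hP1]
    have hR : DifferentiableAt ℝ (fun x => pd i P (reflect x)) x :=
      (hpi i _).comp x (contDiff_reflect.differentiable one_ne_zero x)
    rw [h2, pd_half_add (hpi i x) hR, pd_comp_reflect (hpi i), ← hs, ← mul_assoc, hss, one_mul]
  simp only [h1]
  rw [← Finset.sum_div, Finset.sum_add_distrib, hΔ, hΔ]
  simp

theorem evenPart_of_lastCoord_eq_zero (P : Space d → ℝ) {x : Space d} (hx : lastCoord x = 0) :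
    evenPart P x = P x := by
  rw [evenPart, reflect_eq_self hx]; ring

/-- The normal derivative of an even function vanishes on the thin space. -/
theorem pd_last_evenPart {P : Space d → ℝ} (hP : Differentiable ℝ P) {x : Space d}
    (hx : lastCoord x = 0) : pd (Fin.last d) (evenPart P) x = 0 := by
  rw [pd_evenPart hP, reflect_eq_self hx]
  simp

/-- By homogeneity, the integral of an even part on the hemisphere is controlled by the `L²` norm on
the ball. -/
theorem hemi_abs_evenPart_le {P : Space d → ℝ} (hP : Continuous P) {n : ℕ}
    (hhom : ∀ t : ℝ, ∀ x, P (t • x) = t ^ n * P x) :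
    hemi (fun x => |evenPart P x|) 1 ≤
      √(((hemiMeasure d).real univ + 1) * (d + 1 + 2 * n)) *
        √(∫ x in ball (0 : Space d) 1, P x ^ 2) := by
  have hRc : Continuous (reflect : Space d → Space d) := (contDiff_reflect (n := 0)).continuous
  have hq : Continuous (evenPart P) := ((hP.add (hP.comp hRc)).div_const 2)
  have hqhom : ∀ t : ℝ, ∀ x, evenPart P (t • x) = t ^ n * evenPart P x := by
    intro t x
    simp only [evenPart, reflect_smul, hhom]
    ring
  have iball : ∀ F : Space d → ℝ, Continuous F → IntegrableOn F (ball (0 : Space d) 1) :=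
    fun F hF => (hF.continuousOn.integrableOn_compact (isCompact_closedBall 0 1)).mono_set
      ball_subset_closedBall
  have h1 : ∫ x in halfBall d 1, evenPart P x ^ 2 =
      hemi (fun x => evenPart P x ^ 2) 1 / (d + 1 + 2 * n) := by
    rw [setIntegral_halfBall_eq (F := fun x => evenPart P x ^ 2) zero_le_one
      ((iball _ (hq.pow 2)).mono_set (halfBall_subset_ball 1))]
    have h2 : ∀ ρ : ℝ, ρ ^ d * hemi (fun x => evenPart P x ^ 2) ρ =
        ρ ^ (d + 2 * n) * hemi (fun x => evenPart P x ^ 2) 1 := by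
      intro ρ
      have : hemi (fun x => evenPart P x ^ 2) ρ =
          (ρ ^ n) ^ 2 * hemi (fun x => evenPart P x ^ 2) 1 := by
        simp only [hemi]
        rw [← integral_const_mul]
        refine integral_congr_ae (Eventually.of_forall fun y => ?_)
        simp only [one_smul]
        rw [hqhom, mul_pow]
      rw [this]
      ring
    simp only [h2]
    rw [intervalIntegral.integral_mul_const, integral_pow]
    push_cast
    simp
    ring
  have h3 : ∫ x in halfBall d 1, evenPart P x ^ 2 ≤ ∫ x in ball (0 : Space d) 1, P x ^ 2 := by
    calc ∫ x in halfBall d 1, evenPart P x ^ 2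
        ≤ ∫ x in ball (0 : Space d) 1, evenPart P x ^ 2 :=
          setIntegral_mono_set (iball _ (hq.pow 2)) (Eventually.of_forall fun x => sq_nonneg _)
            (halfBall_subset_ball 1).eventuallyLE
      _ ≤ ∫ x in ball (0 : Space d) 1, (P x ^ 2 / 2 + P (reflect x) ^ 2 / 2) := by
          refine setIntegral_mono (iball _ (hq.pow 2))
            (iball _ (((hP.pow 2).div_const 2).add (((hP.comp hRc).pow 2).div_const 2)))
            fun x => ?_
          simp only [evenPart]
          nlinarith [sq_nonneg (P x - P (reflect x))]
      _ = ∫ x in ball (0 : Space d) 1, P x ^ 2 := by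
          have hpre : reflectIso d ⁻¹' ball (0 : Space d) 1 = ball 0 1 := by
            ext x
            simp
          have h4 := (reflectIso d).measurePreserving.setIntegral_preimage_emb
            (reflectIso d).toHomeomorph.measurableEmbedding (fun x => P x ^ 2)
            (ball (0 : Space d) 1)
          rw [hpre] at h4
          simp only [reflectIso_apply] at h4
          rw [integral_add (iball (fun x => P x ^ 2 / 2) ((hP.pow 2).div_const 2))
            (iball (fun x => P (reflect x) ^ 2 / 2) (((hP.comp hRc).pow 2).div_const 2)),
            integral_div, integral_div, h4]
          ring
  have hpos : (0 : ℝ) < d + 1 + 2 * n := by positivity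
  rw [h1, div_le_iff₀ hpos] at h3
  have h5 := hemi_abs_sq_le hq
  have hs0 : 0 ≤ (hemiMeasure d).real univ := measureReal_nonneg
  rw [← Real.sqrt_mul (by positivity)]
  refine Real.le_sqrt_of_sq_le (h5.trans ?_)
  have := mul_le_mul_of_nonneg_left h3 (show 0 ≤ (hemiMeasure d).real univ + 1 by positivity)
  linarith

theorem contDiff_polyFun (p : MvPolynomial (Fin (d + 1)) ℝ) {n : WithTop ℕ∞} :
    ContDiff ℝ n (polyFun p : Space d → ℝ) := by
  induction p using MvPolynomial.induction_on with
  | C a =>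
    have : (polyFun (MvPolynomial.C a) : Space d → ℝ) = fun _ => a := by ext x; simp [polyFun]
    rw [this]
    exact contDiff_const
  | add p q hp hq =>
    have : (polyFun (p + q) : Space d → ℝ) = fun x => polyFun p x + polyFun q x := by
      ext x; simp [polyFun]
    rw [this]
    exact hp.add hq
  | mul_X p i hp =>
    have : (polyFun (p * MvPolynomial.X i) : Space d → ℝ) = fun x => polyFun p x * x i := by
      ext x; simp [polyFun]
    rw [this]
    exact hp.mul (EuclideanSpace.proj (𝕜 := ℝ) i).contDiff

theorem pd_polyFun (i : Fin (d + 1)) (p : MvPolynomial (Fin (d + 1)) ℝ) :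
    pd i (polyFun p : Space d → ℝ) = polyFun (MvPolynomial.pderiv i p) := by
  have hdiff : ∀ p : MvPolynomial (Fin (d + 1)) ℝ, Differentiable ℝ (polyFun p : Space d → ℝ) :=
    fun p => (contDiff_polyFun p (n := 1)).differentiable one_ne_zero
  induction p using MvPolynomial.induction_on with
  | C a =>
    have : (polyFun (MvPolynomial.C a) : Space d → ℝ) = fun _ => a := by ext x; simp [polyFun]
    ext x
    simp only [pd]
    rw [this]
    simp [polyFun]
  | add p q hp hq =>
    have : (polyFun (p + q) : Space d → ℝ) = fun x => polyFun p x + polyFun q x := by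
      ext x; simp [polyFun]
    ext x
    have h1 := congrFun hp x
    have h2 := congrFun hq x
    simp only [pd] at h1 h2 ⊢
    rw [this, fderiv_fun_add (hdiff p x) (hdiff q x), add_apply, h1, h2]
    simp [polyFun]
  | mul_X p j hp =>
    have : (polyFun (p * MvPolynomial.X j) : Space d → ℝ) =
        fun x => polyFun p x * EuclideanSpace.proj (𝕜 := ℝ) j x := by
      ext x; simp [polyFun]
    ext x
    have h1 := congrFun hp x
    simp only [pd] at h1 ⊢
    rw [this, fderiv_fun_mul (hdiff p x) (ContinuousLinearMap.differentiableAt _)]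
    simp only [ContinuousLinearMap.fderiv, add_apply, smul_apply, h1]
    by_cases h : i = j
    · subst h
      simp [polyFun]
    · simp [polyFun, MvPolynomial.pderiv_X_of_ne (Ne.symm h), Ne.symm h]

theorem polyFun_smul {p : MvPolynomial (Fin (d + 1)) ℝ} {n : ℕ} (hp : p.IsHomogeneous n) (t : ℝ)
    (x : Space d) : polyFun p (t • x) = t ^ n * polyFun p x := by
  simp only [polyFun]
  rw [MvPolynomial.eval_eq, MvPolynomial.eval_eq, Finset.mul_sum]
  refine Finset.sum_congr rfl fun s hs => ?_
  have hdeg := hp (MvPolynomial.mem_support_iff.1 hs)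
  have h1 : s.degree = n := by
    rw [← hdeg, Finsupp.degree_eq_weight_one]
    rfl
  simp only [PiLp.smul_apply, smul_eq_mul, mul_pow]
  rw [Finset.prod_mul_distrib, Finset.prod_pow_eq_pow_sum]
  have h2 : ∑ i ∈ s.support, s i = n := by rw [← h1]; rfl
  rw [h2]
  ring

theorem IsAdmissiblePoly.sum_pd {κ : ℕ} {p : MvPolynomial (Fin (d + 1)) ℝ}
    (hp : IsAdmissiblePoly κ p) (x : Space d) :
    ∑ i, pd i (pd i (polyFun p : Space d → ℝ)) x = 0 := by
  simp only [pd_polyFun]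
  have := congrArg (fun q => polyFun q x) hp.harmonic
  simpa [polyFun, map_sum] using this

/-! ### Decay from the frequency limit -/

/-- If the generalized frequency tends to `n - 1 + 2κ` with `κ < k`, the truncation in its
definition is inactive at small radii, and the height decays almost like `r ^ (n - 1 + 2κ)`. -/
theorem FrequencyLimit.tendsto_height {k : ℕ} {u : Space d → ℝ} {κ : ℝ} (hκ : κ < k)
    (h : FrequencyLimit k u ((d : ℝ) + 2 * κ)) {l : ℝ} (hl0 : 0 ≤ l) (hl : l < κ) :
    Tendsto (fun r : ℝ => r ^ (-((d : ℝ) + 2 * l)) * height u r) (𝓝[>] 0) (𝓝 0) := by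
  obtain ⟨C, hC, hlim⟩ := h
  -- an exponent strictly between `l` and `κ`, so that a power of `r` is left over
  set b : ℝ := (l + κ) / 2 with hb
  have hlb : l < b := by linarith
  have hbκ : b < κ := by linarith
  have hlin : Tendsto (fun r : ℝ => 1 + C * r) (𝓝[>] 0) (𝓝 1) := by
    have hc : Continuous (fun r : ℝ => 1 + C * r) := by fun_prop
    have := hc.tendsto (0 : ℝ)
    simp only [mul_zero, add_zero] at this
    exact this.mono_left nhdsWithin_le_nhds
  have hlim0 := hlim.div hlin one_ne_zero
  rw [div_one] at hlim0
  have hev := (hlim0.eventually (lt_mem_nhds (show (d : ℝ) + 2 * b < d + 2 * κ by linarith))).and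
    (hlim0.eventually (gt_mem_nhds (show (d : ℝ) + 2 * κ < d + 2 * k by linarith)))
  obtain ⟨r₀, hr₀, hIoo⟩ := mem_nhdsGT_iff_exists_Ioo_subset.1 hev
  replace hr₀ : 0 < r₀ := hr₀
  have key : ∀ r ∈ Ioo 0 r₀, 0 < height u r ∧
      (d : ℝ) + 2 * b < r * (deriv (height u) r / height u r) := by
    intro r hr
    obtain ⟨h1, h2⟩ := hIoo hr
    have h3 : (genFrequency k C u / fun r => 1 + C * r) r = genFrequency k 0 u r := by
      have : 0 < 1 + C * r := by have := hr.1; positivity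
      rw [Pi.div_apply, genFrequency_factor]
      field_simp
    simp only [h3, genFrequency] at h1 h2
    split_ifs at h1 h2 with h4
    · simp at h2
    · refine ⟨(pow_pos hr.1 _).trans (not_le.1 h4), ?_⟩
      simpa using h1
  set e : ℝ := (d : ℝ) + 2 * b with he
  have he0 : 0 < e := by have : (0 : ℝ) ≤ d := d.cast_nonneg; linarith
  have hder : ∀ r ∈ Ioo 0 r₀, HasDerivAt (fun r => r ^ (-e) * height u r)
      (-e * r ^ (-e - 1) * height u r + r ^ (-e) * deriv (height u) r) r := by
    intro r hr
    obtain ⟨h1, h2⟩ := key r hr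
    -- the lower bound on `r H' / H` excludes the value zero of `deriv` at points where `H` is not
    -- differentiable
    have hne : deriv (height u) r ≠ 0 := by
      intro h0
      rw [h0] at h2
      simp at h2
      linarith
    exact (Real.hasDerivAt_rpow_const (Or.inl hr.1.ne')).mul
      (differentiableAt_of_deriv_ne_zero hne).hasDerivAt
  -- `r H' / H > e` means that `r ^ (-e) H` is nondecreasing
  have hmono : MonotoneOn (fun r => r ^ (-e) * height u r) (Ioo 0 r₀) := by
    refine monotoneOn_of_deriv_nonneg (convex_Ioo _ _)
      (fun r hr => (hder r hr).continuousAt.continuousWithinAt) ?_ ?_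
    · rw [interior_Ioo]
      exact fun r hr => (hder r hr).differentiableAt.differentiableWithinAt
    · rw [interior_Ioo]
      intro r hr
      obtain ⟨h1, h2⟩ := key r hr
      rw [(hder r hr).deriv, Real.rpow_sub_one hr.1.ne']
      have h3 : e * height u r ≤ r * deriv (height u) r := by
        rw [← mul_div_assoc, lt_div_iff₀ h1] at h2
        exact h2.le
      have h4 : -e * (r ^ (-e) / r) * height u r + r ^ (-e) * deriv (height u) r =
          r ^ (-e) / r * (r * deriv (height u) r - e * height u r) := by
        have := hr.1.ne'
        field_simp
        ring
      rw [h4]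
      exact mul_nonneg (div_nonneg (Real.rpow_nonneg hr.1.le _) hr.1.le) (sub_nonneg.2 h3)
  set K := (r₀ / 2) ^ (-e) * height u (r₀ / 2) with hK
  have hpow : Tendsto (fun r : ℝ => r ^ (2 * (b - l)) * K) (𝓝[>] 0) (𝓝 0) := by
    have h1 : ContinuousAt (fun r : ℝ => r ^ (2 * (b - l)) * K) 0 :=
      (Real.continuousAt_rpow_const _ _ (Or.inr (by linarith))).mul continuousAt_const
    have h2 := h1.tendsto
    simp only [Real.zero_rpow (show 2 * (b - l) ≠ 0 by linarith), zero_mul] at h2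
    exact h2.mono_left nhdsWithin_le_nhds
  refine squeeze_zero' ?_ ?_ hpow
  · filter_upwards [Ioo_mem_nhdsGT hr₀] with r hr
    exact mul_nonneg (Real.rpow_nonneg hr.1.le _) (key r hr).1.le
  · filter_upwards [Ioo_mem_nhdsGT (show 0 < r₀ / 2 by positivity)] with r hr
    have h1 := hmono ⟨hr.1, by linarith [hr.2]⟩ ⟨by positivity, by linarith⟩ hr.2.le
    have h2 : r ^ (-((d : ℝ) + 2 * l)) = r ^ (2 * (b - l)) * r ^ (-e) := by
      rw [← Real.rpow_add hr.1]
      congr 1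
      rw [he]; ring
    rw [h2, mul_assoc]
    exact mul_le_mul_of_nonneg_left h1 (Real.rpow_nonneg hr.1.le _)

/-! ### Normalized solutions in half-ball form -/

theorem uniqueDiffOn_upperBall : UniqueDiffOn ℝ (upperBall d) := by
  have hconv : Convex ℝ (upperBall d) := by
    have h1 : upperBall d =
        ball (0 : Space d) 1 ∩ {x | 0 ≤ EuclideanSpace.proj (Fin.last d) x} := by
      ext x
      simp [upperBall, lastCoord]
    rw [h1]
    exact (convex_ball _ _).inter
      (convex_halfSpace_ge (EuclideanSpace.proj (𝕜 := ℝ) (Fin.last d)).isLinear 0)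
  refine uniqueDiffOn_convex hconv ⟨(1 / 2 : ℝ) • lastVec d, ?_⟩
  refine interior_maximal (show halfBall d 1 ⊆ upperBall d from fun x hx => ⟨hx.1, hx.2.le⟩)
    (isOpen_halfBall 1) ⟨?_, ?_⟩
  · rw [norm_smul, norm_lastVec]; norm_num
  · rw [lastCoord_smul]; simp [lastCoord, lastVec]

theorem norm_tang_le (x : Space d) : ‖tang x‖ ≤ ‖x‖ := by
  rw [EuclideanSpace.norm_eq, EuclideanSpace.norm_eq]
  refine Real.sqrt_le_sqrt ?_
  rw [Fin.sum_univ_castSucc (f := fun i => ‖x i‖ ^ 2)]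
  exact le_add_of_nonneg_right (sq_nonneg _)

theorem grad_eq_fderiv (u : Space d → ℝ) {x : Space d} (hx : x ∈ halfBall d 1) :
    grad u x = fderiv ℝ u x :=
  fderivWithin_of_mem_nhds (mem_of_superset ((isOpen_halfBall 1).mem_nhds hx)
    fun _ hy => ⟨hy.1, hy.2.le⟩)

/-- A normalized solution is a solution of the thin obstacle problem in its half-ball form. The
right hand side is set to zero on the null set where its bound fails. -/
theorem IsNormalizedSolution.exists_isSignorini {k : ℕ} {M : ℝ} {u : Space d → ℝ}
    (h : IsNormalizedSolution k M u) : 0 ≤ M ∧ ∃ f, IsSignorini k u f M := by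
  have h0 : (0 : Space d) ∈ upperBall d := by simp [upperBall, lastCoord]
  have hM : 0 ≤ M := (abs_nonneg _).trans (h.bound 0 h0)
  have hsub : halfBall d 1 ⊆ upperBall d := fun x hx => ⟨hx.1, hx.2.le⟩
  refine ⟨hM, ?_⟩
  obtain ⟨f, hfm, hfb, hfw⟩ := h.laplacian_le
  classical
  set S : Set (Space d) := {x | |f x| ≤ M * ‖x‖ ^ (k - 1)} with hS
  have hSm : MeasurableSet S := measurableSet_le hfm.abs (by fun_prop)
  have hbd : ∀ x, |S.indicator f x| ≤ M * ‖x‖ ^ (k - 1) := by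
    intro x
    by_cases hx : x ∈ S
    · rw [indicator_of_mem hx]; exact hx
    · rw [indicator_of_notMem hx, abs_zero]; positivity
  have hae : ∀ᵐ x ∂volume.restrict (upperHalfBall d), S.indicator f x = f x := by
    filter_upwards [hfb] with x hx
    have hxS : x ∈ S := hx.trans (mul_le_mul_of_nonneg_left
      (pow_le_pow_left₀ (norm_nonneg _) (norm_tang_le x) _) hM)
    exact indicator_of_mem hxS f
  have hw : HasWeakLaplacian u (S.indicator f) := by
    intro ζ h1 h2 h3
    rw [hfw ζ h1 h2 h3]
    refine integral_congr_ae ?_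
    filter_upwards [hae] with x hx
    rw [hx]
  have hws : IsWeakSolution u (S.indicator f) M M :=
    hw.isWeakSolution (h.regular.1.mono hsub) (fun x hx => h.bound x (hsub hx))
      (fun x hx => by rw [← grad_eq_fderiv u hx]; exact h.grad_bound x (hsub hx))
      (hfm.indicator hSm) (fun x hx => (hbd x).trans (mul_le_of_le_one_right hM
        (pow_le_one₀ (norm_nonneg x) hx.1.le)))
  refine ⟨S.indicator f, ⟨hws, h.regular.1.continuousOn, h.nonneg, ?_, fun x _ => hbd x⟩⟩
  intro R hR w hwc hw0 ε hε
  have hRs : {x : Space d | ‖x‖ ≤ R ∧ 0 ≤ lastCoord x} ⊆ upperBall d :=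
    fun x hx => ⟨hx.1.trans_lt hR, hx.2⟩
  have hnc : ContinuousOn (normalDeriv u) (upperBall d) :=
    (h.regular.1.continuousOn_fderivWithin uniqueDiffOn_upperBall le_rfl).clm_apply
      continuousOn_const
  obtain ⟨δ, hδ, hle⟩ := le_of_thin_nonpos (G := fun x => normalDeriv u x * (w x - u x))
    ((hnc.mono hRs).mul (hwc.sub (h.regular.1.continuousOn.mono hRs)))
    (fun x hx hx0 => by
      have hxt : x ∈ thinBall d 1 := ⟨hx.trans_lt hR, hx0⟩
      have h1 := h.normal_nonneg x hxt
      have h2 := h.complementarity x hxt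
      nlinarith [mul_nonneg h1 (hw0 x hx hx0)]) hε
  refine ⟨δ, hδ, fun x hx hxδ => ?_⟩
  have h3 := hle x hx hxδ
  have h4 : pd (Fin.last d) u x = normalDeriv u x := by
    rw [normalDeriv, grad_eq_fderiv u (halfBall_mono hR.le hx)]
    rfl
  rw [h4]
  exact h3

/-! ### The Monneau functional of a normalized solution -/

theorem height_eq_hemi {u : Space d → ℝ} {N : ℝ}
    (hev : ∀ x : Space d, ‖x‖ < 1 → u (reflect x) = u x)
    (huc : ContinuousOn u (halfBall d 1)) (hN : ∀ x ∈ halfBall d 1, |u x| ≤ N) {r : ℝ}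
    (hr : 0 < r) (hr1 : r < 1) : height u r = 2 * r ^ d * hemi (fun x => u x ^ 2) r := by
  have hc : ContinuousOn (fun x => u x ^ 2) (halfBall d 1) := huc.pow 2
  have hR : ∀ x ∈ halfBall d 1, u (reflect x) ^ 2 = u x ^ 2 := fun x hx => by rw [hev x hx.1]
  rw [height, sphereIntegral, integral_toSphere_eq_hemi (F := fun x => u x ^ 2)
    (integrable_comp_smul hr hr1 hc fun x hx => abs_sq_le_of (hN x hx))
    (integrable_comp_smul (F := fun x => u (reflect x) ^ 2) hr hr1 (hc.congr hR)
      fun x hx => by rw [hR x hx]; exact abs_sq_le_of (hN x hx)), hemi_congr hr hr1 hR]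
  ring

/-- Splitting the competitor into its even and odd parts, the Monneau functional of an even function
is that of the even part on the hemisphere, up to a constant. -/
theorem monneau_eq_hemi {u : Space d → ℝ} {N : ℝ}
    (hev : ∀ x : Space d, ‖x‖ < 1 → u (reflect x) = u x)
    (huc : ContinuousOn u (halfBall d 1)) (hN : ∀ x ∈ halfBall d 1, |u x| ≤ N) {n : ℕ}
    {p : MvPolynomial (Fin (d + 1)) ℝ} (hp : p.IsHomogeneous n) {r : ℝ}
    (hr : 0 < r) (hr1 : r < 1) :
    monneau n u p r =
      2 * (((r ^ n) ^ 2)⁻¹ * hemi (fun x => (u x - evenPart (polyFun p) x) ^ 2) r) +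
        2 * hemi (fun x => oddPart (polyFun p) x ^ 2) 1 := by
  set P : Space d → ℝ := polyFun p with hP
  have hPd : ContDiff ℝ 1 P := contDiff_polyFun p
  have hbound : ∀ g : Space d → ℝ, ContDiff ℝ 1 g →
      ContinuousOn (fun x => (u x - g x) ^ 2) (halfBall d 1) ∧
        ∃ C, ∀ x ∈ halfBall d 1, |(u x - g x) ^ 2| ≤ C := by
    intro g hg
    obtain ⟨L, hL, -⟩ := exists_bound_halfBall hg
    exact ⟨(huc.sub hg.continuous.continuousOn).pow 2, _, fun x hx =>
      abs_sq_le_of ((abs_sub _ _).trans (add_le_add (hN x hx) (hL x hx)))⟩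
  obtain ⟨c1, C1, b1⟩ := hbound P hPd
  obtain ⟨c2, C2, b2⟩ := hbound (fun x => P (reflect x)) (hPd.comp contDiff_reflect)
  obtain ⟨c3, C3, b3⟩ := hbound (evenPart P) (contDiff_evenPart hPd)
  have ho := contDiff_oddPart hPd
  obtain ⟨L, hL, -⟩ := exists_bound_halfBall ho
  have hR : ∀ x ∈ halfBall d 1, (u (reflect x) - P (reflect x)) ^ 2 = (u x - P (reflect x)) ^ 2 :=
    fun x hx => by rw [hev x hx.1]
  have hsplit : hemi (fun x => (u x - P x) ^ 2) r + hemi (fun x => (u x - P (reflect x)) ^ 2) r =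
      2 * hemi (fun x => (u x - evenPart P x) ^ 2) r + 2 * hemi (fun x => oddPart P x ^ 2) r := by
    have c4 : ContinuousOn (fun x => oddPart P x ^ 2) (halfBall d 1) :=
      (ho.continuous.pow 2).continuousOn
    rw [← mul_add, ← hemi_add hr hr1 c1 b1 c2 b2,
      ← hemi_add hr hr1 c3 b3 c4 (fun x hx => abs_sq_le_of (hL x hx)), ← hemi_const_mul]
    congr 1
    ext x
    simp only [evenPart, oddPart]
    ring
  have hodd : hemi (fun x => oddPart P x ^ 2) r =
      (r ^ n) ^ 2 * hemi (fun x => oddPart P x ^ 2) 1 := by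
    simp only [hemi]
    rw [← integral_const_mul]
    refine integral_congr_ae (Eventually.of_forall fun y => ?_)
    simp only [oddPart, one_smul, reflect_smul, hP, polyFun_smul hp]
    ring
  rw [monneau, sphereIntegral, integral_toSphere_eq_hemi (F := fun x => (u x - P x) ^ 2)
    (integrable_comp_smul hr hr1 c1 b1)
    (integrable_comp_smul (F := fun x => (u (reflect x) - P (reflect x)) ^ 2) hr hr1 (c2.congr hR)
      fun x hx => by rw [hR x hx]; exact b2 x hx), hemi_congr hr hr1 hR, hsplit, hodd, pow_add,
    pow_mul']
  have hrd : 0 < r ^ d := pow_pos hr d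
  have hrn : 0 < r ^ n := pow_pos hr n
  field_simp

/-- The constant in the Monneau monotonicity formula. The absolute value makes it nonnegative also
for `M < 0`, when the class of solutions is empty. -/
def monneauConst (d n : ℕ) (M : ℝ) : ℝ :=
  4 * (M ^ 2 * (volume : Measure (Space d)).real (halfBall d 1) / 4 +
    |M| * (((hemiMeasure d).real univ + growthConst d n M) / 2 +
      √(((hemiMeasure d).real univ + 1) * (d + 1 + 2 * n))))

theorem monneauConst_nonneg (d n : ℕ) (M : ℝ) : 0 ≤ monneauConst d n M := by
  have h1 : 0 ≤ (volume : Measure (Space d)).real (halfBall d 1) := measureReal_nonneg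
  have h2 : 0 ≤ (hemiMeasure d).real univ := measureReal_nonneg
  have h3 := growthConst_nonneg (d := d) n M
  unfold monneauConst
  positivity

/-- The Monneau monotonicity formula for normalized solutions on `(0, 1 / 2)`. -/
theorem IsNormalizedSolution.hasDerivAt_monneau {k m : ℕ} {M : ℝ} {u : Space d → ℝ}
    (h : IsNormalizedSolution k M u) (hd : 1 ≤ d) (hm : 1 ≤ m) (hk : 2 * m < k)
    (hs : IsSingularOrigin k ((2 * m : ℕ) : ℝ) u) {p : MvPolynomial (Fin (d + 1)) ℝ}
    (hp : IsAdmissiblePoly (2 * m) p) {r : ℝ} (hr : 0 < r) (hr2 : r < 1 / 2) :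
    ∃ D, HasDerivAt (monneau (2 * m) u p) D r ∧
      -monneauConst d (2 * m) M * (1 + polyL2Norm p) ≤ D := by
  obtain ⟨hM, f, hS⟩ := h.exists_isSignorini
  have huc := hS.contDiffOn.continuousOn
  set P : Space d → ℝ := polyFun p with hP
  have hPd : ContDiff ℝ 2 P := contDiff_polyFun p
  have hP1 : Differentiable ℝ P := hPd.differentiable two_ne_zero
  have hPhom : ∀ t : ℝ, ∀ x, P (t • x) = t ^ (2 * m) * P x := polyFun_smul hp.homogeneous
  have hdecay : ∀ l : ℝ, 1 ≤ l → l < (2 * m : ℕ) →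
      Tendsto (fun r : ℝ => r ^ (-(2 * l)) * hemi (fun x => u x ^ 2) r) (𝓝[>] 0) (𝓝 0) := by
    intro l hl hlm
    have h1 := (hs.frequency.tendsto_height (by exact_mod_cast hk) (by linarith) hlm).const_mul
      (1 / 2 : ℝ)
    rw [mul_zero] at h1
    refine h1.congr' ?_
    filter_upwards [Ioo_mem_nhdsGT one_pos] with t ht
    rw [height_eq_hemi h.even huc hS.abs_le ht.1 ht.2, neg_add, Real.rpow_add ht.1,
      Real.rpow_neg ht.1.le, Real.rpow_natCast]
    have : 0 < t ^ d := pow_pos ht.1 d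
    field_simp
  obtain ⟨D, hD, hge⟩ := hS.hasDerivAt_monneau hd hM (n := 2 * m) (by omega) (by omega) hdecay
    (contDiff_evenPart hPd)
    (fun t x => by simp only [evenPart, reflect_smul, hPhom]; ring)
    (harmonic_evenPart hPd hp.sum_pd) (fun x hx => pd_last_evenPart hP1 hx)
    (fun x hx => by rw [evenPart_of_lastCoord_eq_zero P hx]; exact hp.nonneg x hx) hr hr2
  refine ⟨2 * D, ?_, ?_⟩
  · refine ((hD.const_mul 2).add_const
      (2 * hemi (fun x => oddPart P x ^ 2) 1)).congr_of_eventuallyEq ?_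
    filter_upwards [Ioo_mem_nhds hr (show r < 1 by linarith)] with t ht
    exact monneau_eq_hemi h.even huc hS.abs_le hp.homogeneous ht.1 ht.2
  · have hQ := hemi_abs_evenPart_le hPd.continuous hPhom
    have hL : √(∫ x in ball (0 : Space d) 1, P x ^ 2) = polyL2Norm p := rfl
    rw [hL] at hQ
    have hL0 : 0 ≤ polyL2Norm p := Real.sqrt_nonneg _
    have h1 : 0 ≤ (volume : Measure (Space d)).real (halfBall d 1) := measureReal_nonneg
    have h2 : 0 ≤ (hemiMeasure d).real univ := measureReal_nonneg
    have h3 := growthConst_nonneg (d := d) ((2 * m : ℕ) : ℝ) M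
    rw [monneauConst, abs_of_nonneg hM]
    set Q := hemi (fun x => |evenPart P x|) 1
    set σ := (hemiMeasure d).real univ
    set a := M ^ 2 * (volume : Measure (Space d)).real (halfBall d 1) / 4 with ha
    set b := (σ + growthConst d ((2 * m : ℕ) : ℝ) M) / 2 with hb
    set c := √((σ + 1) * (d + 1 + 2 * ((2 * m : ℕ) : ℝ)))
    have ha0 : 0 ≤ a := by positivity
    have hb0 : 0 ≤ b := by positivity
    have hc0 : 0 ≤ c := Real.sqrt_nonneg _
    have h4 : M * Q ≤ M * (c * polyL2Norm p) := mul_le_mul_of_nonneg_left hQ hM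
    have h5 : 0 ≤ a * polyL2Norm p + M * b * polyL2Norm p + M * c := by positivity
    linarith

end ThinObstacle

end

theorem mainTheorem10 (d k m : ℕ) (hd : 1 ≤ d) (hm : 1 ≤ m) (hk : 2 * m < k) (M : ℝ) :
    ∃ rM CM : ℝ, 0 < rM ∧ rM ≤ 1 ∧ 0 ≤ CM ∧
      ∀ u : ThinObstacle.Space d → ℝ,
        ThinObstacle.IsNormalizedSolution k M u →
        ThinObstacle.IsSingularOrigin k ((2 * m : ℕ) : ℝ) u →
        ∀ p : MvPolynomial (Fin (d + 1)) ℝ, ThinObstacle.IsAdmissiblePoly (2 * m) p →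
          ∀ r : ℝ, 0 < r → r < rM →
            DifferentiableAt ℝ (ThinObstacle.monneau (2 * m) u p) r ∧
            -CM * (1 + ThinObstacle.polyL2Norm p) ≤
              deriv (ThinObstacle.monneau (2 * m) u p) r := by
  refine ⟨1 / 2, ThinObstacle.monneauConst d (2 * m) M, by norm_num, by norm_num,
    ThinObstacle.monneauConst_nonneg d (2 * m) M, fun u hu hs p hp r hr hr2 => ?_⟩
  obtain ⟨D, hD, hge⟩ := hu.hasDerivAt_monneau hd hm hk hs hp hr hr2
  exact ⟨hD.differentiableAt, by rwa [hD.deriv]⟩
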